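/- Let $m,s,n$ be positive integers with $s\ge 2$ and $n\ge 3$, and let $r\in\mathbb{Z}_n^*$ satisfy $r^{ms}=1$ or $r^{ms}=-1$ in $\mathbb{Z}_n$. Let $\overline{\mathrm{CPM}}(m,s,n;r)$ be the graph whose vertices are the pairs $\langle i;\mathbf v\rangle$ with $i\in\mathbb{Z}_{ms}$ and $\mathbf v=(v_0,\dots,v_{s-1})\in\mathbb{Z}_n^s$, and in which $$\langle i;\mathbf v\rangle\sim\langle i+1;\mathbf v\pm r^i\mathbf e_\ell\rangle,\qquad \ell = i \bmod s,$$ where $\mathbf e_0,\dots,\mathbf e_{s-1}$ are the standard vectors. Let $\Gamma=\mathrm{CPM}(m,s,n;r)$ be its connected component containing $\langle 0;\mathbf 0\rangle$. Let $\bar G=\langle\bar\sigma,\bar\rho_0,\bar\tau_0\rangle$, where $$\langle i;\mathbf v\rangle\bar\rho_0=\langle i;\mathbf v+\mathbf e_0\rangle,\qquad \langle i;\mathbf v\rangle\bar\tau_0=\langle i;(-v_0,v_1,\dots,v_{s-1})\rangle,\qquad \langle i;\mathbf v\rangle\bar\sigma=\langle i+1;(rv_{s-1},rv_0,\dots,rv_{s-2})\rangle,$$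 and let $G\le\mathrm{Aut}(\Gamma)$ be the group induced on $V(\Gamma)$ by the setwise stabilizer of $V(\Gamma)$ in $\bar G$. Define also $$\langle i;\mathbf v\rangle\bar\eta=\langle -i;(r^{-2s+1}v_{s-1},r^{-2s+3}v_{s-2},\dots,r^{-3}v_1,r^{-1}v_0)\rangle,$$ $$\langle i;\mathbf v\rangle\bar\eta'=\langle -i;(r^{-2s+1}v_{s-1}+\delta_0,r^{-2s+3}v_{s-2}+\delta_1,\dots,r^{-1}v_0+\delta_{s-1})\rangle,$$ where, $i_{4s}\in\{0,\dots,4s-1\}$ denoting the remainder of $i$ modulo $4s$, $\delta_j=n/2$ if $2s\le i_{4s}+j\le 4s-1$ and $\delta_j=0$ otherwise. The map $\bar\eta'$ is used only if $2(r^{2s}\pm1)=0$ but $r^{2s}\neq\pm1$, in which case $4\mid n$ and $4\mid m$. For integers $t\ge 3$ and $k\ge 1$, the Praeger--Xu graph $\mathrm{PX}(t,k)$ has vertex set $\mathbb{Z}_t\times\mathbb{Z}_2^k$, and $(i,(v_0,\dots,v_{k-1}))$ is adjacent to $(i+1,(v_1,\dots,v_{k-1},a))$ for $a\in\{0,1\}$.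 A graph is arc-transitive (respectively $2$-arc-transitive) if its automorphism group is transitive on the ordered pairs of adjacent vertices (respectively on the triples $(a,b,c)$ of vertices with $a\sim b\sim c$ and $a\ne c$). Then: (1) $\Gamma$ is arc-transitive if and only if $2(r^{2s}+1)=0$ or $2(r^{2s}-1)=0$ in $\mathbb{Z}_n$. (2) If $\Gamma$ is arc-transitive but not $2$-arc-transitive, then at least one of the following holds: (a) $n=4$ and, with $M=m$ if $m$ is even and $M=2m$ if $m$ is odd, $\Gamma\cong\mathrm{CPM}(M,s,4;1)\cong\mathrm{PX}(Ms,s)$, and all vertex-stabilizers in $\mathrm{Aut}(\Gamma)$ have order $2^{s(M-1)+1}$; (b) $\mathrm{Aut}(\Gamma)$ is generated by $G$ together with the restriction to $\Gamma$ (which is an automorphism of $\Gamma$) of $\bar\eta$ if $r^{2s}=\pm1$, and of $\bar\eta'$ if $r^{2s}\ne\pm1$; and all vertex-stabilizers in $\mathrm{Aut}(\Gamma)$ have order $2^{s+1}$. -/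

import Mathlib

/-! ## Symmetry of graphs -/

/-- `Aut(Γ)` is `Γ ≃g Γ`.  `Γ` is arc-transitive if `Aut(Γ)` is transitive on the arcs of `Γ`, i.e.
on the ordered pairs of adjacent vertices. -/
def IsArcTransitive {V : Type*} (Γ : SimpleGraph V) : Prop :=
  ∀ a b a' b' : V, Γ.Adj a b → Γ.Adj a' b' → ∃ φ : Γ ≃g Γ, φ a = a' ∧ φ b = b'

/-- `Γ` is `2`-arc-transitive if `Aut(Γ)` is transitive on the `2`-arcs of `Γ`, i.e. on the triples
`(a, b, c)` of vertices with `a ∼ b ∼ c` and `a ≠ c`. -/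
def IsTwoArcTransitive {V : Type*} (Γ : SimpleGraph V) : Prop :=
  ∀ a b c a' b' c' : V, Γ.Adj a b → Γ.Adj b c → a ≠ c → Γ.Adj a' b' → Γ.Adj b' c' → a' ≠ c' →
    ∃ φ : Γ ≃g Γ, φ a = a' ∧ φ b = b' ∧ φ c = c'

/-- All vertex stabilizers in `Aut(Γ)` have order `k`. -/
def HasVertexStabilizersOfOrder {V : Type*} (Γ : SimpleGraph V) (k : ℕ) : Prop :=
  ∀ x : V, Nat.card (MulAction.stabilizer (Γ ≃g Γ) x) = k

namespace CPM

/-! ## The graphs -/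

/-- The pairs `⟨i; v⟩` with `i ∈ ℤ_{ms}` and `v ∈ ℤ_n^s`.  For `s ≥ 1` the components
`v_0, …, v_{s-1}` are indexed by the residues modulo `s`. -/
abbrev Vertex (m s n : ℕ) : Type := ZMod (m * s) × (ZMod s → ZMod n)

/-- For `i ∈ ℤ_{ms}`, the residue `ℓ = i mod s`. -/
def label {m s : ℕ} (i : ZMod (m * s)) : ZMod s := ZMod.castHom (Dvd.intro_left m rfl) (ZMod s) i

/-- The vector `r ^ i • e_ℓ` where `ℓ = i mod s`, with the exponent `i` represented in
`{0, …, ms - 1}`.  When `r ^ (ms) = ±1`, another representative changes it at most by a sign. -/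
def shift {m s n : ℕ} (r : (ZMod n)ˣ) (i : ZMod (m * s)) : ZMod s → ZMod n :=
  Pi.single (label i) ((r : ZMod n) ^ i.val)

/-- The graph `CPM̄(m,s,n;r)`, with `⟨i; v⟩ ∼ ⟨i + 1; v ± r ^ i • e_ℓ⟩`, `ℓ = i mod s`. -/
def fullGraph (m s n : ℕ) (r : (ZMod n)ˣ) : SimpleGraph (Vertex m s n) :=
  SimpleGraph.fromRel fun x y =>
    y.1 = x.1 + 1 ∧ (y.2 = x.2 + shift r x.1 ∨ y.2 = x.2 - shift r x.1)

/-- The vertex set of the connected component of `CPM̄(m,s,n;r)` that contains `⟨0; 0⟩`. -/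
def verts (m s n : ℕ) (r : (ZMod n)ˣ) : Set (Vertex m s n) :=
  {x | (fullGraph m s n r).Reachable (0, 0) x}

/-- The graph `CPM(m,s,n;r)`: the connected component of `⟨0; 0⟩` in `CPM̄(m,s,n;r)`. -/
def graph (m s n : ℕ) (r : (ZMod n)ˣ) : SimpleGraph (verts m s n r) :=
  (fullGraph m s n r).induce (verts m s n r)

/-! ## The group `G` -/

/-- `ρ̄_ℓ : ⟨i; v⟩ ↦ ⟨i; v + e_ℓ⟩`. -/
def rho (m s n : ℕ) (l : ZMod s) : Equiv.Perm (Vertex m s n) where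
  toFun x := (x.1, x.2 + Pi.single l 1)
  invFun x := (x.1, x.2 - Pi.single l 1)
  left_inv x := by simp
  right_inv x := by simp

/-- `τ̄_ℓ : ⟨i; v⟩ ↦ ⟨i; (v_0, …, v_{ℓ-1}, -v_ℓ, v_{ℓ+1}, …, v_{s-1})⟩`. -/
def tau (m s n : ℕ) (l : ZMod s) : Equiv.Perm (Vertex m s n) where
  toFun x := (x.1, fun j => if j = l then -x.2 j else x.2 j)
  invFun x := (x.1, fun j => if j = l then -x.2 j else x.2 j)
  left_inv x := by
    refine Prod.ext rfl (funext fun j => ?_)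
    by_cases h : j = l <;> simp [h]
  right_inv x := by
    refine Prod.ext rfl (funext fun j => ?_)
    by_cases h : j = l <;> simp [h]

/-- `σ̄ : ⟨i; v⟩ ↦ ⟨i + 1; (r v_{s-1}, r v_0, r v_1, …, r v_{s-2})⟩`. -/
def sigma (m s n : ℕ) (r : (ZMod n)ˣ) : Equiv.Perm (Vertex m s n) where
  toFun x := (x.1 + 1, fun j => (r : ZMod n) * x.2 (j - 1))
  invFun x := (x.1 - 1, fun j => ((r⁻¹ : (ZMod n)ˣ) : ZMod n) * x.2 (j + 1))
  left_inv x := by simp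
  right_inv x := by simp

/-- The group `Ḡ = ⟨σ̄, ρ̄_0, τ̄_0⟩`. -/
def fullGroup (m s n : ℕ) (r : (ZMod n)ˣ) : Subgroup (Equiv.Perm (Vertex m s n)) :=
  Subgroup.closure {sigma m s n r, rho m s n 0, tau m s n 0}

/-- The automorphism `φ` of `CPM(m,s,n;r)` is the restriction of the map `f` on the vertices of
`CPM̄(m,s,n;r)`. -/
def IsRestriction {m s n : ℕ} {r : (ZMod n)ˣ} (φ : graph m s n r ≃g graph m s n r)
    (f : Vertex m s n → Vertex m s n) : Prop :=
  ∀ x : verts m s n r, (φ x : Vertex m s n) = f x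

/-- The group `G ≤ Aut(CPM(m,s,n;r))` of the restrictions to `CPM(m,s,n;r)` of the elements of the
setwise stabilizer of its vertex set in `Ḡ`. -/
def group (m s n : ℕ) (r : (ZMod n)ˣ) : Subgroup (graph m s n r ≃g graph m s n r) where
  carrier := {φ | ∃ g ∈ fullGroup m s n r, g '' verts m s n r = verts m s n r ∧ IsRestriction φ g}
  one_mem' := ⟨1, one_mem _, by simp, fun _ => rfl⟩
  mul_mem' := by
    rintro φ ψ ⟨g, hg, hgV, hgφ⟩ ⟨h, hh, hhV, hhψ⟩
    refine ⟨g * h, mul_mem hg hh, ?_, fun x => ?_⟩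
    · rw [Equiv.Perm.coe_mul, Set.image_comp, hhV, hgV]
    · rw [Equiv.Perm.mul_apply, ← hhψ x, ← hgφ (ψ x)]
      rfl
  inv_mem' := by
    rintro φ ⟨g, hg, hgV, hgφ⟩
    refine ⟨g⁻¹, inv_mem hg, ?_, fun x => ?_⟩
    · conv_lhs => rw [← hgV]
      rw [← Set.image_comp, ← Equiv.Perm.coe_mul, inv_mul_cancel]
      simp
    · rw [Equiv.Perm.eq_inv_iff_eq, ← hgφ]
      exact congrArg Subtype.val (RelIso.apply_symm_apply φ x)

/-! ## The reflections -/

/-- `η̄ : ⟨i; v⟩ ↦ ⟨-i; (r^{-2s+1} v_{s-1}, r^{-2s+3} v_{s-2}, …, r^{-3} v_1, r^{-1} v_0)⟩`; the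
component `j`, `0 ≤ j < s`, of the image vector is `r^{2j-2s+1} v_{s-1-j}`. -/
def eta (m s n : ℕ) (r : (ZMod n)ˣ) (x : Vertex m s n) : Vertex m s n :=
  (-x.1, fun j => ((r ^ (2 * (j.val : ℤ) - 2 * (s : ℤ) + 1) : (ZMod n)ˣ) : ZMod n) * x.2 (-1 - j))

/-- The offset `δ_j`, which is `n / 2` if `2s ≤ i_{4s} + j ≤ 4s - 1` and `0` otherwise, where
`i_{4s}` is the remainder of `i` modulo `4s`.  (It is only used when `4 ∣ n` and `4 ∣ m`.) -/
def delta {m s n : ℕ} (i : ZMod (m * s)) (j : ZMod s) : ZMod n :=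
  if 2 * s ≤ i.val % (4 * s) + j.val ∧ i.val % (4 * s) + j.val ≤ 4 * s - 1 then
    ((n / 2 : ℕ) : ZMod n) else 0

/-- `η̄' : ⟨i; v⟩ ↦ ⟨-i; (r^{-2s+1} v_{s-1} + δ_0, r^{-2s+3} v_{s-2} + δ_1, …, r^{-1} v_0 + δ_{s-1})⟩`.
-/
def etaPrime (m s n : ℕ) (r : (ZMod n)ˣ) (x : Vertex m s n) : Vertex m s n :=
  ((eta m s n r x).1, fun j => (eta m s n r x).2 j + delta x.1 j)

end CPM

/-! ## Praeger–Xu graphs -/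

/-- The Praeger–Xu graph `PX(t,s)` (for `t ≥ 3`, `s ≥ 1`), with vertex set `ℤ_t × ℤ_2^s` and with
`(i, (v_0, …, v_{s-1})) ∼ (i + 1, (v_1, …, v_{s-1}, a))` for `a ∈ {0, 1}`. -/
def praegerXu (t s : ℕ) : SimpleGraph (ZMod t × (Fin s → ZMod 2)) :=
  SimpleGraph.fromRel fun x y =>
    y.1 = x.1 + 1 ∧
      ∀ (j : ℕ) (hj : j + 1 < s), y.2 ⟨j, Nat.lt_of_succ_lt hj⟩ = x.2 ⟨j + 1, hj⟩

/-!
Write `Γ` for `CPM(m,s,n;r)` and orient its edges from level `i` to level `i + 1`, so that every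
vertex has two out-neighbours and two in-neighbours. A `2`-arc is a turn if it changes direction at
its middle vertex, and straight otherwise.

The group `G` is transitive on the vertices, with an arbitrary choice of the images of the two
out-neighbours and of the two in-neighbours (`CPM.Admissible.group_transitive`). Therefore, if `Γ`
is arc-transitive and some automorphism maps a turn to a straight `2`-arc, then `Γ` is
`2`-arc-transitive (`CPM.Admissible.isTwoArcTransitive_of_turn`). Otherwise all automorphisms map
turns to turns, and by connectedness each of them preserves or reverses the orientation as a whole
(`CPM.Admissible.preserves_or_reverses`).

For `n ≠ 4` the orientation is rigid. Along an alternating path an arc-preserving map carries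
`v ↦ v + 2k w` to `v ↦ v ± 2k w'`, where `w` and `w'` are the weights of the edges concerned, and
this translation is inherited by all vertices of a directed path of length `s`
(`CPM.ArcMap.transport`). Consequently an orientation-preserving automorphism that fixes a directed
path of length `s` is the identity (`CPM.ArcMap.eq_id`). This shows that `G` consists of all
orientation-preserving automorphisms, with vertex stabilizers of order `2 ^ s`
(`CPM.Admissible.mem_group_iff`, `CPM.Admissible.card_preserving`). Comparing the weights of the
first and last edges of a reversed path gives `2 r ^ (2s) = ±2` as soon as there is a reversing
automorphism (`CPM.two_mul_pow_of_reverses`). Conversely, under this condition `η` or `η'` restricts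
to a reversing automorphism (`CPM.exists_eta`, `CPM.exists_etaPrime`), which together with `G`
generates everything.

For `n = 4` all weights are `±1`, and `Γ` is the Praeger–Xu graph `PX(Ms,s)`
(`CPM.exists_iso_praegerXu`), whose orientation-preserving automorphisms are the translations by
functions on the levels, combined with shifts of the levels.

It remains to see that `Γ` is not `2`-arc-transitive when `2 r ^ (2s) ≠ ±2`
(`CPM.Admissible.not_isTwoArcTransitive`). Call a `3`-arc good if it lies in a closed
non-backtracking walk of length `8`. A turn that is extended straight on is always good. For `s ≥ 3`
no straight `3`-arc is good, so a turn and a straight `2`-arc are not equivalent. For `s = 2` a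
straight `3`-arc is good only under one of three relations for `r ^ 2`, which depend on a sign
`c` (`CPM.StraightGood`), and for one of the two signs none of them holds. Hence, in a
`2`-arc-transitive graph, a turn extended by another turn is bad, which refutes the first two
relations. Under the third relation every `2`-arc has just one bad extension. Following bad
extensions from a turn and from a straight `2`-arc yields two closed paths of different lengths.
-/

namespace CPM

/-- The standing assumptions on the parameters `m`, `s`, `n`, `r`. -/
structure Admissible (m s n : ℕ) (r : (ZMod n)ˣ) : Prop where
  one_le_m : 1 ≤ m
  two_le_s : 2 ≤ s
  three_le_n : 3 ≤ n
  pow_eq : (r : ZMod n) ^ (m * s) + 1 = 0 ∨ (r : ZMod n) ^ (m * s) - 1 = 0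

variable {m s n : ℕ} {r r' : (ZMod n)ˣ}

/-! ### Signs, weights and arcs -/

/-- A permutation of a finite set that preserves a relation also reflects it. -/
lemma perm_rel_iff {α : Type*} [Finite α] (g : Equiv.Perm α) (R : α → α → Prop)
    (hg : ∀ a b, R a b → R (g a) (g b)) {a b : α} : R (g a) (g b) ↔ R a b := by
  refine ⟨fun hab => ?_, hg a b⟩
  have hk : ∀ k : ℕ, R ((g ^ k) (g a)) ((g ^ k) (g b)) := by
    intro k
    induction k with
    | zero => simpa using hab
    | succ k ih => simp only [pow_succ', Equiv.Perm.mul_apply]; exact hg _ _ ih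
  have h1 : ∀ x, (g ^ (orderOf g - 1)) (g x) = x := by
    intro x
    rw [← Equiv.Perm.mul_apply, ← pow_succ, Nat.sub_add_cancel (orderOf_pos g), pow_orderOf_eq_one]
    rfl
  simpa only [h1] using hk (orderOf g - 1)

/-- A sign, regarded as a scalar of `ℤ_n`. -/
def sg (n : ℕ) (e : ℤˣ) : ZMod n := ((e : ℤ) : ZMod n)

@[simp] lemma sg_one : sg n 1 = 1 := by simp [sg]
@[simp] lemma sg_neg (e : ℤˣ) : sg n (-e) = -sg n e := by simp [sg]
@[simp] lemma sg_mul (e f : ℤˣ) : sg n (e * f) = sg n e * sg n f := by simp [sg]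
@[simp] lemma sg_mul_self (e : ℤˣ) : sg n e * sg n e = 1 := by
  rcases Int.units_eq_one_or e with rfl | rfl <;> simp
@[simp] lemma sg_sq (e : ℤˣ) : sg n e ^ 2 = 1 := by rw [pow_two, sg_mul_self]

lemma two_ne_zero_of_three_le (hn : 3 ≤ n) : (2 : ZMod n) ≠ 0 := by
  intro h
  have h2 : ((2 : ℕ) : ZMod n) = 0 := by exact_mod_cast h
  rw [ZMod.natCast_eq_zero_iff] at h2
  have := Nat.le_of_dvd (by norm_num) h2
  omega

lemma four_ne_zero_of (hn : 3 ≤ n) (h4 : n ≠ 4) : (4 : ZMod n) ≠ 0 := by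
  intro h
  have h2 : ((4 : ℕ) : ZMod n) = 0 := by exact_mod_cast h
  rw [ZMod.natCast_eq_zero_iff] at h2
  have := Nat.le_of_dvd (by norm_num) h2
  interval_cases n <;> omega

lemma sg_injective (hn : 3 ≤ n) : Function.Injective (sg n) := by
  have h2 := two_ne_zero_of_three_le hn
  intro e f hef
  rcases Int.units_eq_one_or e with rfl | rfl <;> rcases Int.units_eq_one_or f with rfl | rfl
  · rfl
  · exact absurd (by simp at hef; linear_combination hef) h2
  · exact absurd (by simp at hef; linear_combination -hef) h2
  · rfl

/-- The weight `r ^ i` of the edges between levels `i` and `i + 1`. -/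
def wt {N : ℕ} (r : (ZMod n)ˣ) (i : ZMod N) : (ZMod n)ˣ := r ^ i.val

lemma shift_eq (i : ZMod (m * s)) : shift r i = Pi.single (label i) (wt r i : ZMod n) := by
  simp [shift, wt]

lemma label_add_one (i : ZMod (m * s)) : label (i + 1) = label i + 1 := by simp [label]

lemma label_sub_one (i : ZMod (m * s)) : label (i - 1) = label i - 1 := by simp [label]

lemma label_add_natCast (i : ZMod (m * s)) (k : ℕ) :
    label (i + (k : ZMod (m * s))) = label i + (k : ZMod s) := by simp [label]

lemma label_zero : label (0 : ZMod (m * s)) = 0 := by simp [label]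

lemma label_neg (i : ZMod (m * s)) : label (-i) = -label i := by simp [label]

lemma shift_apply_self (i : ZMod (m * s)) : shift r i (label i) = wt r i := by simp [shift_eq]

lemma shift_apply_of_ne {i : ZMod (m * s)} {l : ZMod s} (hl : l ≠ label i) : shift r i l = 0 := by
  simp [shift_eq, hl]

namespace Admissible

lemma two_le_mul (h : Admissible m s n r) : 2 ≤ m * s :=
  le_trans h.two_le_s (Nat.le_mul_of_pos_left _ h.one_le_m)

lemma neZero_mul (h : Admissible m s n r) : NeZero (m * s) := ⟨by have := h.two_le_mul; omega⟩
lemma neZero_s (h : Admissible m s n r) : NeZero s := ⟨by have := h.two_le_s; omega⟩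
lemma neZero_n (h : Admissible m s n r) : NeZero n := ⟨by have := h.three_le_n; omega⟩

lemma exists_pow_eq (h : Admissible m s n r) : ∃ e : ℤˣ, (r : ZMod n) ^ (m * s) = sg n e := by
  rcases h.pow_eq with h | h
  · exact ⟨-1, by simp; linear_combination h⟩
  · exact ⟨1, by simp; linear_combination h⟩

lemma inv (h : Admissible m s n r) : Admissible m s n r⁻¹ := by
  refine ⟨h.one_le_m, h.two_le_s, h.three_le_n, ?_⟩
  have h1 : ((r⁻¹ : (ZMod n)ˣ) : ZMod n) ^ (m * s) * (r : ZMod n) ^ (m * s) = 1 := by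
    rw [← mul_pow]; simp
  rcases h.pow_eq with h | h
  · left; linear_combination -h1 + ((r⁻¹ : (ZMod n)ˣ) : ZMod n) ^ (m * s) * h
  · right; linear_combination h1 - ((r⁻¹ : (ZMod n)ˣ) : ZMod n) ^ (m * s) * h

/-- Passing from one level to the next multiplies the weight by `r`, up to the sign `r ^ (ms)` that
may occur when the level wraps around. -/
lemma wt_add_one (h : Admissible m s n r) (i : ZMod (m * s)) :
    ∃ e : ℤˣ, (wt r (i + 1) : ZMod n) = sg n e * r * wt r i := by
  have := h.neZero_mul
  have h2 := h.two_le_mul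
  have : Fact (1 < m * s) := ⟨by omega⟩
  have hlt := ZMod.val_lt i
  by_cases hi : i.val + 1 < m * s
  · refine ⟨1, ?_⟩
    have : (i + 1).val = i.val + 1 := by
      rw [ZMod.val_add, ZMod.val_one, Nat.mod_eq_of_lt hi]
    simp [wt, this, pow_succ, mul_comm]
  · obtain ⟨e, he⟩ := h.exists_pow_eq
    refine ⟨e, ?_⟩
    have hi' : i.val + 1 = m * s := by omega
    have : (i + 1).val = 0 := by
      rw [ZMod.val_add, ZMod.val_one, hi', Nat.mod_self]
    have h3 : (r : ZMod n) * (r : ZMod n) ^ i.val = sg n e := by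
      rw [← pow_succ', hi', he]
    simp [wt, this, mul_assoc, h3]

lemma wt_add (h : Admissible m s n r) (i : ZMod (m * s)) (k : ℕ) :
    ∃ e : ℤˣ, (wt r (i + (k : ZMod (m * s))) : ZMod n) = sg n e * r ^ k * wt r i := by
  induction k with
  | zero => exact ⟨1, by simp⟩
  | succ k ih =>
    obtain ⟨e, he⟩ := ih
    obtain ⟨f, hf⟩ := h.wt_add_one (i + (k : ZMod (m * s)))
    refine ⟨f * e, ?_⟩
    push_cast
    rw [← add_assoc, hf, he, sg_mul]
    ring

end Admissible

/-- The out-neighbour of `x` obtained by adding `±r ^ i`. -/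
def step (r : (ZMod n)ˣ) (e : ℤˣ) (x : Vertex m s n) : Vertex m s n :=
  (x.1 + 1, x.2 + sg n e • shift r x.1)

/-- The in-neighbour of `x` from which `x` is obtained by `step r e`. -/
def back (r : (ZMod n)ˣ) (e : ℤˣ) (x : Vertex m s n) : Vertex m s n :=
  (x.1 - 1, x.2 - sg n e • shift r (x.1 - 1))

@[simp] lemma step_fst (e : ℤˣ) (x : Vertex m s n) : (step r e x).1 = x.1 + 1 := rfl
@[simp] lemma step_snd (e : ℤˣ) (x : Vertex m s n) :
    (step r e x).2 = x.2 + sg n e • shift r x.1 := rfl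
@[simp] lemma back_fst (e : ℤˣ) (x : Vertex m s n) : (back r e x).1 = x.1 - 1 := rfl
@[simp] lemma back_snd (e : ℤˣ) (x : Vertex m s n) :
    (back r e x).2 = x.2 - sg n e • shift r (x.1 - 1) := rfl

@[simp] lemma step_back (e : ℤˣ) (x : Vertex m s n) : step r e (back r e x) = x := by
  ext <;> simp [step, back]

@[simp] lemma back_step (e : ℤˣ) (x : Vertex m s n) : back r e (step r e x) = x := by
  ext <;> simp [step, back]

/-- The orientation of the edges of `CPM̄(m,s,n;r)` from level `i` to level `i + 1`. -/
def Arc (r : (ZMod n)ˣ) (x y : Vertex m s n) : Prop := ∃ e : ℤˣ, y = step r e x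

lemma arc_step (e : ℤˣ) (x : Vertex m s n) : Arc r x (step r e x) := ⟨e, rfl⟩

lemma arc_back (e : ℤˣ) (x : Vertex m s n) : Arc r (back r e x) x := ⟨e, by simp⟩

lemma Arc.exists_back {x y : Vertex m s n} (h : Arc r x y) : ∃ e : ℤˣ, x = back r e y := by
  obtain ⟨e, rfl⟩ := h
  exact ⟨e, by simp⟩

lemma arc_iff {x y : Vertex m s n} : Arc r x y ↔
    y.1 = x.1 + 1 ∧ (y.2 = x.2 + shift r x.1 ∨ y.2 = x.2 - shift r x.1) := by
  constructor
  · rintro ⟨e, rfl⟩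
    refine ⟨rfl, ?_⟩
    rcases Int.units_eq_one_or e with rfl | rfl <;> simp [sub_eq_add_neg]
  · rintro ⟨h1, h2 | h2⟩
    · exact ⟨1, Prod.ext h1 (by simp [h2])⟩
    · exact ⟨-1, Prod.ext h1 (by simp [h2, sub_eq_add_neg])⟩

lemma Arc.fst {x y : Vertex m s n} (h : Arc r x y) : y.1 = x.1 + 1 := (arc_iff.1 h).1

namespace Admissible

lemma one_ne_zero_s (h : Admissible m s n r) : (1 : ZMod s) ≠ 0 := by
  have := h.two_le_s
  have : Fact (1 < s) := ⟨by omega⟩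
  exact one_ne_zero

lemma wt_two_ne (h : Admissible m s n r) {N : ℕ} (i : ZMod N) : 2 * (wt r i : ZMod n) ≠ 0 := by
  intro h0
  exact two_ne_zero_of_three_le h.three_le_n
    ((Units.mul_left_eq_zero _).1 h0)

lemma step_injective_sign (h : Admissible m s n r) {e f : ℤˣ} {x : Vertex m s n}
    (hx : step r e x = step r f x) : e = f := by
  have := congrFun (congrArg Prod.snd hx) (label x.1)
  simp only [step_snd, Pi.add_apply, Pi.smul_apply, shift_apply_self, smul_eq_mul,
    add_right_inj] at this
  exact sg_injective h.three_le_n ((Units.mul_left_inj _).1 this)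

lemma back_injective_sign (h : Admissible m s n r) {e f : ℤˣ} {x : Vertex m s n}
    (hx : back r e x = back r f x) : e = f := by
  have := congrFun (congrArg Prod.snd hx) (label (x.1 - 1))
  simp only [back_snd, Pi.sub_apply, Pi.smul_apply, shift_apply_self, smul_eq_mul,
    sub_right_inj] at this
  exact sg_injective h.three_le_n ((Units.mul_left_inj _).1 this)

/-- The edges below and above a vertex change different coordinates, so that no in-neighbour is an
out-neighbour (not even if there are only two levels). -/
lemma arc_asymm (h : Admissible m s n r) {x y : Vertex m s n} (hxy : Arc r x y) : ¬ Arc r y x := by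
  rintro ⟨f, hf⟩
  obtain ⟨e, rfl⟩ := hxy
  have := congrFun (congrArg Prod.snd hf) (label x.1)
  have hne : label x.1 ≠ label (x.1 + 1) := by
    rw [label_add_one]
    intro h0
    exact h.one_ne_zero_s (by linear_combination -h0)
  simp only [step_snd, step_fst, Pi.add_apply, Pi.smul_apply, shift_apply_self, smul_eq_mul,
    shift_apply_of_ne hne] at this
  have h1 : sg n e * (wt r x.1 : ZMod n) = 0 := by linear_combination -this
  apply h.wt_two_ne x.1
  rw [Units.mul_left_eq_zero] at h1
  have := sg_mul_self (n := n) e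
  rw [h1] at this
  have h01 : (1 : ZMod n) = 0 := by simpa using this.symm
  linear_combination 2 * (wt r x.1 : ZMod n) * h01

lemma arc_irrefl (h : Admissible m s n r) (x : Vertex m s n) : ¬ Arc r x x :=
  fun hx => h.arc_asymm hx hx

lemma fullGraph_adj (h : Admissible m s n r) {x y : Vertex m s n} :
    (fullGraph m s n r).Adj x y ↔ Arc r x y ∨ Arc r y x := by
  rw [fullGraph, SimpleGraph.fromRel_adj, ← arc_iff, ← arc_iff]
  constructor
  · exact fun hx => hx.2
  · refine fun hx => ⟨?_, hx⟩
    rintro rfl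
    exact h.arc_irrefl x (hx.elim id id)

lemma mem_verts_iff_of_arc (h : Admissible m s n r) {x y : Vertex m s n} (hxy : Arc r x y) :
    x ∈ verts m s n r ↔ y ∈ verts m s n r := by
  have hadj : (fullGraph m s n r).Adj x y := h.fullGraph_adj.2 (Or.inl hxy)
  exact ⟨fun hx => SimpleGraph.Reachable.trans hx hadj.reachable,
    fun hy => SimpleGraph.Reachable.trans hy hadj.symm.reachable⟩

lemma step_mem (h : Admissible m s n r) {x : Vertex m s n} (hx : x ∈ verts m s n r) (e : ℤˣ) :
    step r e x ∈ verts m s n r := (h.mem_verts_iff_of_arc (arc_step e x)).1 hx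

lemma back_mem (h : Admissible m s n r) {x : Vertex m s n} (hx : x ∈ verts m s n r) (e : ℤˣ) :
    back r e x ∈ verts m s n r := (h.mem_verts_iff_of_arc (arc_back e x)).2 hx

end Admissible

lemma zero_mem_verts : ((0, 0) : Vertex m s n) ∈ verts m s n r := SimpleGraph.Reachable.refl _

namespace Admissible

/-- A property that holds at `⟨0; 0⟩` and passes along arcs in both directions holds on the whole
component. -/
lemma verts_induction (h : Admissible m s n r) {p : Vertex m s n → Prop} {z : Vertex m s n}
    (hzV : z ∈ verts m s n r) (hz : p z)
    (hp : ∀ x y, x ∈ verts m s n r → Arc r x y → (p x ↔ p y)) {x : Vertex m s n}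
    (hx : x ∈ verts m s n r) : p x := by
  have key : ∀ a b : Vertex m s n, (fullGraph m s n r).Reachable a b → a ∈ verts m s n r →
      p a → p b := by
    intro a b hab
    obtain ⟨w⟩ := hab
    induction w with
    | nil => exact fun _ h => h
    | @cons a c b hac _ ih =>
      intro ha hpa
      rcases h.fullGraph_adj.1 hac with h1 | h1
      · exact ih ((h.mem_verts_iff_of_arc h1).1 ha) ((hp _ _ ha h1).1 hpa)
      · have hc := (h.mem_verts_iff_of_arc h1).2 ha
        exact ih hc ((hp _ _ hc h1).2 hpa)
  exact key z x (SimpleGraph.Reachable.trans (SimpleGraph.Reachable.symm hzV) hx) hzV hz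

lemma finite_vertex (h : Admissible m s n r) : Finite (Vertex m s n) := by
  have := h.neZero_mul
  have := h.neZero_s
  have := h.neZero_n
  infer_instance

/-- Since every vertex has as many in-neighbours as out-neighbours, everything in the component can
be reached along arcs. -/
lemma verts_induction_forward (h : Admissible m s n r) {p : Vertex m s n → Prop} {z : Vertex m s n}
    (hzV : z ∈ verts m s n r) (hz : p z) (hp : ∀ x y, p x → Arc r x y → p y) {x : Vertex m s n}
    (hx : x ∈ verts m s n r) : p x := by
  have := h.finite_vertex
  refine h.verts_induction hzV hz (fun x y _ hxy => ⟨fun hpx => hp x y hpx hxy, fun hpy => ?_⟩) hx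
  obtain ⟨e, rfl⟩ := hxy
  let f : Equiv.Perm (Vertex m s n) := ⟨step r e, back r e, back_step e, step_back e⟩
  exact (perm_rel_iff f (fun a _ => p a) (fun a _ ha => hp _ _ ha (arc_step e a)) (b := x)).1 hpy

end Admissible
end CPM

namespace CPM
variable {m s n : ℕ} {r r' : (ZMod n)ˣ}

/-! ### Rigidity of arc-preserving maps -/

/-- Translation of the vector component by `t`. -/
def tr (t : ZMod s → ZMod n) (x : Vertex m s n) : Vertex m s n := (x.1, x.2 + t)

@[simp] lemma tr_fst (t : ZMod s → ZMod n) (x : Vertex m s n) : (tr t x).1 = x.1 := rfl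
@[simp] lemma tr_snd (t : ZMod s → ZMod n) (x : Vertex m s n) : (tr t x).2 = x.2 + t := rfl
@[simp] lemma tr_zero (x : Vertex m s n) : tr 0 x = x := by ext <;> simp

lemma tr_tr (t t' : ZMod s → ZMod n) (x : Vertex m s n) : tr t (tr t' x) = tr (t' + t) x := by
  ext <;> simp [add_assoc]

lemma step_tr (e : ℤˣ) (t : ZMod s → ZMod n) (x : Vertex m s n) :
    step r e (tr t x) = tr t (step r e x) := by
  ext <;> simp [add_right_comm]

lemma Arc.tr {x y : Vertex m s n} (h : Arc r x y) (t : ZMod s → ZMod n) :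
    Arc r (tr t x) (tr t y) := by
  obtain ⟨e, rfl⟩ := h
  exact ⟨e, (step_tr e t x).symm⟩

/-- There is a directed walk of length `j` from `x` to `y`. -/
def Desc (r : (ZMod n)ˣ) : ℕ → Vertex m s n → Vertex m s n → Prop
  | 0, x, y => x = y
  | j + 1, x, y => ∃ z, Desc r j x z ∧ Arc r z y

lemma Desc.tr {j : ℕ} {x y : Vertex m s n} (h : Desc r j x y) (t : ZMod s → ZMod n) :
    Desc r j (tr t x) (tr t y) := by
  induction j generalizing y with
  | zero => cases h; rfl
  | succ j ih =>
    obtain ⟨z, hz, hzy⟩ := h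
    exact ⟨_, ih hz, hzy.tr t⟩

lemma Desc.cons {j : ℕ} {w x y : Vertex m s n} (hw : Arc r w x) (h : Desc r j x y) :
    Desc r (j + 1) w y := by
  induction j generalizing y with
  | zero => cases h; exact ⟨w, rfl, hw⟩
  | succ j ih =>
    obtain ⟨z, hz, hzy⟩ := h
    exact ⟨_, ih hz, hzy⟩

lemma Desc.fst {j : ℕ} {x y : Vertex m s n} (h : Desc r j x y) :
    y.1 = x.1 + (j : ZMod (m * s)) := by
  induction j generalizing y with
  | zero => cases h; simp
  | succ j ih =>
    obtain ⟨z, hz, hzy⟩ := h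
    rw [hzy.fst, ih hz]
    push_cast
    ring

/-- A directed walk of length `j` changes only the coordinates `i, i + 1, …, i + j - 1`, if it
starts at level `i`. -/
lemma Desc.snd_eq {j : ℕ} {x y : Vertex m s n} (h : Desc r j x y) {l : ZMod s}
    (hl : ∀ k < j, l ≠ label x.1 + (k : ZMod s)) : y.2 l = x.2 l := by
  induction j generalizing y with
  | zero => cases h; rfl
  | succ j ih =>
    obtain ⟨z, hz, e, rfl⟩ := h
    rw [step_snd, Pi.add_apply, Pi.smul_apply, shift_apply_of_ne, smul_zero, add_zero,
      ih hz fun k hk => hl k (Nat.lt_succ_of_lt hk)]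
    rw [hz.fst, label_add_natCast]
    exact hl j (Nat.lt_succ_self j)

lemma Admissible.desc_mem (h : Admissible m s n r) {j : ℕ} {x y : Vertex m s n}
    (hxy : Desc r j x y) : x ∈ verts m s n r ↔ y ∈ verts m s n r := by
  induction j generalizing y with
  | zero => cases hxy; rfl
  | succ j ih =>
    obtain ⟨z, hz, hzy⟩ := hxy
    rw [ih hz, h.mem_verts_iff_of_arc hzy]

/-- An injective map from the component of `CPM̄(m,s,n;r)` that sends arcs to arcs of
`CPM̄(m,s,n;r')`.  Its values off the component do not matter. -/
structure ArcMap (r r' : (ZMod n)ˣ) (f : Vertex m s n → Vertex m s n) : Prop where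
  injOn : Set.InjOn f (verts m s n r)
  arc : ∀ x ∈ verts m s n r, ∀ y, Arc r x y → Arc r' (f x) (f y)

variable {f : Vertex m s n → Vertex m s n}

lemma ArcMap.desc (h : Admissible m s n r) (hf : ArcMap r r' f) {j : ℕ} {x y : Vertex m s n}
    (hx : x ∈ verts m s n r) (hxy : Desc r j x y) : Desc r' j (f x) (f y) := by
  induction j generalizing y with
  | zero => cases hxy; rfl
  | succ j ih =>
    obtain ⟨z, hz, hzy⟩ := hxy
    exact ⟨_, ih hz, hf.arc _ ((h.desc_mem hz).1 hx) _ hzy⟩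

lemma Admissible.tr_two_mem (h : Admissible m s n r) {x : Vertex m s n} (hx : x ∈ verts m s n r)
    (k : ℕ) : tr ((2 * k : ZMod n) • shift r x.1) x ∈ verts m s n r := by
  induction k with
  | zero => simpa using hx
  | succ k ih =>
    have := h.back_mem (h.step_mem ih 1) (-1)
    convert this using 1
    ext
    · simp
    · simp; ring

/-- The images of the two out-neighbours of a vertex are the two out-neighbours of its image. -/
lemma ArcMap.exists_sign (h : Admissible m s n r) (hf : ArcMap r r' f)
    {x : Vertex m s n} (hx : x ∈ verts m s n r) :
    ∃ e : ℤˣ, ∀ d : ℤˣ, f (step r d x) = step r' (e * d) (f x) := by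
  obtain ⟨e, he⟩ := hf.arc x hx _ (arc_step 1 x)
  obtain ⟨e', he'⟩ := hf.arc x hx _ (arc_step (-1) x)
  have hne : e' ≠ e := by
    rintro rfl
    have h1 := hf.injOn (h.step_mem hx 1) (h.step_mem hx (-1)) (he.trans he'.symm)
    exact absurd (h.step_injective_sign h1) (by decide)
  have hee : e' = -e := by
    rcases Int.units_eq_one_or e with rfl | rfl <;> rcases Int.units_eq_one_or e' with rfl | rfl
      <;> simp at hne ⊢
  refine ⟨e, fun d => ?_⟩
  rcases Int.units_eq_one_or d with rfl | rfl
  · rw [he, mul_one]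
  · rw [he', hee, mul_neg_one]

/-- An arc-preserving map sends alternating cycles to alternating cycles. -/
lemma ArcMap.alternating (h : Admissible m s n r) (hf : ArcMap r r' f)
    {x : Vertex m s n} (hx : x ∈ verts m s n r) :
    ∃ e : ℤˣ, ∀ k : ℕ,
      f (tr ((2 * k : ZMod n) • shift r x.1) x) =
        tr ((2 * k * sg n e : ZMod n) • shift r' (f x).1) (f x) ∧
      ∀ d : ℤˣ, f (step r d (tr ((2 * k : ZMod n) • shift r x.1) x)) =
        step r' (e * d) (f (tr ((2 * k : ZMod n) • shift r x.1) x)) := by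
  obtain ⟨e, he⟩ := hf.exists_sign h hx
  refine ⟨e, fun k => ?_⟩
  induction k with
  | zero => simpa using he
  | succ k ih =>
    obtain ⟨ih1, ih2⟩ := ih
    have hk := h.tr_two_mem hx k
    have hk1 := h.tr_two_mem hx (k + 1)
    set z := tr ((2 * k : ZMod n) • shift r x.1) x with hz
    set z' := tr ((2 * (k + 1 : ℕ) : ZMod n) • shift r x.1) x with hz'
    have hzz : step r (-1) z' = step r 1 z := by
      rw [hz, hz']
      ext
      · simp
      · simp; ring
    obtain ⟨e', he'⟩ := hf.exists_sign h hk1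
    have h1 : step r' (e' * -1) (f z') = step r' (e * 1) (f z) := by
      rw [← he', ← ih2, hzz]
    have hee : e' = e := by
      by_contra hne
      have hee : e' = -e := by
        rcases Int.units_eq_one_or e with rfl | rfl <;>
          rcases Int.units_eq_one_or e' with rfl | rfl <;> simp at hne ⊢
      rw [hee, neg_mul_neg] at h1
      have h2 : f z' = f z := by
        have := congrArg (back r' (e * 1)) h1
        simpa using this
      have h3 := congrFun (congrArg Prod.snd (hf.injOn hk1 hk h2)) (label x.1)
      simp only [hz, hz', tr_snd, Pi.add_apply, Pi.smul_apply, shift_apply_self, smul_eq_mul,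
        Nat.cast_add, Nat.cast_one] at h3
      exact h.wt_two_ne x.1 (by linear_combination h3)
    subst hee
    refine ⟨?_, he'⟩
    have h2 : f z' = back r' (e' * -1) (step r' (e' * 1) (f z)) := by rw [← h1, back_step]
    rw [h2, ih1]
    ext
    · simp
    · simp; ring

/-- Consecutive positions of a coordinate are distinct within a window of length `s`. -/
lemma ne_add_natCast {a : ZMod s} {k j : ℕ} (hkj : k < j) (hj : j < s) :
    a + (j : ZMod s) ≠ a + (k : ZMod s) := by
  intro h0
  have h1 := add_left_cancel h0
  rw [ZMod.natCast_eq_natCast_iff, Nat.ModEq, Nat.mod_eq_of_lt hj,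
    Nat.mod_eq_of_lt (hkj.trans hj)] at h1
  omega

/-- Translations by `2 r ^ i` along the first alternating cycle of a directed walk of length at most
`s` are carried along the walk by every arc-preserving map: vertices on two alternating cycles that
are translates of each other correspond if and only if they have a common ancestor. -/
lemma ArcMap.transport (h : Admissible m s n r) (hn4 : n ≠ 4)
    (hf : ArcMap r r' f) {v : ℕ → Vertex m s n} (hv0 : v 0 ∈ verts m s n r)
    (hv : ∀ j < s, Arc r (v j) (v (j + 1))) :
    ∃ e : ℤˣ, (∀ d : ℤˣ, f (step r d (v 0)) = step r' (e * d) (f (v 0))) ∧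
      ∀ j ≤ s, ∀ k : ℕ, f (tr ((2 * k : ZMod n) • shift r (v 0).1) (v j)) =
        tr ((2 * k * sg n e : ZMod n) • shift r' (f (v 0)).1) (f (v j)) := by
  obtain ⟨e, he⟩ := hf.alternating h hv0
  set u := shift r (v 0).1 with hu
  set u' := shift r' (f (v 0)).1 with hu'
  have hs := h.two_le_s
  -- membership along the walk and its translates
  have hdesc : ∀ j ≤ s, Desc r j (v 0) (v j) := by
    intro j hj
    induction j with
    | zero => rfl
    | succ j ih => exact ⟨_, ih (by omega), hv j (by omega)⟩
  have hdesc1 : ∀ j, j + 1 ≤ s → Desc r j (v 1) (v (j + 1)) := by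
    intro j hj
    induction j with
    | zero => rfl
    | succ j ih => exact ⟨_, ih (by omega), hv (j + 1) (by omega)⟩
  have hmem : ∀ j ≤ s, ∀ k : ℕ, tr ((2 * k : ZMod n) • u) (v j) ∈ verts m s n r := fun j hj k =>
    (h.desc_mem ((hdesc j hj).tr _)).1 (h.tr_two_mem hv0 k)
  have hlev : ∀ j ≤ s, (f (v j)).1 = (f (v 0)).1 + (j : ZMod (m * s)) := fun j hj =>
    (hf.desc h hv0 (hdesc j hj)).fst
  refine ⟨e, fun d => by simpa using (he 0).2 d, fun j hj => ?_⟩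
  induction j with
  | zero => exact fun k => (he k).1
  | succ j ih =>
    obtain rfl | hj0 := Nat.eq_zero_or_pos j
    · intro k
      obtain ⟨d, hd⟩ := hv 0 (by omega)
      rw [hd, ← step_tr, (he k).2, (he k).1, step_tr]
      have := (he 0).2 d
      simp only [Nat.cast_zero, mul_zero, zero_smul, tr_zero] at this
      rw [this]
    have ihj := ih (by omega)
    obtain ⟨d, hd⟩ := hv j (by omega)
    have hvj : ∀ k : ℕ, tr ((2 * k : ZMod n) • u) (v j) ∈ verts m s n r := hmem j (by omega)
    choose δ hδ using fun k => hf.alternating h (hvj k)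
    have hdist : label (f (v j)).1 ≠ label (f (v 0)).1 := by
      rw [hlev j (by omega), label_add_natCast]
      have := ne_add_natCast (a := label (f (v 0)).1) hj0 (show j < s by omega)
      simpa using this
    have hδs : ∀ k, δ k = δ (k + 1) := by
      intro k
      by_contra hne
      -- the common ancestor
      obtain ⟨i, rfl⟩ : ∃ i, j = i + 1 := ⟨j - 1, by omega⟩
      obtain ⟨c, hc⟩ := hv 0 (by omega)
      have hanc : ∀ a : ℕ, (a = k ∨ a = k + 1) → Desc r (i + 1)
          (back r 1 (tr ((2 * (k + 1) : ZMod n) • u + (2 : ZMod n) • shift r (v (i + 1)).1) (v 1)))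
          (tr ((2 : ZMod n) • shift r (v (i + 1)).1) (tr ((2 * a : ZMod n) • u) (v (i + 1)))) := by
        intro a ha
        have h1 := ((hdesc1 i (by omega)).tr ((2 * a : ZMod n) • u)).tr
          ((2 : ZMod n) • shift r (v (i + 1)).1)
        refine Desc.cons ?_ h1
        rcases ha with rfl | rfl
        · refine ⟨-1, ?_⟩
          rw [hc]
          ext
          · simp
          · simp [hu]; ring
        · refine ⟨1, ?_⟩
          rw [step_back, tr_tr]
          push_cast
          rfl
      have hz1 := hanc k (Or.inl rfl)
      have hz2 := hanc (k + 1) (Or.inr rfl)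
      have hzmem : tr ((2 : ZMod n) • shift r (v (i + 1)).1)
          (tr ((2 * k : ZMod n) • u) (v (i + 1))) ∈ verts m s n r := by
        have := h.tr_two_mem (hvj k) 1
        simpa using this
      have hz := (h.desc_mem hz1).2 hzmem
      have hf1 := hf.desc h hz hz1
      have hf2 := hf.desc h hz hz2
      have key := (hδ k 1).1
      have key2 := (hδ (k + 1) 1).1
      rw [ihj] at key key2
      simp only [Nat.cast_one, mul_one, tr_fst] at key key2
      rw [key] at hf1
      rw [key2] at hf2
      have hlz := hf1.fst
      simp only [tr_fst] at hlz
      have hnl : ∀ q < i + 1, label (f (v (i + 1))).1 ≠ label (f (back r 1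
          (tr ((2 * (k + 1) : ZMod n) • u + (2 : ZMod n) • shift r (v (i + 1)).1) (v 1)))).1 +
            (q : ZMod s) := by
        intro q hq
        rw [hlz, label_add_natCast]
        exact ne_add_natCast hq (by omega)
      have e1 := hf1.snd_eq hnl
      have e2 := hf2.snd_eq hnl
      rw [← e2] at e1
      simp only [tr_snd, Pi.add_apply, Pi.smul_apply, shift_apply_self, smul_eq_mul, hu',
        shift_apply_of_ne hdist, mul_zero, add_zero, add_right_inj] at e1
      have e3 := (Units.mul_left_inj _).1 e1
      have h4 := four_ne_zero_of h.three_le_n hn4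
      rcases Int.units_eq_one_or (δ k) with h1 | h1 <;>
        rcases Int.units_eq_one_or (δ (k + 1)) with h2 | h2 <;> rw [h1, h2] at hne e3
      · exact hne rfl
      · simp at e3; exact h4 (by linear_combination e3)
      · simp at e3; exact h4 (by linear_combination -e3)
      · exact hne rfl
    have hδ0 : ∀ k, δ k = δ 0 := by
      intro k
      induction k with
      | zero => rfl
      | succ k ihk => rw [← hδs, ihk]
    intro k
    have h1 := (hδ k 0).2 d
    have h2 := (hδ 0 0).2 d
    simp only [Nat.cast_zero, mul_zero, zero_smul, tr_zero] at h1 h2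
    rw [hd, ← step_tr, h1, h2, hδ0, ihj, step_tr]

lemma exists_nat_eq (h : Admissible m s n r) (a : ZMod n) : ∃ k : ℕ, (k : ZMod n) = a := by
  have := h.neZero_n
  exact ⟨a.val, ZMod.natCast_zmod_val a⟩

/-- The directed walk that always adds `+r ^ i`. -/
def walk (r : (ZMod n)ˣ) (x : Vertex m s n) (j : ℕ) : Vertex m s n := (step r 1)^[j] x

lemma shift_add_s (h : Admissible m s n r) (i : ZMod (m * s)) :
    ∃ e : ℤˣ, shift r (i + (s : ZMod (m * s))) = (sg n e * r ^ s : ZMod n) • shift r i := by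
  obtain ⟨e, he⟩ := h.wt_add i s
  refine ⟨e, ?_⟩
  rw [shift_eq, shift_eq, he, label_add_natCast]
  ext l
  by_cases hl : l = label i <;> simp [hl]

/-- The number `±r ^ s` that relates the alternating cycles at the two ends of a directed walk of
length `s` is preserved by arc-preserving maps. -/
lemma ArcMap.two_mul_pow_eq (h : Admissible m s n r) (h' : Admissible m s n r') (hn4 : n ≠ 4)
    (hf : ArcMap r r' f) : ∃ e : ℤˣ, (2 * r ^ s : ZMod n) = sg n e * (2 * r' ^ s) := by
  let v : ℕ → Vertex m s n := walk r (0, 0)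
  have hv : ∀ j, v (j + 1) = step r 1 (v j) := fun j => Function.iterate_succ_apply' _ _ _
  have hv0 : v 0 ∈ verts m s n r := zero_mem_verts
  have hd : ∀ j, Desc r j (v 0) (v j) := by
    intro j
    induction j with
    | zero => rfl
    | succ j ih => exact ⟨_, ih, 1, hv j⟩
  obtain ⟨e, -, he⟩ := hf.transport h hn4 hv0 (fun j _ => ⟨1, hv j⟩)
  have hs0 := (h.desc_mem (hd s)).1 hv0
  obtain ⟨d, hd'⟩ := hf.alternating h hs0
  have h1 := (hd' 1).1
  rw [(hd s).fst, (hf.desc h hv0 (hd s)).fst] at h1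
  obtain ⟨a, ha⟩ := shift_add_s h (v 0).1
  obtain ⟨a', ha'⟩ := shift_add_s h' (f (v 0)).1
  obtain ⟨k, hk⟩ := exists_nat_eq h (sg n a * r ^ s)
  have h2 := he s le_rfl k
  rw [hk] at h2
  rw [ha, ha'] at h1
  simp only [Nat.cast_one, mul_one, smul_smul] at h1
  rw [h2] at h1
  have h3 := congrFun (congrArg Prod.snd h1) (label (f (v 0)).1)
  simp only [tr_snd, Pi.add_apply, Pi.smul_apply, shift_apply_self, smul_eq_mul,
    add_right_inj] at h3
  have h4 := (Units.mul_left_inj _).1 h3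
  refine ⟨a * e * d * a', ?_⟩
  simp only [sg_mul]
  have ea := sg_mul_self (n := n) a
  have ee := sg_mul_self (n := n) e
  linear_combination (sg n a * sg n e) * h4 - 2 * (r : ZMod n) ^ s * ea * (sg n e) ^ 2
    - 2 * (r : ZMod n) ^ s * ee

/-- An arc-preserving map that fixes a directed walk of length `s` fixes the out-neighbours of its
end. -/
lemma ArcMap.fix_next (h : Admissible m s n r) (hn4 : n ≠ 4)
    (hf : ArcMap r r f) {v : ℕ → Vertex m s n} (hv0 : v 0 ∈ verts m s n r)
    (hv : ∀ j < s, Arc r (v j) (v (j + 1))) (hfix : ∀ j ≤ s, f (v j) = v j) (d : ℤˣ) :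
    f (step r d (v s)) = step r d (v s) := by
  have hd : ∀ j ≤ s, Desc r j (v 0) (v j) := by
    intro j hj
    induction j with
    | zero => rfl
    | succ j ih => exact ⟨_, ih (by omega), hv j (by omega)⟩
  have h2s := h.two_le_s
  obtain ⟨e, he0, he⟩ := hf.transport h hn4 hv0 hv
  have hs0 := (h.desc_mem (hd s le_rfl)).1 hv0
  obtain ⟨c, hc⟩ := hf.alternating h hs0
  rw [hfix 0 (by omega)] at he0 he
  have he1 : e = 1 := by
    obtain ⟨b, hb⟩ := hv 0 (by omega)
    have h1 := he0 b
    rw [← hb, hfix 1 (by omega), hb] at h1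
    have := h.step_injective_sign h1
    exact (mul_eq_right.1 this.symm)
  subst he1
  obtain ⟨a, ha⟩ := shift_add_s h (v 0).1
  obtain ⟨k, hk⟩ := exists_nat_eq h (sg n a * r ^ s)
  have h1 := (hc 1).1
  have h2 := he s le_rfl k
  rw [hfix s le_rfl] at h1 h2
  rw [hk] at h2
  simp only [Nat.cast_one, mul_one, sg_one] at h1 h2
  have hsh : (2 * (sg n a * r ^ s) : ZMod n) • shift r (v 0).1 =
      (2 : ZMod n) • shift r (v s).1 := by
    rw [(hd s le_rfl).fst, ha, smul_smul]
  rw [hsh, h1] at h2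
  have h3 := congrFun (congrArg Prod.snd h2) (label (v s).1)
  simp only [tr_snd, Pi.add_apply, Pi.smul_apply, shift_apply_self, smul_eq_mul,
    add_right_inj] at h3
  have h4 := (Units.mul_left_inj _).1 h3
  have hc1 : c = 1 := by
    rcases Int.units_eq_one_or c with rfl | rfl
    · rfl
    · simp at h4
      exact absurd (by linear_combination -h4) (four_ne_zero_of h.three_le_n hn4)
  have h5 := (hc 0).2 d
  simpa [hc1, hfix s le_rfl] using h5

/-- An arc-preserving map that fixes a directed walk of length `s` is the identity. -/
lemma ArcMap.eq_id (h : Admissible m s n r) (hn4 : n ≠ 4)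
    (hf : ArcMap r r f) {v : ℕ → Vertex m s n} (hv0 : v 0 ∈ verts m s n r)
    (hv : ∀ j < s, Arc r (v j) (v (j + 1))) (hfix : ∀ j ≤ s, f (v j) = v j)
    {x : Vertex m s n} (hx : x ∈ verts m s n r) : f x = x := by
  have hd : ∀ (v : ℕ → Vertex m s n), (∀ j < s, Arc r (v j) (v (j + 1))) →
      ∀ j ≤ s, Desc r j (v 0) (v j) := by
    intro v hv j hj
    induction j with
    | zero => rfl
    | succ j ih => exact ⟨_, ih (by omega), hv j (by omega)⟩
  let p : Vertex m s n → Prop := fun y => ∃ v : ℕ → Vertex m s n, v 0 ∈ verts m s n r ∧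
    (∀ j < s, Arc r (v j) (v (j + 1))) ∧ (∀ j ≤ s, f (v j) = v j) ∧ v s = y
  have h2s := h.two_le_s
  have hp : p x := by
    refine h.verts_induction_forward (p := p) ((h.desc_mem (hd v hv s le_rfl)).1 hv0)
      ⟨v, hv0, hv, hfix, rfl⟩ ?_ hx
    rintro y z ⟨w, hw0, hw, hwf, rfl⟩ ⟨d, rfl⟩
    refine ⟨fun j => if j < s then w (j + 1) else step r d (w s), ?_, ?_, ?_, by simp⟩
    · simp only [show 0 < s by omega, if_true]
      exact (h.mem_verts_iff_of_arc (hw 0 (by omega))).1 hw0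
    · intro j hj
      simp only [hj, if_true]
      split_ifs with hj1
      · exact hw _ hj1
      · have : j + 1 = s := by omega
        rw [this]
        exact arc_step d _
    · intro j hj
      simp only
      split_ifs with hj1
      · exact hwf _ hj1
      · exact hf.fix_next h hn4 hw0 hw hwf d
  obtain ⟨v, -, -, hvf, rfl⟩ := hp
  exact hvf s le_rfl

end CPM

namespace CPM
variable {m s n : ℕ} {r r' : (ZMod n)ˣ}

/-! ### The group `G` -/

/-- Translations as permutations. -/
def trPerm (m : ℕ) (t : ZMod s → ZMod n) : Equiv.Perm (Vertex m s n) where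
  toFun := tr t
  invFun := tr (-t)
  left_inv x := by simp [tr_tr]
  right_inv x := by simp [tr_tr]

/-- The sign change `⟨i; v⟩ ↦ ⟨i; (ε_j v_j)_j⟩`. -/
def signMap (ε : ZMod s → ℤˣ) (x : Vertex m s n) : Vertex m s n :=
  (x.1, fun j => sg n (ε j) * x.2 j)

@[simp] lemma signMap_fst (ε : ZMod s → ℤˣ) (x : Vertex m s n) : (signMap ε x).1 = x.1 := rfl
@[simp] lemma signMap_snd (ε : ZMod s → ℤˣ) (x : Vertex m s n) (j : ZMod s) :
    (signMap ε x).2 j = sg n (ε j) * x.2 j := rfl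

lemma signMap_signMap (ε ε' : ZMod s → ℤˣ) (x : Vertex m s n) :
    signMap ε (signMap ε' x) = signMap (ε * ε') x := by
  ext <;> simp [mul_assoc]

lemma signMap_one (x : Vertex m s n) : signMap 1 x = x := by ext <;> simp

/-- Sign changes as permutations. -/
def signPerm (m n : ℕ) (ε : ZMod s → ℤˣ) : Equiv.Perm (Vertex m s n) where
  toFun := signMap ε
  invFun := signMap ε
  left_inv x := by
    rw [signMap_signMap, show ε * ε = 1 from funext fun j => Int.units_mul_self (ε j), signMap_one]
  right_inv x := by
    rw [signMap_signMap, show ε * ε = 1 from funext fun j => Int.units_mul_self (ε j), signMap_one]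

lemma signMap_step (ε : ZMod s → ℤˣ) (e : ℤˣ) (x : Vertex m s n) :
    signMap ε (step r e x) = step r (ε (label x.1) * e) (signMap ε x) := by
  ext j
  · simp
  · by_cases hj : j = label x.1
    · subst hj
      simp [shift_apply_self, mul_add, mul_assoc]
    · simp [shift_apply_of_ne hj]

lemma sigma_mem : sigma m s n r ∈ fullGroup m s n r := Subgroup.subset_closure (by simp)

lemma trPerm_single_zero_mem : trPerm m (Pi.single 0 1) ∈ fullGroup m s n r := by
  have : trPerm m (Pi.single (0 : ZMod s) (1 : ZMod n)) = rho m s n 0 := Equiv.ext fun _ => rfl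
  rw [this]
  exact Subgroup.subset_closure (by simp)

lemma signPerm_single_zero_mem :
    signPerm m n (Pi.mulSingle 0 (-1)) ∈ fullGroup m s n r := by
  have : signPerm m n (Pi.mulSingle (0 : ZMod s) (-1)) = tau m s n 0 := by
    ext x j
    · rfl
    · by_cases hj : j = 0
      · subst hj; simp [signPerm, tau]
      · simp [signPerm, tau, hj]
  rw [this]
  exact Subgroup.subset_closure (Or.inr (Or.inr rfl))

lemma sigma_mul_trPerm (t : ZMod s → ZMod n) :
    sigma m s n r * trPerm m t * (sigma m s n r)⁻¹ =
      trPerm m (fun j => (r : ZMod n) * t (j - 1)) := by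
  rw [mul_inv_eq_iff_eq_mul]
  ext x j
  · rfl
  · simp [sigma, trPerm, mul_add]

lemma sigma_mul_signPerm (ε : ZMod s → ℤˣ) :
    sigma m s n r * signPerm m n ε * (sigma m s n r)⁻¹ = signPerm m n (fun j => ε (j - 1)) := by
  rw [mul_inv_eq_iff_eq_mul]
  ext x j
  · rfl
  · simp [sigma, signPerm]; ring

lemma trPerm_mem (hs : 2 ≤ s) (hn : 3 ≤ n) (t : ZMod s → ZMod n) :
    trPerm m t ∈ fullGroup m s n r := by
  have : NeZero s := ⟨by omega⟩
  have : NeZero n := ⟨by omega⟩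
  let T : AddSubgroup (ZMod s → ZMod n) :=
    { carrier := {t | trPerm m t ∈ fullGroup m s n r}
      zero_mem' := by
        have : trPerm m (0 : ZMod s → ZMod n) = 1 := by ext <;> simp [trPerm]
        simp only [Set.mem_ofPred_eq, this, one_mem]
      add_mem' := by
        intro a b ha hb
        have : trPerm m (a + b) = trPerm m b * trPerm m a := by
          ext <;> simp [trPerm, add_assoc]
        simp only [Set.mem_ofPred_eq, this] at *
        exact mul_mem hb ha
      neg_mem' := by
        intro a ha
        have : trPerm m (-a) = (trPerm m a)⁻¹ := by
          rw [eq_inv_iff_mul_eq_one]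
          ext <;> simp [trPerm]
        simp only [Set.mem_ofPred_eq, this] at *
        exact inv_mem ha }
  have h1 : ∀ k : ℕ, (Pi.single (k : ZMod s) ((r : ZMod n) ^ k) : ZMod s → ZMod n) ∈ T := by
    intro k
    induction k with
    | zero =>
      have : trPerm m (Pi.single ((0 : ℕ) : ZMod s) ((r : ZMod n) ^ 0)) ∈ fullGroup m s n r := by
        simpa using trPerm_single_zero_mem
      exact this
    | succ k ih =>
      have h2 := mul_mem (mul_mem (sigma_mem (m := m) (r := r)) ih) (inv_mem sigma_mem)
      rw [sigma_mul_trPerm] at h2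
      have : (fun j => (r : ZMod n) * (Pi.single (k : ZMod s) ((r : ZMod n) ^ k) : ZMod s → ZMod n)
          (j - 1)) = Pi.single ((k + 1 : ℕ) : ZMod s) ((r : ZMod n) ^ (k + 1)) := by
        ext j
        by_cases hj : j = ((k + 1 : ℕ) : ZMod s)
        · subst hj; simp [pow_succ']
        · have : j - 1 ≠ k := fun h0 => hj (by push_cast; rw [← h0]; ring)
          rw [Pi.single_eq_of_ne hj, Pi.single_eq_of_ne this, mul_zero]
      rw [this] at h2
      exact h2
  have h2 : ∀ (l : ZMod s) (c : ZMod n), (Pi.single l c : ZMod s → ZMod n) ∈ T := by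
    intro l c
    have h3 := nsmul_mem (h1 l.val) (c * ((r⁻¹ : (ZMod n)ˣ) : ZMod n) ^ l.val).val
    convert h3 using 1
    rw [ZMod.natCast_zmod_val, ← Pi.single_smul, nsmul_eq_mul, ZMod.natCast_zmod_val, mul_assoc,
      ← mul_pow]
    simp
  have h3 : ∑ l, (Pi.single l (t l) : ZMod s → ZMod n) ∈ T := sum_mem fun l _ => h2 l _
  rw [Finset.univ_sum_single] at h3
  exact h3

lemma signPerm_mem (hs : 2 ≤ s) (ε : ZMod s → ℤˣ) :
    signPerm m n ε ∈ fullGroup m s n r := by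
  have : NeZero s := ⟨by omega⟩
  let F : (ZMod s → ℤˣ) →* Equiv.Perm (Vertex m s n) :=
    { toFun := signPerm m n
      map_one' := by ext x <;> simp [signPerm]
      map_mul' := fun a b => Equiv.ext fun x => (signMap_signMap a b x).symm }
  have h1 : ∀ k : ℕ, (Pi.mulSingle (k : ZMod s) (-1 : ℤˣ) : ZMod s → ℤˣ) ∈
      (fullGroup m s n r).comap F := by
    intro k
    induction k with
    | zero =>
      have : signPerm m n (Pi.mulSingle ((0 : ℕ) : ZMod s) (-1)) ∈ fullGroup m s n r := by
        simpa using signPerm_single_zero_mem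
      exact this
    | succ k ih =>
      have h2 := mul_mem (mul_mem (sigma_mem (m := m) (r := r)) ih) (inv_mem sigma_mem)
      change sigma m s n r * signPerm m n _ * (sigma m s n r)⁻¹ ∈ _ at h2
      rw [sigma_mul_signPerm] at h2
      have : (fun j => (Pi.mulSingle (k : ZMod s) (-1 : ℤˣ) : ZMod s → ℤˣ) (j - 1)) =
          Pi.mulSingle ((k + 1 : ℕ) : ZMod s) (-1 : ℤˣ) := by
        ext j
        by_cases hj : j = ((k + 1 : ℕ) : ZMod s)
        · subst hj; simp
        · have : j - 1 ≠ k := fun h0 => hj (by push_cast; rw [← h0]; ring)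
          rw [Pi.mulSingle_eq_of_ne hj, Pi.mulSingle_eq_of_ne this]
      rw [this] at h2
      exact h2
  have h2 : ∀ l : ZMod s, (Pi.mulSingle l (ε l) : ZMod s → ℤˣ) ∈ (fullGroup m s n r).comap F := by
    intro l
    rcases Int.units_eq_one_or (ε l) with h0 | h0 <;> rw [h0]
    · rw [Pi.mulSingle_one]; exact one_mem _
    · simpa using h1 l.val
  have h3 : ∏ l, (Pi.mulSingle l (ε l) : ZMod s → ℤˣ) ∈ (fullGroup m s n r).comap F :=
    prod_mem fun l _ => h2 l
  rw [Finset.univ_prod_mulSingle] at h3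
  exact h3

lemma Admissible.sigma_arc (h : Admissible m s n r) {x y : Vertex m s n} (hxy : Arc r x y) :
    Arc r (sigma m s n r x) (sigma m s n r y) := by
  obtain ⟨e, rfl⟩ := hxy
  obtain ⟨f, hf⟩ := h.wt_add_one x.1
  refine ⟨e * f, ?_⟩
  have hf' : (r : ZMod n) * wt r x.1 = sg n f * wt r (x.1 + 1) := by
    rw [hf, ← mul_assoc, ← mul_assoc, sg_mul_self, one_mul]
  ext j
  · rfl
  · simp only [sigma, Equiv.coe_fn_mk, step_fst, step_snd, Pi.add_apply, Pi.smul_apply,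
      smul_eq_mul, sg_mul, mul_add]
    congr 1
    by_cases hj : j = label (x.1 + 1)
    · subst hj
      rw [shift_apply_self, label_add_one, add_sub_cancel_right, shift_apply_self]
      linear_combination sg n e * hf'
    · rw [shift_apply_of_ne hj, shift_apply_of_ne]
      · simp
      · intro h0
        exact hj (by rw [label_add_one, ← h0]; ring)

/-- The elements of `Ḡ` preserve the orientation. -/
lemma Admissible.fullGroup_arc (h : Admissible m s n r) {g : Equiv.Perm (Vertex m s n)}
    (hg : g ∈ fullGroup m s n r) {x y : Vertex m s n} (hxy : Arc r x y) : Arc r (g x) (g y) := by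
  have := h.finite_vertex
  have hgen : ∀ g ∈ fullGroup m s n r, ∀ x y, Arc r x y → Arc r (g x) (g y) := by
    intro g hg
    induction hg using Subgroup.closure_induction with
    | mem g hg =>
      intro x y hxy
      rcases hg with rfl | rfl | rfl
      · exact h.sigma_arc hxy
      · exact hxy.tr _
      · have : tau m s n 0 = signPerm m n (Pi.mulSingle (0 : ZMod s) (-1)) := by
          ext x j
          · rfl
          · by_cases hj : j = 0
            · subst hj; simp [signPerm, tau]
            · simp [signPerm, tau, hj]
        rw [this]
        obtain ⟨e, rfl⟩ := hxy
        exact ⟨_, signMap_step _ _ _⟩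
    | one => exact fun x y h => h
    | mul a b _ _ iha ihb => exact fun x y hxy => iha _ _ (ihb _ _ hxy)
    | inv a _ iha =>
      intro x y hxy
      rw [← perm_rel_iff a (Arc r) iha]
      simpa using hxy
  exact hgen g hg x y hxy

lemma Admissible.fullGroup_arc_iff (h : Admissible m s n r) {g : Equiv.Perm (Vertex m s n)}
    (hg : g ∈ fullGroup m s n r) {x y : Vertex m s n} : Arc r (g x) (g y) ↔ Arc r x y := by
  refine ⟨fun hxy => ?_, h.fullGroup_arc hg⟩
  simpa using h.fullGroup_arc (inv_mem hg) hxy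

/-- An element of `Ḡ` that maps some vertex of `CPM(m,s,n;r)` into `CPM(m,s,n;r)` restricts to an
element of `G`. -/
lemma Admissible.exists_mem_group (h : Admissible m s n r) {g : Equiv.Perm (Vertex m s n)}
    (hg : g ∈ fullGroup m s n r) {x : Vertex m s n} (hx : x ∈ verts m s n r)
    (hgx : g x ∈ verts m s n r) : ∃ φ ∈ group m s n r, IsRestriction φ g := by
  have hadj : ∀ {a b}, (fullGraph m s n r).Adj (g a) (g b) ↔ (fullGraph m s n r).Adj a b := by
    intro a b
    rw [h.fullGraph_adj, h.fullGraph_adj, h.fullGroup_arc_iff hg, h.fullGroup_arc_iff hg]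
  let gi : fullGraph m s n r ≃g fullGraph m s n r := ⟨g, hadj⟩
  have hreach : ∀ y, y ∈ verts m s n r ↔ g y ∈ verts m s n r := by
    intro y
    have h1 : (fullGraph m s n r).Reachable (g x) (g y) ↔ (fullGraph m s n r).Reachable x y :=
      gi.reachable_iff
    exact ⟨fun hy => SimpleGraph.Reachable.trans hgx (h1.2 (hx.symm.trans hy)),
      fun hy => SimpleGraph.Reachable.trans hx (h1.1 (hgx.symm.trans hy))⟩
  let φ : graph m s n r ≃g graph m s n r := ⟨g.subtypeEquiv hreach, hadj⟩
  refine ⟨φ, ⟨g, hg, ?_, fun _ => rfl⟩, fun _ => rfl⟩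
  ext y
  constructor
  · rintro ⟨z, hz, rfl⟩
    exact (hreach z).1 hz
  · intro hy
    exact ⟨g.symm y, (hreach _).2 (by simpa using hy), by simp⟩

lemma sigma_pow_fst (k : ℕ) (x : Vertex m s n) :
    (((sigma m s n r) ^ k) x).1 = x.1 + (k : ZMod (m * s)) := by
  induction k with
  | zero => simp
  | succ k ih =>
    rw [pow_succ', Equiv.Perm.mul_apply]
    change (((sigma m s n r) ^ k) x).1 + 1 = _
    rw [ih]; push_cast; ring

/-- `Ḡ` is transitive on the vertices. -/
lemma Admissible.fullGroup_transitive (h : Admissible m s n r) (x y : Vertex m s n) :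
    ∃ g ∈ fullGroup m s n r, g x = y := by
  have := h.neZero_mul
  let z := ((sigma m s n r) ^ (y.1 - x.1).val) x
  have hz : z.1 = y.1 := by
    simp only [z]
    rw [sigma_pow_fst, ZMod.natCast_zmod_val]
    ring
  refine ⟨trPerm m (y.2 - z.2) * (sigma m s n r) ^ (y.1 - x.1).val,
    mul_mem (trPerm_mem h.two_le_s h.three_le_n _) (pow_mem sigma_mem _), ?_⟩
  change tr (y.2 - z.2) z = y
  exact Prod.ext hz (by simp)

lemma Admissible.exists_step_sign (h : Admissible m s n r) {g : Equiv.Perm (Vertex m s n)}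
    (hg : g ∈ fullGroup m s n r) (x : Vertex m s n) :
    ∃ e : ℤˣ, ∀ d, g (step r d x) = step r (e * d) (g x) := by
  obtain ⟨a, ha⟩ := h.fullGroup_arc hg (arc_step 1 x)
  obtain ⟨b, hb⟩ := h.fullGroup_arc hg (arc_step (-1) x)
  have hab : b = -a := by
    by_contra hab
    have hba : b = a := by
      rcases Int.units_eq_one_or a with rfl | rfl <;> rcases Int.units_eq_one_or b with rfl | rfl
        <;> simp at hab ⊢
    rw [hba, ← ha] at hb
    exact absurd (h.step_injective_sign (g.injective hb)) (by decide)
  refine ⟨a, fun d => ?_⟩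
  rcases Int.units_eq_one_or d with rfl | rfl
  · simpa using ha
  · simpa [hab] using hb

lemma Admissible.exists_back_sign (h : Admissible m s n r) {g : Equiv.Perm (Vertex m s n)}
    (hg : g ∈ fullGroup m s n r) (x : Vertex m s n) :
    ∃ e : ℤˣ, ∀ d, g (back r d x) = back r (e * d) (g x) := by
  obtain ⟨a, ha⟩ := (h.fullGroup_arc hg (arc_back 1 x)).exists_back
  obtain ⟨b, hb⟩ := (h.fullGroup_arc hg (arc_back (-1) x)).exists_back
  have hab : b = -a := by
    by_contra hab
    have hba : b = a := by
      rcases Int.units_eq_one_or a with rfl | rfl <;> rcases Int.units_eq_one_or b with rfl | rfl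
        <;> simp at hab ⊢
    rw [hba, ← ha] at hb
    exact absurd (h.back_injective_sign (g.injective hb)) (by decide)
  refine ⟨a, fun d => ?_⟩
  rcases Int.units_eq_one_or d with rfl | rfl
  · simpa using ha
  · simpa [hab] using hb

lemma signMap_back (ε : ZMod s → ℤˣ) (e : ℤˣ) (x : Vertex m s n) :
    signMap ε (back r e x) = back r (ε (label (x.1 - 1)) * e) (signMap ε x) := by
  have := signMap_step (r := r) ε e (back r e x)
  rw [step_back, back_fst] at this
  rw [this, back_step]

/-- `G` is transitive on the vertices; moreover it realizes every choice of what happens to the two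
out-neighbours and to the two in-neighbours. -/
lemma Admissible.group_transitive (h : Admissible m s n r) (x y : verts m s n r) (a b : ℤˣ) :
    ∃ φ ∈ group m s n r, φ x = y ∧
      (∀ d, (φ ⟨step r d x, h.step_mem x.2 d⟩ : Vertex m s n) = step r (a * d) y) ∧
      (∀ d, (φ ⟨back r d x, h.back_mem x.2 d⟩ : Vertex m s n) = back r (b * d) y) := by
  obtain ⟨g1, hg1, hx1⟩ := h.fullGroup_transitive x (0, 0)
  obtain ⟨g2, hg2, hx2⟩ := h.fullGroup_transitive (0, 0) y
  obtain ⟨a1, ha1⟩ := h.exists_step_sign hg1 x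
  obtain ⟨a2, ha2⟩ := h.exists_step_sign hg2 (0, 0)
  obtain ⟨b1, hb1⟩ := h.exists_back_sign hg1 x
  obtain ⟨b2, hb2⟩ := h.exists_back_sign hg2 (0, 0)
  let ε : ZMod s → ℤˣ := fun j => if j = 0 then a2 * a * a1 else b2 * b * b1
  have hε0 : signMap ε ((0, 0) : Vertex m s n) = (0, 0) := by ext <;> simp
  have hg : g2 * (signPerm m n ε * g1) ∈ fullGroup m s n r :=
    mul_mem hg2 (mul_mem (signPerm_mem h.two_le_s ε) hg1)
  have happ : ∀ z, (g2 * (signPerm m n ε * g1)) z = g2 (signMap ε (g1 z)) := fun z => rfl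
  have hgx : (g2 * (signPerm m n ε * g1)) x = y := by rw [happ, hx1, hε0, hx2]
  obtain ⟨φ, hφ, hφg⟩ := h.exists_mem_group hg x.2 (by rw [hgx]; exact y.2)
  refine ⟨φ, hφ, Subtype.ext ((hφg x).trans hgx), fun d => ?_, fun d => ?_⟩
  · rw [hφg, happ, ha1, hx1, signMap_step, hε0, ha2, hx2]
    congr 1
    simp only [label_zero, ε, if_true]
    rcases Int.units_eq_one_or a1 with rfl | rfl <;> rcases Int.units_eq_one_or a2 with rfl | rfl
      <;> simp
  · rw [hφg, happ, hb1, hx1, signMap_back, hε0, hb2, hx2]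
    congr 1
    have : label ((0 : ZMod (m * s)) - 1) ≠ 0 := by
      rw [label_sub_one, label_zero, zero_sub, neg_ne_zero]
      exact h.one_ne_zero_s
    simp only [ε, this, if_false]
    rcases Int.units_eq_one_or b1 with rfl | rfl <;> rcases Int.units_eq_one_or b2 with rfl | rfl
      <;> simp

/-- The elements of `G` preserve the orientation. -/
lemma Admissible.group_arc (h : Admissible m s n r) {φ : graph m s n r ≃g graph m s n r}
    (hφ : φ ∈ group m s n r) {x y : verts m s n r} (hxy : Arc r (x : Vertex m s n) y) :
    Arc r (φ x : Vertex m s n) (φ y) := by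
  obtain ⟨g, hg, -, hφg⟩ := hφ
  rw [hφg, hφg]
  exact h.fullGroup_arc hg hxy

lemma Admissible.graph_adj (h : Admissible m s n r) {x y : verts m s n r} :
    (graph m s n r).Adj x y ↔ Arc r (x : Vertex m s n) y ∨ Arc r (y : Vertex m s n) x :=
  h.fullGraph_adj

end CPM

namespace CPM
variable {m s n : ℕ} {r r' : (ZMod n)ˣ}

/-! ### Turns and straight paths -/

/-- The out-neighbour `step r e x` as a vertex of `CPM(m,s,n;r)`. -/
def Admissible.up (h : Admissible m s n r) (e : ℤˣ) (x : verts m s n r) : verts m s n r :=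
  ⟨step r e x, h.step_mem x.2 e⟩

/-- The in-neighbour `back r e x` as a vertex of `CPM(m,s,n;r)`. -/
def Admissible.down (h : Admissible m s n r) (e : ℤˣ) (x : verts m s n r) : verts m s n r :=
  ⟨back r e x, h.back_mem x.2 e⟩

/-- The orientation of the edges of `CPM(m,s,n;r)`. -/
def VArc (x y : verts m s n r) : Prop := Arc r (x : Vertex m s n) y

/-- The path `(x, y, z)` changes its direction at `y`. -/
def Turn (x y z : verts m s n r) : Prop := (VArc y x ∧ VArc y z) ∨ (VArc x y ∧ VArc z y)

namespace Admissible
variable (h : Admissible m s n r)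

lemma varc_up (e : ℤˣ) (x : verts m s n r) : VArc x (h.up e x) := ⟨e, rfl⟩
lemma varc_down (e : ℤˣ) (x : verts m s n r) : VArc (h.down e x) x := ⟨e, by simp [down]⟩

lemma varc_iff_up {x y : verts m s n r} : VArc x y ↔ ∃ e, y = h.up e x :=
  ⟨fun ⟨e, he⟩ => ⟨e, Subtype.ext he⟩, fun ⟨e, he⟩ => ⟨e, congrArg Subtype.val he⟩⟩

lemma varc_iff_down {x y : verts m s n r} : VArc x y ↔ ∃ e, x = h.down e y :=
  ⟨fun hxy => (Arc.exists_back hxy).imp fun _ he => Subtype.ext he,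
    fun ⟨e, he⟩ => he ▸ h.varc_down e y⟩

include h in
lemma varc_asymm {x y : verts m s n r} (hxy : VArc x y) : ¬ VArc y x := h.arc_asymm hxy

lemma up_injective {e f : ℤˣ} {x : verts m s n r} (hx : h.up e x = h.up f x) : e = f :=
  h.step_injective_sign (congrArg Subtype.val hx)

lemma down_injective {e f : ℤˣ} {x : verts m s n r} (hx : h.down e x = h.down f x) : e = f :=
  h.back_injective_sign (congrArg Subtype.val hx)

lemma up_ne_down (e f : ℤˣ) (x : verts m s n r) : h.up e x ≠ h.down f x := fun h0 =>
  h.varc_asymm (h.varc_up e x) (h0 ▸ h.varc_down f x)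

lemma adj_up (e : ℤˣ) (x : verts m s n r) : (graph m s n r).Adj x (h.up e x) :=
  h.graph_adj.2 (Or.inl (h.varc_up e x))

lemma adj_down (e : ℤˣ) (x : verts m s n r) : (graph m s n r).Adj x (h.down e x) :=
  h.graph_adj.2 (Or.inr (h.varc_down e x))

lemma adj_iff {x y : verts m s n r} :
    (graph m s n r).Adj x y ↔ (∃ e, y = h.up e x) ∨ ∃ e, y = h.down e x := by
  rw [h.graph_adj, ← h.varc_iff_up, ← h.varc_iff_down]
  rfl

end Admissible

lemma units_three (a b c : ℤˣ) : a = b ∨ a = c ∨ b = c := by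
  rcases Int.units_eq_one_or a with rfl | rfl <;> rcases Int.units_eq_one_or b with rfl | rfl <;>
    rcases Int.units_eq_one_or c with rfl | rfl <;> simp

lemma units_ne_iff {a b : ℤˣ} : a ≠ b ↔ b = -a := by
  rcases Int.units_eq_one_or a with rfl | rfl <;> rcases Int.units_eq_one_or b with rfl | rfl
    <;> decide

/-- An automorphism that maps turns to turns preserves or reverses the orientation as a whole. -/
lemma Admissible.preserves_or_reverses (h : Admissible m s n r)
    (φ : graph m s n r ≃g graph m s n r)
    (hφ : ∀ x y z, x ≠ z → Turn x y z → Turn (φ x) (φ y) (φ z)) :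
    (∀ x y, VArc x y → VArc (φ x) (φ y)) ∨ (∀ x y, VArc x y → VArc (φ y) (φ x)) := by
  let P : verts m s n r → Prop := fun y =>
    (∀ z, VArc y z → VArc (φ y) (φ z)) ∧ (∀ z, VArc z y → VArc (φ z) (φ y))
  let R : verts m s n r → Prop := fun y =>
    (∀ z, VArc y z → VArc (φ z) (φ y)) ∧ (∀ z, VArc z y → VArc (φ y) (φ z))
  have key : ∀ y, P y ∨ R y := by
    intro y
    have hne : (1 : ℤˣ) ≠ -1 := by decide
    have hout := hφ (h.up 1 y) y (h.up (-1) y) (fun h0 => hne (h.up_injective h0))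
      (Or.inl ⟨h.varc_up _ _, h.varc_up _ _⟩)
    have hin := hφ (h.down 1 y) y (h.down (-1) y) (fun h0 => hne (h.down_injective h0))
      (Or.inr ⟨h.varc_down _ _, h.varc_down _ _⟩)
    have h1 : ∀ z, VArc y z → z = h.up 1 y ∨ z = h.up (-1) y := by
      intro z hz
      obtain ⟨e, rfl⟩ := h.varc_iff_up.1 hz
      rcases Int.units_eq_one_or e with rfl | rfl <;> simp
    have h2 : ∀ z, VArc z y → z = h.down 1 y ∨ z = h.down (-1) y := by
      intro z hz
      obtain ⟨e, rfl⟩ := h.varc_iff_down.1 hz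
      rcases Int.units_eq_one_or e with rfl | rfl <;> simp
    have hinj : ∀ {a b}, φ a = φ b → a = b := fun hab => φ.injective hab
    -- `φ y` has only two out-neighbours and only two in-neighbours
    have h3 : ∀ a b c, VArc (φ y) (φ a) → VArc (φ y) (φ b) → VArc (φ y) (φ c) →
        a = b ∨ a = c ∨ b = c := by
      intro a b c ha hb hc
      obtain ⟨ea, ha⟩ := h.varc_iff_up.1 ha
      obtain ⟨eb, hb⟩ := h.varc_iff_up.1 hb
      obtain ⟨ec, hc⟩ := h.varc_iff_up.1 hc
      rcases units_three ea eb ec with rfl | rfl | rfl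
      · exact Or.inl (hinj (ha.trans hb.symm))
      · exact Or.inr (Or.inl (hinj (ha.trans hc.symm)))
      · exact Or.inr (Or.inr (hinj (hb.trans hc.symm)))
    have h4 : ∀ a b c, VArc (φ a) (φ y) → VArc (φ b) (φ y) → VArc (φ c) (φ y) →
        a = b ∨ a = c ∨ b = c := by
      intro a b c ha hb hc
      obtain ⟨ea, ha⟩ := h.varc_iff_down.1 ha
      obtain ⟨eb, hb⟩ := h.varc_iff_down.1 hb
      obtain ⟨ec, hc⟩ := h.varc_iff_down.1 hc
      rcases units_three ea eb ec with rfl | rfl | rfl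
      · exact Or.inl (hinj (ha.trans hb.symm))
      · exact Or.inr (Or.inl (hinj (ha.trans hc.symm)))
      · exact Or.inr (Or.inr (hinj (hb.trans hc.symm)))
    have hd1 : h.up 1 y ≠ h.up (-1) y := fun h0 => hne (h.up_injective h0)
    rcases hout with ⟨a1, a2⟩ | ⟨a1, a2⟩ <;> rcases hin with ⟨b1, b2⟩ | ⟨b1, b2⟩
    · rcases h3 _ _ _ a1 a2 b1 with h0 | h0 | h0
      · exact absurd h0 hd1
      · exact absurd h0 (h.up_ne_down _ _ _)
      · exact absurd h0 (h.up_ne_down _ _ _)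
    · left
      refine ⟨fun z hz => ?_, fun z hz => ?_⟩
      · rcases h1 z hz with rfl | rfl <;> assumption
      · rcases h2 z hz with rfl | rfl <;> assumption
    · right
      refine ⟨fun z hz => ?_, fun z hz => ?_⟩
      · rcases h1 z hz with rfl | rfl <;> assumption
      · rcases h2 z hz with rfl | rfl <;> assumption
    · rcases h4 _ _ _ a1 a2 b1 with h0 | h0 | h0
      · exact absurd h0 hd1
      · exact absurd h0 (h.up_ne_down _ _ _)
      · exact absurd h0 (h.up_ne_down _ _ _)
  have hPR : ∀ y, ¬ (P y ∧ R y) := fun y ⟨hP, hR⟩ =>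
    h.varc_asymm (hP.1 _ (h.varc_up 1 y)) (hR.1 _ (h.varc_up 1 y))
  have hiff : ∀ x y, VArc x y → (P x ↔ P y) := by
    intro x y hxy
    constructor
    · intro hx
      refine (key y).resolve_right fun hy => ?_
      exact h.varc_asymm (hx.1 _ hxy) (hy.2 _ hxy)
    · intro hy
      refine (key x).resolve_right fun hx => ?_
      exact h.varc_asymm (hy.2 _ hxy) (hx.1 _ hxy)
  let z : verts m s n r := ⟨(0, 0), zero_mem_verts⟩
  have hall : ∀ y, P y ↔ P z := by
    intro y
    have := h.verts_induction (p := fun x => ∃ hx : x ∈ verts m s n r, (P ⟨x, hx⟩ ↔ P z)) z.2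
      ⟨z.2, Iff.rfl⟩ ?_ y.2
    · exact this.2
    · intro a b ha hab
      have hb := (h.mem_verts_iff_of_arc hab).1 ha
      have := hiff ⟨a, ha⟩ ⟨b, hb⟩ hab
      exact ⟨fun ⟨_, h1⟩ => ⟨hb, this.symm.trans h1⟩, fun ⟨_, h1⟩ => ⟨ha, this.trans h1⟩⟩
  rcases key z with hz | hz
  · exact Or.inl fun x y hxy => ((hall x).2 hz).1 y hxy
  · refine Or.inr fun x y hxy => ?_
    exact ((key x).resolve_left fun hx => hPR z ⟨(hall x).1 hx, hz⟩).1 y hxy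

/-- If some automorphism of an arc-transitive graph `CPM(m,s,n;r)` maps a turn to a straight path,
then the graph is `2`-arc-transitive: `G` has one orbit on the straight paths up to reversal and one
orbit on each of the two kinds of turns, and the orbits of the full group are unions of these. -/
lemma Admissible.isTwoArcTransitive_of_turn (h : Admissible m s n r)
    (harc : IsArcTransitive (graph m s n r)) (φ : graph m s n r ≃g graph m s n r)
    {x y z : verts m s n r} (hxz : x ≠ z) (ht : Turn x y z) (hnt : ¬ Turn (φ x) (φ y) (φ z)) :
    IsTwoArcTransitive (graph m s n r) := by
  let V := verts m s n r
  let E : V × V × V → V × V × V → Prop := fun t t' =>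
    ∃ φ : graph m s n r ≃g graph m s n r, φ t.1 = t'.1 ∧ φ t.2.1 = t'.2.1 ∧ φ t.2.2 = t'.2.2
  have Etrans : ∀ {a b c}, E a b → E b c → E a c := by
    rintro a b c ⟨φ, h1, h2, h3⟩ ⟨ψ, k1, k2, k3⟩
    refine ⟨φ.trans ψ, ?_, ?_, ?_⟩
    · rw [← k1, ← h1]; rfl
    · rw [← k2, ← h2]; rfl
    · rw [← k3, ← h3]; rfl
  have Esymm : ∀ {a b}, E a b → E b a := by
    rintro a b ⟨φ, h1, h2, h3⟩
    refine ⟨φ.symm, ?_, ?_, ?_⟩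
    · rw [← h1]; exact φ.symm_apply_apply _
    · rw [← h2]; exact φ.symm_apply_apply _
    · rw [← h3]; exact φ.symm_apply_apply _
  have Erev : ∀ {a b c a' b' c' : V}, E (a, b, c) (a', b', c') → E (c, b, a) (c', b', a') := by
    rintro a b c a' b' c' ⟨φ, h1, h2, h3⟩
    exact ⟨φ, h3, h2, h1⟩
  let o : V := ⟨(0, 0), zero_mem_verts⟩
  let tOut : V × V × V := (h.up 1 o, o, h.up (-1) o)
  let tIn : V × V × V := (h.down 1 o, o, h.down (-1) o)
  let sUp : V × V × V := (h.down 1 o, o, h.up 1 o)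
  let sDown : V × V × V := (h.up 1 o, o, h.down 1 o)
  have hg : ∀ (y : V) (a b : ℤˣ), ∃ φ : graph m s n r ≃g graph m s n r, φ y = o ∧
      (∀ d, φ (h.up d y) = h.up (a * d) o) ∧ (∀ d, φ (h.down d y) = h.down (b * d) o) := by
    intro y a b
    obtain ⟨φ, -, h1, h2, h3⟩ := h.group_transitive y o a b
    exact ⟨φ, h1, fun d => Subtype.ext (h2 d), fun d => Subtype.ext (h3 d)⟩
  have hOut : ∀ (y : V) (d : ℤˣ), E (h.up d y, y, h.up (-d) y) tOut := by
    intro y d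
    obtain ⟨φ, h1, h2, -⟩ := hg y d 1
    refine ⟨φ, ?_, h1, ?_⟩
    · rw [h2, Int.units_mul_self]
    · rw [h2, mul_neg, Int.units_mul_self]
  have hIn : ∀ (y : V) (d : ℤˣ), E (h.down d y, y, h.down (-d) y) tIn := by
    intro y d
    obtain ⟨φ, h1, -, h2⟩ := hg y 1 d
    refine ⟨φ, ?_, h1, ?_⟩
    · rw [h2, Int.units_mul_self]
    · rw [h2, mul_neg, Int.units_mul_self]
  have hUp : ∀ (y : V) (d e : ℤˣ), E (h.down d y, y, h.up e y) sUp := by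
    intro y d e
    obtain ⟨φ, h1, h2, h3⟩ := hg y e d
    exact ⟨φ, by rw [h3, Int.units_mul_self], h1, by rw [h2, Int.units_mul_self]⟩
  have hDown : ∀ (y : V) (d e : ℤˣ), E (h.up e y, y, h.down d y) sDown := fun y d e =>
    Erev (hUp y d e)
  have hcl : ∀ a b c : V, (graph m s n r).Adj a b → (graph m s n r).Adj b c → a ≠ c →
      (Turn a b c ∧ (E (a, b, c) tOut ∨ E (a, b, c) tIn)) ∨
        (E (a, b, c) sUp ∨ E (a, b, c) sDown) := by
    intro a b c hab hbc hac
    rcases h.adj_iff.1 hab.symm with ⟨d, rfl⟩ | ⟨d, rfl⟩ <;>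
      rcases h.adj_iff.1 hbc with ⟨e, rfl⟩ | ⟨e, rfl⟩
    · have : d ≠ e := fun h0 => hac (by rw [h0])
      rw [units_ne_iff] at this
      subst this
      exact Or.inl ⟨Or.inl ⟨h.varc_up _ _, h.varc_up _ _⟩, Or.inl (hOut _ _)⟩
    · exact Or.inr (Or.inr (hDown _ _ _))
    · exact Or.inr (Or.inl (hUp _ _ _))
    · have : d ≠ e := fun h0 => hac (by rw [h0])
      rw [units_ne_iff] at this
      subst this
      exact Or.inl ⟨Or.inr ⟨h.varc_down _ _, h.varc_down _ _⟩, Or.inr (hIn _ _)⟩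
  have hadj : (graph m s n r).Adj x y ∧ (graph m s n r).Adj y z := by
    rcases ht with ⟨h1, h2⟩ | ⟨h1, h2⟩
    · exact ⟨h.graph_adj.2 (Or.inr h1), h.graph_adj.2 (Or.inl h2)⟩
    · exact ⟨h.graph_adj.2 (Or.inl h1), h.graph_adj.2 (Or.inr h2)⟩
  have hstr : E (x, y, z) sUp ∨ E (x, y, z) sDown := by
    have h1 := (hcl _ _ _ (φ.map_rel_iff.2 hadj.1) (φ.map_rel_iff.2 hadj.2)
      (φ.injective.ne hxz)).resolve_left (fun h0 => hnt h0.1)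
    have h2 : E (x, y, z) (φ x, φ y, φ z) := ⟨φ, rfl, rfl, rfl⟩
    exact h1.imp (Etrans h2) (Etrans h2)
  have hturn : E (x, y, z) tOut ∨ E (x, y, z) tIn := by
    rcases ht with ⟨h1, h2⟩ | ⟨h1, h2⟩
    · left
      obtain ⟨d, rfl⟩ := h.varc_iff_up.1 h1
      obtain ⟨e, rfl⟩ := h.varc_iff_up.1 h2
      have : d ≠ e := fun h0 => hxz (by rw [h0])
      rw [units_ne_iff] at this
      subst this
      exact hOut _ _
    · right
      obtain ⟨d, rfl⟩ := h.varc_iff_down.1 h1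
      obtain ⟨e, rfl⟩ := h.varc_iff_down.1 h2
      have : d ≠ e := fun h0 => hxz (by rw [h0])
      rw [units_ne_iff] at this
      subst this
      exact hIn _ _
  have rOut : E (h.up (-1) o, o, h.up 1 o) tOut := by simpa using hOut o (-1)
  have rIn : E (h.down (-1) o, o, h.down 1 o) tIn := by simpa using hIn o (-1)
  have rOut' : ∀ {t}, E tOut (t : V × V × V) → E tOut (t.2.2, t.2.1, t.1) := by
    rintro ⟨a, b, c⟩ h0
    exact Etrans (Esymm rOut) (Erev h0)
  have rIn' : ∀ {t}, E tIn (t : V × V × V) → E tIn (t.2.2, t.2.1, t.1) := by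
    rintro ⟨a, b, c⟩ h0
    exact Etrans (Esymm rIn) (Erev h0)
  have hall : E tIn tOut ∧ E sUp tOut ∧ E sDown tOut := by
    rcases hturn with ht | ht
    · have h1 : E tOut sUp ∨ E tOut sDown := hstr.imp (Etrans (Esymm ht)) (Etrans (Esymm ht))
      have h2 : E tOut sUp ∧ E tOut sDown := by
        rcases h1 with h1 | h1
        · exact ⟨h1, rOut' h1⟩
        · exact ⟨rOut' h1, h1⟩
      refine ⟨?_, Esymm h2.1, Esymm h2.2⟩
      obtain ⟨ψ, hψ1, hψ2⟩ := harc o (h.down 1 o) o (h.up 1 o) (h.adj_down 1 o) (h.adj_up 1 o)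
      have h3 : E tIn (h.up 1 o, o, ψ (h.down (-1) o)) := ⟨ψ, hψ2, hψ1, rfl⟩
      have h4 : (graph m s n r).Adj o (ψ (h.down (-1) o)) := by
        rw [← hψ1]
        exact ψ.map_rel_iff.2 (by rw [hψ1]; exact h.adj_down _ o)
      have h5 : h.up 1 o ≠ ψ (h.down (-1) o) := by
        rw [← hψ2]
        exact fun h0 => absurd (h.down_injective (ψ.injective h0)) (by decide)
      rcases h.adj_iff.1 h4 with ⟨e, he⟩ | ⟨e, he⟩
      · rw [he] at h3 h5
        have : (1 : ℤˣ) ≠ e := fun h0 => h5 (by rw [h0])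
        rw [units_ne_iff] at this
        subst this
        exact h3
      · rw [he] at h3
        exact Etrans h3 (Etrans (hDown o e 1) (Esymm h2.2))
    · have h1 : E tIn sUp ∨ E tIn sDown := hstr.imp (Etrans (Esymm ht)) (Etrans (Esymm ht))
      have h2 : E tIn sUp ∧ E tIn sDown := by
        rcases h1 with h1 | h1
        · exact ⟨h1, rIn' h1⟩
        · exact ⟨rIn' h1, h1⟩
      have h6 : E tIn tOut := by
        apply Esymm
        obtain ⟨ψ, hψ1, hψ2⟩ := harc o (h.up 1 o) o (h.down 1 o) (h.adj_up 1 o) (h.adj_down 1 o)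
        have h3 : E tOut (h.down 1 o, o, ψ (h.up (-1) o)) := ⟨ψ, hψ2, hψ1, rfl⟩
        have h4 : (graph m s n r).Adj o (ψ (h.up (-1) o)) := by
          rw [← hψ1]
          exact ψ.map_rel_iff.2 (by rw [hψ1]; exact h.adj_up _ o)
        have h5 : h.down 1 o ≠ ψ (h.up (-1) o) := by
          rw [← hψ2]
          exact fun h0 => absurd (h.up_injective (ψ.injective h0)) (by decide)
        rcases h.adj_iff.1 h4 with ⟨e, he⟩ | ⟨e, he⟩
        · rw [he] at h3
          exact Etrans h3 (Etrans (hUp o 1 e) (Esymm h2.1))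
        · rw [he] at h3 h5
          have : (1 : ℤˣ) ≠ e := fun h0 => h5 (by rw [h0])
          rw [units_ne_iff] at this
          subst this
          exact h3
      exact ⟨h6, Etrans (Esymm h2.1) h6, Etrans (Esymm h2.2) h6⟩
  have hone : ∀ a b c : V, (graph m s n r).Adj a b → (graph m s n r).Adj b c → a ≠ c →
      E (a, b, c) tOut := by
    intro a b c hab hbc hac
    rcases hcl a b c hab hbc hac with ⟨-, h1 | h1⟩ | h1 | h1
    · exact h1
    · exact Etrans h1 hall.1
    · exact Etrans h1 hall.2.1
    · exact Etrans h1 hall.2.2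
  intro a b c a' b' c' hab hbc hac hab' hbc' hac'
  exact Etrans (hone a b c hab hbc hac) (Esymm (hone a' b' c' hab' hbc' hac'))

end CPM

namespace CPM
variable {m s n : ℕ} {r r' : (ZMod n)ˣ}

/-! ### Automorphisms that preserve or reverse the orientation -/

/-- The automorphism `φ` preserves the orientation. -/
def Preserves (φ : graph m s n r ≃g graph m s n r) : Prop := ∀ x y, VArc x y → VArc (φ x) (φ y)

/-- The automorphism `φ` reverses the orientation. -/
def Reverses (φ : graph m s n r ≃g graph m s n r) : Prop := ∀ x y, VArc x y → VArc (φ y) (φ x)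

namespace Admissible

lemma varc_iff_of_reverses (h : Admissible m s n r) {φ : graph m s n r ≃g graph m s n r}
    (hφ : Reverses φ) {x y : verts m s n r} : VArc (φ x) (φ y) ↔ VArc y x := by
  refine ⟨fun hxy => ?_, hφ y x⟩
  have h1 : (graph m s n r).Adj x y := φ.map_rel_iff.1 (h.graph_adj.2 (Or.inl hxy))
  exact (h.graph_adj.1 h1).resolve_left fun h2 => h.varc_asymm hxy (hφ _ _ h2)

lemma preserves_of_mem_group (h : Admissible m s n r) {φ : graph m s n r ≃g graph m s n r}
    (hφ : φ ∈ group m s n r) : Preserves φ := fun _ _ hxy => h.group_arc hφ hxy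

end Admissible

lemma Preserves.mul {φ ψ : graph m s n r ≃g graph m s n r} (hφ : Preserves φ) (hψ : Preserves ψ) :
    Preserves (φ * ψ) := fun _ _ hxy => hφ _ _ (hψ _ _ hxy)

lemma Preserves.mul_reverses {φ ψ : graph m s n r ≃g graph m s n r} (hφ : Preserves φ)
    (hψ : Reverses ψ) : Reverses (φ * ψ) := fun _ _ hxy => hφ _ _ (hψ _ _ hxy)

lemma Reverses.mul {φ ψ : graph m s n r ≃g graph m s n r} (hφ : Reverses φ) (hψ : Reverses ψ) :
    Preserves (φ * ψ) := fun _ _ hxy => hφ _ _ (hψ _ _ hxy)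

lemma Reverses.inv (h : Admissible m s n r) {φ : graph m s n r ≃g graph m s n r}
    (hφ : Reverses φ) : Reverses φ⁻¹ := by
  intro x y hxy
  rw [← h.varc_iff_of_reverses hφ]
  have h1 : ∀ z, φ (φ⁻¹ z) = z := fun z => φ.apply_symm_apply z
  rwa [h1, h1]

lemma Admissible.not_reverses (h : Admissible m s n r) {φ : graph m s n r ≃g graph m s n r}
    (hφ : Preserves φ) : ¬ Reverses φ := by
  intro hψ
  let o : verts m s n r := ⟨(0, 0), zero_mem_verts⟩
  exact h.varc_asymm (hφ _ _ (h.varc_up 1 o)) (hψ _ _ (h.varc_up 1 o))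

open Classical in
/-- An automorphism of `CPM(m,s,n;r)`, extended to all vertices of `CPM̄(m,s,n;r)`. -/
noncomputable def extend (φ : graph m s n r ≃g graph m s n r) (x : Vertex m s n) : Vertex m s n :=
  if hx : x ∈ verts m s n r then φ ⟨x, hx⟩ else x

lemma extend_apply (φ : graph m s n r ≃g graph m s n r) (x : verts m s n r) :
    extend φ x = φ x := by simp [extend]

lemma injOn_extend (φ : graph m s n r ≃g graph m s n r) :
    Set.InjOn (extend φ) (verts m s n r) := by
  intro x hx y hy hxy
  have h1 := extend_apply φ ⟨x, hx⟩
  have h2 := extend_apply φ ⟨y, hy⟩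
  simp only at h1 h2
  rw [h1, h2] at hxy
  exact congrArg Subtype.val (φ.injective (Subtype.ext hxy))

lemma arcMap_extend (h : Admissible m s n r) {φ : graph m s n r ≃g graph m s n r}
    (hφ : Preserves φ) : ArcMap r r (extend φ) := by
  refine ⟨injOn_extend φ, fun x hx y hxy => ?_⟩
  have h1 := extend_apply φ ⟨x, hx⟩
  have h2 := extend_apply φ ⟨y, (h.mem_verts_iff_of_arc hxy).1 hx⟩
  simp only at h1 h2
  rw [h1, h2]
  exact hφ _ _ hxy

/-- The isomorphism from `CPM̄(m,s,n;r)`, with all arcs reversed, to `CPM̄(m,s,n;r⁻¹)`. -/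
def theta (r : (ZMod n)ˣ) (x : Vertex m s n) : Vertex m s n :=
  (-x.1, fun j => (r : ZMod n) * x.2 (-1 - j))

lemma theta_injective : Function.Injective (theta r : Vertex m s n → Vertex m s n) := by
  intro x y hxy
  have h1 : -x.1 = -y.1 := congrArg Prod.fst hxy
  refine Prod.ext (neg_injective h1) (funext fun j => ?_)
  have h2 := congrFun (congrArg Prod.snd hxy) (-1 - j)
  simp only [theta] at h2
  simpa using h2

lemma val_neg_add_one_add {N : ℕ} [NeZero N] (i : ZMod N) : (-(i + 1)).val + (i.val + 1) = N := by
  have h1 : (((-(i + 1)).val + (i.val + 1) : ℕ) : ZMod N) = 0 := by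
    push_cast
    rw [ZMod.natCast_zmod_val, ZMod.natCast_zmod_val]
    ring
  rw [ZMod.natCast_eq_zero_iff] at h1
  obtain ⟨c, hc⟩ := h1
  have h2 := ZMod.val_lt (-(i + 1))
  have h3 := ZMod.val_lt i
  have h4 : c = 1 := by
    rcases c with _ | _ | c
    · omega
    · rfl
    · nlinarith
  rw [hc, h4, mul_one]

lemma wt_neg_add_one (h : Admissible m s n r) (i : ZMod (m * s)) :
    ∃ e : ℤˣ, (wt r (-(i + 1)) : ZMod n) * (r * wt r i) = sg n e := by
  have := h.neZero_mul
  obtain ⟨e, he⟩ := h.exists_pow_eq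
  refine ⟨e, ?_⟩
  have h1 : (r : ZMod n) ^ ((-(i + 1)).val + (i.val + 1)) = sg n e := by
    rw [val_neg_add_one_add, he]
  rw [← h1]
  simp only [wt, Units.val_pow_eq_pow_val]
  ring

lemma theta_arc (h : Admissible m s n r) {x y : Vertex m s n} (hxy : Arc r x y) :
    Arc r⁻¹ (theta r y) (theta r x) := by
  obtain ⟨e, rfl⟩ := hxy
  obtain ⟨f, hf⟩ := wt_neg_add_one h x.1
  have hf' : (wt r⁻¹ (-(x.1 + 1)) : ZMod n) = sg n f * (r * wt r x.1) := by
    have h1 : (wt r⁻¹ (-(x.1 + 1)) : ZMod n) * wt r (-(x.1 + 1)) = 1 := by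
      rw [← Units.val_mul]; simp [wt]
    have := sg_mul_self (n := n) f
    linear_combination (-(wt r⁻¹ (-(x.1 + 1)) : ZMod n)) * this
      + (sg n f * (r * wt r x.1)) * h1 - (wt r⁻¹ (-(x.1 + 1)) : ZMod n) * sg n f * hf
  refine ⟨-(e * f), ?_⟩
  refine Prod.ext (by simp [theta]) (funext fun j => ?_)
  simp only [theta, step_fst, step_snd, Pi.add_apply, Pi.smul_apply, smul_eq_mul, sg_neg, sg_mul]
  by_cases hj : j = label (-(x.1 + 1))
  · have : -1 - j = label x.1 := by rw [hj, label_neg, label_add_one]; ring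
    rw [this, hj, shift_apply_self, shift_apply_self, hf']
    have := sg_mul_self (n := n) f
    linear_combination (sg n e * r * wt r x.1 : ZMod n) * this
  · have : -1 - j ≠ label x.1 := by
      intro h0
      apply hj
      rw [label_neg, label_add_one, ← h0]; ring
    rw [shift_apply_of_ne hj, shift_apply_of_ne this]
    ring

/-- If some automorphism reverses the orientation, then `2 (r ^ (2s) ± 1) = 0`. -/
lemma two_mul_pow_of_reverses (h : Admissible m s n r) (hn4 : n ≠ 4)
    {φ : graph m s n r ≃g graph m s n r} (hφ : Reverses φ) :
    2 * ((r : ZMod n) ^ (2 * s) + 1) = 0 ∨ 2 * ((r : ZMod n) ^ (2 * s) - 1) = 0 := by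
  have hf : ArcMap r r⁻¹ (fun x => theta r (extend φ x)) := by
    refine ⟨fun x hx y hy hxy => injOn_extend φ hx hy (theta_injective hxy), fun x hx y hxy => ?_⟩
    have h1 := extend_apply φ ⟨x, hx⟩
    have h2 := extend_apply φ ⟨y, (h.mem_verts_iff_of_arc hxy).1 hx⟩
    simp only at h1 h2
    rw [h1, h2]
    exact theta_arc h (hφ _ _ hxy)
  obtain ⟨e, he⟩ := hf.two_mul_pow_eq h h.inv hn4
  have h1 : ((r⁻¹ : (ZMod n)ˣ) : ZMod n) ^ s * (r : ZMod n) ^ s = 1 := by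
    rw [← mul_pow]; simp
  have h2 : (2 * r ^ (2 * s) : ZMod n) = 2 * sg n e := by
    rw [two_mul s, pow_add]
    linear_combination (r : ZMod n) ^ s * he + 2 * sg n e * h1
  rcases Int.units_eq_one_or e with rfl | rfl
  · right; simp at h2; linear_combination h2
  · left; simp at h2; linear_combination h2

/-- The vertex `⟨0; 0⟩`. -/
def origin (m s n : ℕ) (r : (ZMod n)ˣ) : verts m s n r := ⟨(0, 0), zero_mem_verts⟩

lemma walk_succ (x : Vertex m s n) (j : ℕ) : walk r x (j + 1) = step r 1 (walk r x j) :=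
  Function.iterate_succ_apply' _ _ _

lemma walk_fst (x : Vertex m s n) (j : ℕ) : (walk r x j).1 = x.1 + (j : ZMod (m * s)) := by
  induction j with
  | zero => simp [walk]
  | succ j ih => rw [walk_succ, step_fst, ih]; push_cast; ring

lemma walk_mem (h : Admissible m s n r) {x : Vertex m s n} (hx : x ∈ verts m s n r) (j : ℕ) :
    walk r x j ∈ verts m s n r := by
  induction j with
  | zero => exact hx
  | succ j ih => rw [walk_succ]; exact h.step_mem ih 1

lemma arcMap_signMap_comp {f : Vertex m s n → Vertex m s n}
    (hf : ArcMap r r f) (ε : ZMod s → ℤˣ) : ArcMap r r (fun x => signMap ε (f x)) := by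
  refine ⟨fun x hx y hy hxy => hf.injOn hx hy ((signPerm m n ε).injective hxy),
    fun x hx y hxy => ?_⟩
  obtain ⟨e, he⟩ := hf.arc x hx y hxy
  exact ⟨_, by rw [he]; exact signMap_step _ _ _⟩

/-- An automorphism that preserves the orientation and fixes `⟨0; 0⟩` is a sign change. -/
lemma exists_signMap_of_preserves (h : Admissible m s n r) (hn4 : n ≠ 4)
    {φ : graph m s n r ≃g graph m s n r} (hφ : Preserves φ)
    (ho : φ (origin m s n r) = origin m s n r) :
    ∃ ε : ZMod s → ℤˣ, IsRestriction φ (signMap ε) := by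
  have hf := arcMap_extend h hφ
  have ho' : extend φ (0, 0) = (0, 0) := by
    have := extend_apply φ (origin m s n r)
    rw [ho] at this
    exact this
  set w : ℕ → Vertex m s n := walk r (0, 0) with hw
  have hwm : ∀ j, w j ∈ verts m s n r := walk_mem h zero_mem_verts
  have hws : ∀ j, w (j + 1) = step r 1 (w j) := walk_succ _
  have harc : ∀ j, Arc r (extend φ (w j)) (extend φ (w (j + 1))) := fun j =>
    hf.arc _ (hwm j) _ ⟨1, hws j⟩
  choose c hc using harc
  let ε : ZMod s → ℤˣ := fun j => c j.val
  have hε0 : signMap ε ((0, 0) : Vertex m s n) = (0, 0) := by ext <;> simp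
  have hfix : ∀ j ≤ s, signMap ε (w j) = extend φ (w j) := by
    intro j hj
    induction j with
    | zero => exact hε0.trans ho'.symm
    | succ j ih =>
      rw [hc, ← ih (by omega), hws, signMap_step]
      congr 1
      have : label (w j).1 = (j : ZMod s) := by
        rw [hw, walk_fst, label_add_natCast]; simp [label_zero]
      rw [this, mul_one]
      simp only [ε]
      rw [ZMod.val_natCast_of_lt (by omega)]
  have hsq : ∀ x : Vertex m s n, signMap ε (signMap ε x) = x := (signPerm m n ε).left_inv
  refine ⟨ε, fun x => ?_⟩
  have h1 := (arcMap_signMap_comp hf ε).eq_id h hn4 (v := w) (hwm 0) (fun j _ => ⟨1, hws j⟩)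
    (fun j hj => by rw [← hfix j hj, hsq]) x.2
  rw [← extend_apply, ← hsq (extend φ x), h1]

lemma IsRestriction.eq {φ ψ : graph m s n r ≃g graph m s n r} {f : Vertex m s n → Vertex m s n}
    (hφ : IsRestriction φ f) (hψ : IsRestriction ψ f) : φ = ψ :=
  RelIso.ext fun x => Subtype.ext ((hφ x).trans (hψ x).symm)

lemma Admissible.exists_signAut (h : Admissible m s n r) (ε : ZMod s → ℤˣ) :
    ∃ φ ∈ group m s n r, IsRestriction φ (signMap ε) :=
  h.exists_mem_group (signPerm_mem h.two_le_s ε) (x := (0, 0)) zero_mem_verts (by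
    have hε0 : signMap ε ((0, 0) : Vertex m s n) = (0, 0) := by ext <;> simp
    change signMap ε (0, 0) ∈ _
    rw [hε0]
    exact zero_mem_verts)

/-- For `n ≠ 4` the group `G` consists of all automorphisms that preserve the orientation. -/
lemma Admissible.mem_group_iff (h : Admissible m s n r) (hn4 : n ≠ 4)
    {φ : graph m s n r ≃g graph m s n r} : φ ∈ group m s n r ↔ Preserves φ := by
  refine ⟨h.preserves_of_mem_group, fun hφ => ?_⟩
  obtain ⟨ψ, hψ, hψo, -⟩ := h.group_transitive (φ (origin m s n r)) (origin m s n r) 1 1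
  obtain ⟨ε, hε⟩ := exists_signMap_of_preserves h hn4
    ((h.preserves_of_mem_group hψ).mul hφ) hψo
  obtain ⟨χ, hχ, hχε⟩ := h.exists_signAut ε
  rw [← hε.eq hχε] at hχ
  exact (Subgroup.mul_mem_cancel_left _ hψ).1 hχ

/-- Sign changes are determined by their effect on the component of `⟨0; 0⟩`. -/
lemma Admissible.signMap_injOn (h : Admissible m s n r) {ε ε' : ZMod s → ℤˣ}
    (hε : ∀ x ∈ verts m s n r, signMap ε x = signMap ε' x) : ε = ε' := by
  have := h.neZero_s
  funext j
  have h1 := hε _ (walk_mem h zero_mem_verts (j.val + 1))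
  rw [walk_succ, signMap_step, signMap_step, hε _ (walk_mem h zero_mem_verts j.val)] at h1
  have h2 := h.step_injective_sign h1
  have : label (walk r ((0, 0) : Vertex m s n) j.val).1 = j := by
    rw [walk_fst, label_add_natCast]; simp [label_zero]
  simpa [this] using h2

/-- For `n ≠ 4` there are `2 ^ s` automorphisms that fix `⟨0; 0⟩` and preserve the orientation. -/
lemma Admissible.card_preserving (h : Admissible m s n r) (hn4 : n ≠ 4) :
    Nat.card {φ : graph m s n r ≃g graph m s n r //
      φ (origin m s n r) = origin m s n r ∧ Preserves φ} = 2 ^ s := by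
  have := h.neZero_s
  choose F hF hFε using h.exists_signAut
  have ho : ∀ ε, F ε (origin m s n r) = origin m s n r := by
    intro ε
    refine Subtype.ext ((hFε ε _).trans ?_)
    ext <;> simp [origin]
  let f : (ZMod s → ℤˣ) → {φ : graph m s n r ≃g graph m s n r //
      φ (origin m s n r) = origin m s n r ∧ Preserves φ} := fun ε =>
    ⟨F ε, ho ε, h.preserves_of_mem_group (hF ε)⟩
  have hf : Function.Bijective f := by
    constructor
    · intro ε ε' hεε
      have h1 : F ε = F ε' := congrArg Subtype.val hεε
      refine h.signMap_injOn (r := r) fun x hx => ?_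
      rw [← hFε ε ⟨x, hx⟩, h1, hFε ε' ⟨x, hx⟩]
    · rintro ⟨φ, hφo, hφ⟩
      obtain ⟨ε, hε⟩ := exists_signMap_of_preserves h hn4 hφ hφo
      exact ⟨ε, Subtype.ext ((hFε ε).eq hε)⟩
  rw [← Nat.card_congr (Equiv.ofBijective f hf)]
  simp

/-- If every automorphism preserves or reverses the orientation, and some automorphism reverses it,
then half of each vertex stabilizer preserves it. -/
lemma Admissible.hasVertexStabilizersOfOrder (h : Admissible m s n r)
    (hdich : ∀ φ : graph m s n r ≃g graph m s n r, Preserves φ ∨ Reverses φ)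
    {ρ : graph m s n r ≃g graph m s n r} (hρ : Reverses ρ) {k : ℕ}
    (hk : Nat.card {φ : graph m s n r ≃g graph m s n r //
      φ (origin m s n r) = origin m s n r ∧ Preserves φ} = 2 ^ k) :
    HasVertexStabilizersOfOrder (graph m s n r) (2 ^ (k + 1)) := by
  set o := origin m s n r with hoo
  -- a reversing automorphism that fixes the origin
  obtain ⟨ψ, hψ, hψo, -⟩ := h.group_transitive (ρ o) o 1 1
  have hη : Reverses (ψ * ρ) := (h.preserves_of_mem_group hψ).mul_reverses hρ
  have hηo : (ψ * ρ) o = o := hψo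
  set η := ψ * ρ with hηdef
  let f : {φ : graph m s n r ≃g graph m s n r // φ o = o ∧ Preserves φ} × Bool →
      MulAction.stabilizer (graph m s n r ≃g graph m s n r) o := fun p =>
    if p.2 then ⟨p.1.1, p.1.2.1⟩ else ⟨p.1.1 * η, by
      change p.1.1 (η o) = o
      rw [hηo, p.1.2.1]⟩
  have hf : Function.Bijective f := by
    constructor
    · rintro ⟨⟨φ, hφo, hφ⟩, b⟩ ⟨⟨φ', hφo', hφ'⟩, b'⟩ heq
      have h1 := congrArg Subtype.val heq
      cases b <;> cases b' <;> simp only [f, if_true, if_false, Bool.false_eq_true] at h1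
      · simp only [Prod.mk.injEq, Subtype.mk.injEq, and_true]
        exact mul_right_cancel h1
      · exact absurd (h1 ▸ hφ.mul_reverses hη) (h.not_reverses hφ')
      · exact absurd (h1 ▸ hφ'.mul_reverses hη) (h.not_reverses hφ)
      · simp only [Prod.mk.injEq, Subtype.mk.injEq, and_true]
        exact h1
    · rintro ⟨φ, hφ⟩
      have hφo : φ o = o := hφ
      rcases hdich φ with h1 | h1
      · exact ⟨(⟨φ, hφo, h1⟩, true), rfl⟩
      · have h2 : Preserves (φ * η⁻¹) := h1.mul (hη.inv h)
        have h3 : (φ * η⁻¹) o = o := by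
          change φ (η⁻¹ o) = o
          have : η⁻¹ o = o := by
            have h4 : η⁻¹ (η o) = o := η.symm_apply_apply o
            rwa [hηo] at h4
          rw [this, hφo]
        refine ⟨(⟨φ * η⁻¹, h3, h2⟩, false), Subtype.ext ?_⟩
        simp [f]
  have h0 : Nat.card (MulAction.stabilizer (graph m s n r ≃g graph m s n r) o) = 2 ^ (k + 1) := by
    rw [← Nat.card_congr (Equiv.ofBijective f hf), Nat.card_prod, hk, pow_succ]
    simp
  intro x
  obtain ⟨χ, -, hχ, -⟩ := h.group_transitive o x 1 1
  have hχ' : χ • o = x := hχ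
  rw [← h0, ← hχ', MulAction.stabilizer_smul_eq_stabilizer_map_conj]
  exact (Nat.card_congr (Subgroup.equivMapOfInjective _ _
    (MulEquiv.injective (MulAut.conj χ))).toEquiv).symm

/-- If every automorphism preserves or reverses the orientation, then `G` and any automorphism that
reverses it generate the whole group. -/
lemma Admissible.closure_eq_top (h : Admissible m s n r) (hn4 : n ≠ 4)
    (hdich : ∀ φ : graph m s n r ≃g graph m s n r, Preserves φ ∨ Reverses φ)
    {η : graph m s n r ≃g graph m s n r} (hη : Reverses η) :
    Subgroup.closure ((group m s n r : Set (graph m s n r ≃g graph m s n r)) ∪ {η}) = ⊤ := by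
  rw [eq_top_iff]
  intro φ _
  have hη' : η ∈ Subgroup.closure ((group m s n r : Set (graph m s n r ≃g graph m s n r)) ∪ {η}) :=
    Subgroup.subset_closure (Or.inr rfl)
  rcases hdich φ with h1 | h1
  · exact Subgroup.subset_closure (Or.inl ((h.mem_group_iff hn4).2 h1))
  · have h2 : φ * η ∈ Subgroup.closure
        ((group m s n r : Set (graph m s n r ≃g graph m s n r)) ∪ {η}) :=
      Subgroup.subset_closure (Or.inl ((h.mem_group_iff hn4).2 (h1.mul hη)))
    exact (Subgroup.mul_mem_cancel_right _ hη').1 h2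

/-- `G` together with an automorphism that reverses the orientation is transitive on the arcs. -/
lemma Admissible.isArcTransitive_of_reverses (h : Admissible m s n r)
    {η : graph m s n r ≃g graph m s n r} (hη : Reverses η) :
    IsArcTransitive (graph m s n r) := by
  have hG : ∀ a b a' b' : verts m s n r, VArc a b → VArc a' b' →
      ∃ φ : graph m s n r ≃g graph m s n r, φ a = a' ∧ φ b = b' := by
    intro a b a' b' hab hab'
    obtain ⟨d, rfl⟩ := h.varc_iff_up.1 hab
    obtain ⟨d', rfl⟩ := h.varc_iff_up.1 hab'
    obtain ⟨φ, -, h1, h2, -⟩ := h.group_transitive a a' (d' * d) 1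
    refine ⟨φ, h1, Subtype.ext ((h2 d).trans ?_)⟩
    rw [mul_assoc, Int.units_mul_self, mul_one]
    rfl
  intro a b a' b' hab hab'
  rcases h.graph_adj.1 hab with h1 | h1 <;> rcases h.graph_adj.1 hab' with h2 | h2
  · exact hG a b a' b' h1 h2
  · obtain ⟨φ, h3, h4⟩ := hG (η b) (η a) b' a' (hη _ _ h1) h2
    exact ⟨φ * η, h4, h3⟩
  · obtain ⟨φ, h3, h4⟩ := hG (η a) (η b) a' b' (hη _ _ h1) h2
    exact ⟨φ * η, h3, h4⟩
  · obtain ⟨φ, h3, h4⟩ := hG b a b' a' h1 h2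
    exact ⟨φ, h4, h3⟩

end CPM

namespace CPM
variable {m s n : ℕ} {r r' : (ZMod n)ˣ}

/-! ### The reflections -/

lemma exists_reverses (h : Admissible m s n r) {f : Vertex m s n → Vertex m s n}
    (hf0 : f (0, 0) = (0, 0)) (hinj : Function.Injective f)
    (hf : ∀ x y, Arc r x y → Arc r (f y) (f x)) :
    ∃ η : graph m s n r ≃g graph m s n r, Reverses η ∧ IsRestriction η f := by
  have := h.finite_vertex
  have hmem : ∀ x ∈ verts m s n r, f x ∈ verts m s n r := by
    intro x hx
    refine h.verts_induction (p := fun x => f x ∈ verts m s n r) zero_mem_verts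
      (by simpa only [hf0] using zero_mem_verts) (fun x y _ hxy => ?_) hx
    exact (h.mem_verts_iff_of_arc (hf x y hxy)).symm
  let F : verts m s n r → verts m s n r := fun x => ⟨f x, hmem x x.2⟩
  have hF : Function.Injective F := fun x y hxy => Subtype.ext (hinj (congrArg Subtype.val hxy))
  let g : Equiv.Perm (verts m s n r) := Equiv.ofBijective F (Finite.injective_iff_bijective.1 hF)
  have hg : ∀ x y, (graph m s n r).Adj x y → (graph m s n r).Adj (g x) (g y) := by
    intro x y hxy
    rw [h.graph_adj] at hxy ⊢
    exact hxy.symm.imp (hf _ _) (hf _ _)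
  exact ⟨⟨g, perm_rel_iff g _ hg⟩, fun x y hxy => hf _ _ hxy, fun x => rfl⟩

lemma label_eq_natCast [NeZero (m * s)] (i : ZMod (m * s)) : label i = (i.val : ZMod s) := by
  conv_lhs => rw [← ZMod.natCast_zmod_val i]
  simp [label]

lemma val_label [NeZero (m * s)] (i : ZMod (m * s)) : (label i).val = i.val % s := by
  rw [label_eq_natCast, ZMod.val_natCast]

/-- The factor `r ^ (2j - 2s + 1)` in the definition of the reflections. -/
def etaCoeff (r : (ZMod n)ˣ) (j : ZMod s) : (ZMod n)ˣ := r ^ (2 * (j.val : ℤ) - 2 * (s : ℤ) + 1)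

/-- The effect of a reflection on an edge at level `i`, compared to the edges at the image level. -/
lemma etaCoeff_mul_wt (h : Admissible m s n r) (i : ZMod (m * s)) :
    ∃ f : ℤˣ, (etaCoeff r (label (-(i + 1))) : ZMod n) * wt r i =
      sg n f * r ^ (2 * s * (i.val / s)) * wt r (-(i + 1)) := by
  have := h.neZero_mul
  have := h.neZero_s
  obtain ⟨f, hf⟩ := wt_neg_add_one h i
  refine ⟨f, ?_⟩
  have h1 : (label (-(i + 1))).val + (i.val % s + 1) = s := by
    rw [label_neg, label_add_one, ← val_label]
    exact val_neg_add_one_add _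
  have h2 := Nat.div_add_mod i.val s
  have h3 : etaCoeff r (label (-(i + 1))) * r * wt r i ^ 2 = r ^ (2 * s * (i.val / s)) := by
    rw [etaCoeff, wt, ← zpow_natCast, ← zpow_natCast, ← zpow_natCast, ← zpow_mul, ← zpow_add_one,
      ← zpow_add]
    congr 1
    have h1' : ((label (-(i + 1))).val : ℤ) + ((i.val % s : ℕ) + 1) = s := by exact_mod_cast h1
    have h2' : (s : ℤ) * (i.val / s : ℕ) + (i.val % s : ℕ) = i.val := by exact_mod_cast h2
    push_cast at h1' h2' ⊢
    linear_combination 2 * h1' - 2 * h2'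
  have h3' := congrArg Units.val h3
  push_cast at h3'
  rw [← h3']
  have hff := sg_mul_self (n := n) f
  linear_combination (-(etaCoeff r (label (-(i + 1))) : ZMod n) * wt r i * sg n f) * hf
    - (etaCoeff r (label (-(i + 1))) : ZMod n) * wt r i * hff

lemma eta_eq (x : Vertex m s n) : eta m s n r x =
    (-x.1, fun j => (etaCoeff r j : ZMod n) * x.2 (-1 - j)) := rfl

lemma eta_injective : Function.Injective (eta m s n r) := by
  intro x y hxy
  rw [eta_eq, eta_eq] at hxy
  have h1 : -x.1 = -y.1 := congrArg Prod.fst hxy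
  refine Prod.ext (neg_injective h1) (funext fun j => ?_)
  have h2 := congrFun (congrArg Prod.snd hxy) (-1 - j)
  simpa using h2

/-- A reflection `⟨i; v⟩ ↦ ⟨-i; (r ^ (2j - 2s + 1) v_{-1-j} + δ_j(i))_j⟩` reverses the arcs, if
passing from level `i` to level `i + 1` changes only one component of `δ` and if this change is
compensated for by the deviation of `r ^ (2s⌊i/s⌋)` from `±1`. -/
lemma reflection_arc (h : Admissible m s n r) (δ : ZMod (m * s) → ZMod s → ZMod n)
    (h1 : ∀ i j, j ≠ label (-(i + 1)) → δ i j = δ (i + 1) j)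
    (h2 : ∀ i, ∃ g : ℤˣ, ∀ e : ℤˣ, sg n e * r ^ (2 * s * (i.val / s)) * wt r (-(i + 1)) +
      δ (i + 1) (label (-(i + 1))) =
      sg n (e * g) * wt r (-(i + 1)) + δ i (label (-(i + 1)))) {x y : Vertex m s n}
    (hxy : Arc r x y) :
    Arc r ((eta m s n r y).1, fun j => (eta m s n r y).2 j + δ y.1 j)
      ((eta m s n r x).1, fun j => (eta m s n r x).2 j + δ x.1 j) := by
  obtain ⟨e, rfl⟩ := hxy
  obtain ⟨f, hf⟩ := etaCoeff_mul_wt h x.1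
  obtain ⟨g, hg⟩ := h2 x.1
  refine ⟨-(e * f * g), ?_⟩
  rw [eta_eq, eta_eq]
  refine Prod.ext (by simp) (funext fun j => ?_)
  simp only [step_fst, step_snd, Pi.add_apply, Pi.smul_apply, smul_eq_mul, sg_neg]
  by_cases hj : j = label (-(x.1 + 1))
  · have : -1 - j = label x.1 := by rw [hj, label_neg, label_add_one]; ring
    rw [this, hj, shift_apply_self, shift_apply_self]
    have h3 := hg (e * f)
    rw [sg_mul] at h3
    linear_combination -h3 - sg n e * hf
  · have : -1 - j ≠ label x.1 := by
      intro h0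
      apply hj
      rw [label_neg, label_add_one, ← h0]; ring
    rw [shift_apply_of_ne hj, shift_apply_of_ne this, h1 _ _ hj]
    ring

lemma exists_eta (h : Admissible m s n r)
    (hr : (r : ZMod n) ^ (2 * s) + 1 = 0 ∨ (r : ZMod n) ^ (2 * s) - 1 = 0) :
    ∃ η : graph m s n r ≃g graph m s n r, Reverses η ∧ IsRestriction η (eta m s n r) := by
  obtain ⟨a, ha⟩ : ∃ a : ℤˣ, (r : ZMod n) ^ (2 * s) = sg n a := by
    rcases hr with hr | hr
    · exact ⟨-1, by simp; linear_combination hr⟩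
    · exact ⟨1, by simp; linear_combination hr⟩
  have hpow : ∀ k : ℕ, sg n a ^ k = sg n (a ^ k) := by intro k; simp [sg]
  refine exists_reverses h ?_ eta_injective fun x y hxy => ?_
  · rw [eta_eq]; ext <;> simp
  · have := reflection_arc h (fun _ _ => 0) (fun _ _ _ => rfl)
      (fun i => ⟨a ^ (i.val / s), fun e => by rw [pow_mul, ha, hpow, sg_mul]⟩) hxy
    simpa using this

lemma half_of_two_mul_eq_zero [NeZero n] {a : ZMod n} (ha : a ≠ 0) (h2 : 2 * a = 0) :
    2 ∣ n ∧ a = ((n / 2 : ℕ) : ZMod n) := by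
  have h1 : ((2 * a.val : ℕ) : ZMod n) = 0 := by
    push_cast; rw [ZMod.natCast_zmod_val, h2]
  rw [ZMod.natCast_eq_zero_iff] at h1
  obtain ⟨c, hc⟩ := h1
  have h3 := ZMod.val_lt a
  have h4 : a.val ≠ 0 := by rwa [Ne, ZMod.val_eq_zero]
  have h5 : c = 1 := by
    rcases c with _ | _ | c
    · omega
    · rfl
    · nlinarith
  rw [h5, mul_one] at hc
  refine ⟨⟨_, hc.symm⟩, ?_⟩
  rw [← ZMod.natCast_zmod_val a]
  congr 1
  omega

/-- In the case of the reflection with offsets, `r ^ (2s) = ±1 + n / 2`, and `4` divides both `n`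
and `m`. -/
lemma etaPrime_arithmetic (h : Admissible m s n r)
    (hr : ¬ ((r : ZMod n) ^ (2 * s) + 1 = 0 ∨ (r : ZMod n) ^ (2 * s) - 1 = 0))
    (hr2 : 2 * ((r : ZMod n) ^ (2 * s) + 1) = 0 ∨ 2 * ((r : ZMod n) ^ (2 * s) - 1) = 0) :
    4 ∣ n ∧ 4 ∣ m ∧ (∃ a : ℤˣ, (r : ZMod n) ^ (2 * s) = sg n a + ((n / 2 : ℕ) : ZMod n)) ∧
      (r : ZMod n) ^ (4 * s) = 1 := by
  have := h.neZero_n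
  push Not at hr
  have h1 : 2 ∣ n ∧ ∃ a : ℤˣ, (r : ZMod n) ^ (2 * s) = sg n a + ((n / 2 : ℕ) : ZMod n) := by
    rcases hr2 with hr2 | hr2
    · obtain ⟨h1, h2⟩ := half_of_two_mul_eq_zero hr.1 hr2
      exact ⟨h1, -1, by rw [← h2]; simp⟩
    · obtain ⟨h1, h2⟩ := half_of_two_mul_eq_zero hr.2 hr2
      exact ⟨h1, 1, by rw [← h2]; simp⟩
  obtain ⟨h2, a, ha⟩ := h1
  have h4 : 4 ∣ n := by
    -- modulo `2` the equation reads `1 = 1 + n / 2`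
    let c := ZMod.castHom h2 (ZMod 2)
    have hu : ∀ u : (ZMod 2)ˣ, (u : ZMod 2) = 1 := by decide
    have hcr : c (r : ZMod n) = 1 := hu (Units.map c.toMonoidHom r)
    have hca : c (sg n a) = 1 := by
      rcases Int.units_eq_one_or a with rfl | rfl
      · simp
      · simp
    have h3 := congrArg c ha
    rw [map_pow, map_add, hcr, hca, map_natCast, one_pow] at h3
    have h5 : ((n / 2 : ℕ) : ZMod 2) = 0 := by linear_combination -h3
    rw [ZMod.natCast_eq_zero_iff] at h5
    omega
  obtain ⟨k, rfl⟩ := h4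
  have hn2 : 4 * k / 2 = 2 * k := by omega
  have hz : (4 * k : ZMod (4 * k)) = 0 := by exact_mod_cast ZMod.natCast_self (4 * k)
  have h4s : (r : ZMod (4 * k)) ^ (4 * s) = 1 := by
    rw [show 4 * s = 2 * s * 2 by ring, pow_mul, ha, hn2]
    push_cast
    have := sg_sq (n := 4 * k) a
    linear_combination this + (sg (4 * k) a + k) * hz
  refine ⟨dvd_mul_right _ _, ?_, ⟨a, ha⟩, h4s⟩
  have hm1 : ∃ e : ℤˣ, (r : ZMod (4 * k)) ^ (m * s) = sg (4 * k) e := h.exists_pow_eq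
  obtain ⟨e, he⟩ := hm1
  have hm2 : ¬ Odd m := by
    rintro ⟨q, rfl⟩
    apply hr.2
    have h3 : (r : ZMod (4 * k)) ^ ((2 * q + 1) * s * 2) = 1 := by
      rw [pow_mul, he, sg_sq]
    rw [show (2 * q + 1) * s * 2 = 4 * s * q + 2 * s by ring, pow_add, pow_mul, h4s, one_pow,
      one_mul] at h3
    rw [h3, sub_self]
  obtain ⟨q, hq⟩ := Nat.not_odd_iff_even.1 hm2
  have hq2 : ¬ Odd q := by
    rintro ⟨p, rfl⟩
    rw [hq, show (2 * p + 1 + (2 * p + 1)) * s = 4 * s * p + 2 * s by ring, pow_add, pow_mul, h4s,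
      one_pow, one_mul] at he
    rcases Int.units_eq_one_or e with rfl | rfl
    · exact hr.2 (by rw [he]; simp)
    · exact hr.1 (by rw [he]; simp)
  obtain ⟨p, hp⟩ := Nat.not_odd_iff_even.1 hq2
  exact ⟨p, by omega⟩

/-- The offsets change, from one level to the next, in the one component that the edges at this
level change, and there only at the levels `i` with `⌊i / s⌋` odd. -/
lemma delta_succ (h : Admissible m s n r) (h4 : 4 ∣ m) (i : ZMod (m * s)) :
    (∀ j, j ≠ label (-(i + 1)) → (delta i j : ZMod n) = delta (i + 1) j) ∧
    (Even (i.val / s) → (delta i (label (-(i + 1))) : ZMod n) = delta (i + 1) (label (-(i + 1)))) ∧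
    (Odd (i.val / s) → (delta i (label (-(i + 1))) : ZMod n) = ((n / 2 : ℕ) : ZMod n) ∧
        (delta (i + 1) (label (-(i + 1))) : ZMod n) = 0 ∨
      (delta i (label (-(i + 1))) : ZMod n) = 0 ∧
        (delta (i + 1) (label (-(i + 1))) : ZMod n) = ((n / 2 : ℕ) : ZMod n)) := by
  have := h.neZero_mul
  have := h.neZero_s
  have hs2 := h.two_le_s
  have : Fact (1 < m * s) := ⟨by have := h.two_le_mul; omega⟩
  have hlt := ZMod.val_lt i
  set t := i.val % (4 * s) with ht
  have hts : t < 4 * s := Nat.mod_lt _ (by omega)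
  have ht' : (i + 1).val % (4 * s) = if t + 1 = 4 * s then 0 else t + 1 := by
    have h1 : (i + 1).val = (i.val + 1) % (m * s) := by rw [ZMod.val_add, ZMod.val_one]
    rw [h1, Nat.mod_mod_of_dvd _ (Nat.mul_dvd_mul_right h4 s), Nat.add_mod, ← ht,
      Nat.mod_eq_of_lt (show 1 < 4 * s by omega)]
    split_ifs with h0
    · rw [h0, Nat.mod_self]
    · exact Nat.mod_eq_of_lt (by omega)
  -- `i = 4 s A + t` and `t = s a + b`
  obtain ⟨A, hA⟩ : ∃ A, i.val = 4 * s * A + t := ⟨i.val / (4 * s), (Nat.div_add_mod _ _).symm⟩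
  have hb := Nat.mod_lt t (show 0 < s by omega)
  have ha : t = s * (t / s) + t % s := (Nat.div_add_mod _ _).symm
  set a := t / s with had
  set b := t % s with hbd
  have ha4 : a < 4 := by
    rw [had, Nat.div_lt_iff_lt_mul (by omega)]; omega
  have hq : i.val / s = 4 * A + a := by
    rw [hA, show 4 * s * A + t = t + s * (4 * A) by ring, Nat.add_mul_div_left _ _ (by omega)]
    omega
  have hb' : i.val % s = b := by
    rw [hA, show 4 * s * A + t = t + s * (4 * A) by ring, Nat.add_mul_mod_self_left]
  have hj0 : (label (-(i + 1))).val + (b + 1) = s := by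
    rw [← hb', label_neg, label_add_one, ← val_label]
    exact val_neg_add_one_add _
  have hparity : (Even (i.val / s) ↔ Even a) ∧ (Odd (i.val / s) ↔ Odd a) := by
    rw [hq]
    simp only [Nat.even_iff, Nat.odd_iff]
    omega
  rw [hparity.1, hparity.2]
  have hdelta : ∀ j : ZMod s, (delta i j : ZMod n) =
      if 2 * s ≤ t + j.val ∧ t + j.val ≤ 4 * s - 1 then ((n / 2 : ℕ) : ZMod n) else 0 :=
    fun j => rfl
  have hdelta' : ∀ j : ZMod s, (delta (i + 1) j : ZMod n) =
      if 2 * s ≤ (if t + 1 = 4 * s then 0 else t + 1) + j.val ∧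
        (if t + 1 = 4 * s then 0 else t + 1) + j.val ≤ 4 * s - 1 then ((n / 2 : ℕ) : ZMod n)
      else 0 := by
    intro j
    rw [← ht']
    rfl
  have hcond : ∀ j : ZMod s, j.val ≠ s - 1 - b →
      ((2 * s ≤ t + j.val ∧ t + j.val ≤ 4 * s - 1) ↔
      (2 * s ≤ (if t + 1 = 4 * s then 0 else t + 1) + j.val ∧
        (if t + 1 = 4 * s then 0 else t + 1) + j.val ≤ 4 * s - 1)) := by
    intro j hj
    have := ZMod.val_lt j
    clear_value a b t
    interval_cases a <;> split_ifs <;> omega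
  refine ⟨fun j hj => ?_, fun hev => ?_, fun hodd => ?_⟩
  · rw [hdelta, hdelta']
    refine if_congr (hcond j fun h0 => hj ?_) rfl rfl
    apply ZMod.val_injective s
    omega
  · rw [hdelta, hdelta']
    refine if_congr ?_ rfl rfl
    have hJ := hj0
    generalize (label (-(i + 1))).val = J at hJ ⊢
    clear_value a b t
    interval_cases a
    · split_ifs <;> omega
    · exact absurd hev (by decide)
    · split_ifs <;> omega
    · exact absurd hev (by decide)
  · rw [hdelta, hdelta']
    have hJ := hj0
    generalize (label (-(i + 1))).val = J at hJ ⊢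
    clear_value a b t
    interval_cases a
    · exact absurd hodd (by decide)
    · right
      rw [if_neg (by omega), if_pos (by split_ifs <;> omega)]
      exact ⟨rfl, rfl⟩
    · exact absurd hodd (by decide)
    · left
      rw [if_pos (by omega), if_neg (by split_ifs <;> omega)]
      exact ⟨rfl, rfl⟩

lemma exists_etaPrime (h : Admissible m s n r)
    (hr : ¬ ((r : ZMod n) ^ (2 * s) + 1 = 0 ∨ (r : ZMod n) ^ (2 * s) - 1 = 0))
    (hr2 : 2 * ((r : ZMod n) ^ (2 * s) + 1) = 0 ∨ 2 * ((r : ZMod n) ^ (2 * s) - 1) = 0) :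
    ∃ η : graph m s n r ≃g graph m s n r, Reverses η ∧ IsRestriction η (etaPrime m s n r) := by
  obtain ⟨h4n, h4m, ⟨a, ha⟩, h4s⟩ := etaPrime_arithmetic h hr hr2
  have := h.neZero_n
  have := h.neZero_s
  have hs2 := h.two_le_s
  set N : ZMod n := ((n / 2 : ℕ) : ZMod n) with hN
  have hNN : N + N = 0 := by
    have h1 : n / 2 + n / 2 = n := by omega
    rw [hN, ← Nat.cast_add, h1, ZMod.natCast_self]
  -- `n / 2` is fixed by units, which are odd
  have hNu : ∀ u : (ZMod n)ˣ, (u : ZMod n) * N = N := by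
    intro u
    have h2n : 2 ∣ n := dvd_trans (by norm_num) h4n
    have hodd : Odd (u : ZMod n).val := by
      by_contra hev
      rw [Nat.not_odd_iff_even, even_iff_two_dvd] at hev
      have h1 := ZMod.val_coe_unit_coprime u
      have := Nat.dvd_gcd hev h2n
      rw [h1] at this
      omega
    obtain ⟨q, hq⟩ := hodd
    rw [← ZMod.natCast_zmod_val (u : ZMod n), hq]
    push_cast
    linear_combination (q : ZMod n) * hNN
  have hNs : ∀ e : ℤˣ, sg n e * N = N := by
    intro e
    rcases Int.units_eq_one_or e with rfl | rfl
    · simp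
    · simp; linear_combination -hNN
  refine exists_reverses h ?_ ?_ fun x y hxy => ?_
  · have : ∀ j : ZMod s, (delta (0 : ZMod (m * s)) j : ZMod n) = 0 := by
      intro j
      have := ZMod.val_lt j
      rw [delta, if_neg]
      simp
      omega
    ext
    · simp [etaPrime, eta]
    · simp [etaPrime, eta, this]
  · intro x y hxy
    have h1 : -x.1 = -y.1 := congrArg Prod.fst hxy
    have h1' := neg_injective h1
    refine eta_injective (r := r) (Prod.ext h1 (funext fun j => ?_))
    have h2 : (eta m s n r x).2 j + delta x.1 j = (eta m s n r y).2 j + delta y.1 j :=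
      congrFun (congrArg Prod.snd hxy) j
    rw [h1'] at h2
    exact add_right_cancel h2
  · refine reflection_arc h (fun i j => delta i j) (fun i => (delta_succ h h4m i).1)
      (fun i => ?_) hxy
    obtain ⟨-, hev, hodd⟩ := delta_succ (n := n) h h4m i
    rcases Nat.even_or_odd (i.val / s) with hq | hq
    · refine ⟨1, fun e => ?_⟩
      simp only [hev hq]
      obtain ⟨q, hq⟩ := hq
      rw [hq, show 2 * s * (q + q) = 4 * s * q by ring, pow_mul, h4s]
      simp
    · refine ⟨a, fun e => ?_⟩
      have hpow : (r : ZMod n) ^ (2 * s * (i.val / s)) = sg n a + N := by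
        obtain ⟨q, hq⟩ := hq
        rw [hq, show 2 * s * (2 * q + 1) = 4 * s * q + 2 * s by ring, pow_add, pow_mul, h4s, ha]
        simp
      have h1 : sg n e * (sg n a + N) * wt r (-(i + 1)) =
          sg n (e * a) * wt r (-(i + 1)) + N := by
        rw [sg_mul]
        linear_combination (wt r (-(i + 1)) : ZMod n) * hNs e + hNu (wt r (-(i + 1)))
      rw [hpow, h1]
      rcases hodd hq with ⟨h2, h3⟩ | ⟨h2, h3⟩
      · simp only [h2, h3]; ring
      · simp only [h2, h3]; linear_combination hNN

end CPM

/-! ### Praeger–Xu graphs -/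

namespace PraegerXu
variable {t s : ℕ}

/-- The arcs of the Praeger–Xu graph. -/
def PArc (x y : ZMod t × (Fin s → ZMod 2)) : Prop :=
  y.1 = x.1 + 1 ∧ ∀ (j : ℕ) (hj : j + 1 < s), y.2 ⟨j, Nat.lt_of_succ_lt hj⟩ = x.2 ⟨j + 1, hj⟩

/-- The out-neighbour of `x` with new last entry `a`. -/
def succ (a : ZMod 2) (x : ZMod t × (Fin s → ZMod 2)) : ZMod t × (Fin s → ZMod 2) :=
  (x.1 + 1, fun j => if hj : j.val + 1 < s then x.2 ⟨j.val + 1, hj⟩ else a)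

/-- The in-neighbour of `x` with first entry `0`. -/
def pred (x : ZMod t × (Fin s → ZMod 2)) : ZMod t × (Fin s → ZMod 2) :=
  (x.1 - 1, fun j => if j.val = 0 then 0 else x.2 ⟨j.val - 1, by omega⟩)

lemma pArc_succ (a : ZMod 2) (x : ZMod t × (Fin s → ZMod 2)) : PArc x (succ a x) :=
  ⟨rfl, fun j hj => by simp [succ, hj]⟩

lemma pArc_pred (x : ZMod t × (Fin s → ZMod 2)) : PArc (pred x) x :=
  ⟨by simp [pred], fun j hj => by simp [pred]⟩

/-- The Praeger–Xu graph is connected. -/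
lemma induction [NeZero t] {p : ZMod t × (Fin s → ZMod 2) → Prop} (h0 : p (0, 0))
    (hp : ∀ x y, PArc x y → (p x ↔ p y)) (x : ZMod t × (Fin s → ZMod 2)) : p x := by
  have h1 : ∀ k : ℕ, ∀ x y : ZMod t × (Fin s → ZMod 2), x.1 = y.1 →
      (∀ j : Fin s, k ≤ j.val → x.2 j = y.2 j) → (p x ↔ p y) := by
    intro k
    induction k with
    | zero =>
      intro x y hxy hj
      rw [Prod.ext hxy (funext fun j => hj j (Nat.zero_le _))]
    | succ k ih =>
      intro x y hxy hj
      rw [hp _ _ (pArc_succ 0 x), hp _ _ (pArc_succ 0 y)]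
      refine ih _ _ (by simp [succ, hxy]) fun j hkj => ?_
      simp only [succ]
      split_ifs with h2
      · exact hj _ (by simp only; omega)
      · rfl
  have h2 : ∀ i : ℕ, p ((i : ZMod t), 0) := by
    intro i
    induction i with
    | zero => simpa using h0
    | succ i ih =>
      rw [hp _ _ (pArc_succ 0 _)] at ih
      refine (h1 s _ _ ?_ fun j hj => absurd j.2 (by omega)).1 ih
      simp [succ]
  have h3 := h2 x.1.val
  rw [ZMod.natCast_zmod_val] at h3
  exact (h1 s (x.1, 0) x rfl fun j hj => absurd j.2 (by omega)).1 h3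

lemma praegerXu_adj (ht : 3 ≤ t) {x y : ZMod t × (Fin s → ZMod 2)} :
    (praegerXu t s).Adj x y ↔ PArc x y ∨ PArc y x := by
  have h1 : (praegerXu t s).Adj x y ↔ x ≠ y ∧ (PArc x y ∨ PArc y x) := by
    rw [praegerXu, SimpleGraph.fromRel_adj]; rfl
  rw [h1]
  refine ⟨fun h => h.2, fun h => ⟨?_, h⟩⟩
  rintro rfl
  have : Fact (1 < t) := ⟨by omega⟩
  have h2 : x.1 = x.1 + 1 := (h.elim id id).1
  exact one_ne_zero (α := ZMod t) (by linear_combination -h2)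

/-- The automorphism `(i, b) ↦ (i, (b_k + h_{i + k})_k)`. -/
def flip (h : ZMod t → ZMod 2) : Equiv.Perm (ZMod t × (Fin s → ZMod 2)) where
  toFun x := (x.1, fun k => x.2 k + h (x.1 + (k.val : ZMod t)))
  invFun x := (x.1, fun k => x.2 k - h (x.1 + (k.val : ZMod t)))
  left_inv x := by ext <;> simp
  right_inv x := by ext <;> simp

lemma flip_pArc (h : ZMod t → ZMod 2) {x y : ZMod t × (Fin s → ZMod 2)} (hxy : PArc x y) :
    PArc (flip h x) (flip h y) := by
  refine ⟨hxy.1, fun j hj => ?_⟩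
  change y.2 _ + h (y.1 + (j : ZMod t)) = x.2 _ + h (x.1 + ((j + 1 : ℕ) : ZMod t))
  rw [hxy.2 j hj, hxy.1]
  push_cast
  rw [add_assoc, add_comm 1 (j : ZMod t)]

/-- Every permutation that preserves the arcs and fixes a vertex is of the form `flip h`, because it
respects agreement in the last entries (having a common descendant) and agreement in the first
entries (having a common ancestor). -/
lemma exists_eq_flip [NeZero t] (hs : 1 ≤ s) (F : Equiv.Perm (ZMod t × (Fin s → ZMod 2)))
    (hF : ∀ x y, PArc x y → PArc (F x) (F y)) (hF0 : F (0, 0) = (0, 0)) :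
    ∃ h : ZMod t → ZMod 2, (∀ k < s, h (k : ZMod t) = 0) ∧ F = flip h := by
  have hlev : ∀ x, (F x).1 = x.1 := by
    refine induction (by rw [hF0]) fun x y hxy => ?_
    rw [(hF x y hxy).1, hxy.1]
    exact (add_left_inj _).symm
  have hsuf : ∀ k : ℕ, ∀ x y, x.1 = y.1 → (∀ j : Fin s, k ≤ j.val → x.2 j = y.2 j) →
      ∀ j : Fin s, k ≤ j.val → (F x).2 j = (F y).2 j := by
    intro k
    induction k with
    | zero =>
      intro x y hxy hj j _
      rw [Prod.ext hxy (funext fun j => hj j (Nat.zero_le _))]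
    | succ k ih =>
      rintro x y hxy hj ⟨j, hjs⟩ hkj
      simp only at hkj
      obtain ⟨i, rfl⟩ : ∃ i, j = i + 1 := ⟨j - 1, by omega⟩
      rw [← (hF _ _ (pArc_succ 0 x)).2 i hjs, ← (hF _ _ (pArc_succ 0 y)).2 i hjs]
      refine ih _ _ (by simp [succ, hxy]) (fun q hq => ?_) _ (by simp only; omega)
      simp only [succ]
      split_ifs with h2
      · exact hj _ (by simp only; omega)
      · rfl
  have hpre : ∀ k : ℕ, ∀ x y, x.1 = y.1 → (∀ j : Fin s, j.val + k < s → x.2 j = y.2 j) →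
      ∀ j : Fin s, j.val + k < s → (F x).2 j = (F y).2 j := by
    intro k
    induction k with
    | zero =>
      intro x y hxy hj j _
      rw [Prod.ext hxy (funext fun j => hj j (by omega))]
    | succ k ih =>
      rintro x y hxy hj ⟨j, hjs⟩ hkj
      simp only at hkj
      rw [(hF _ _ (pArc_pred x)).2 j (by omega), (hF _ _ (pArc_pred y)).2 j (by omega)]
      refine ih _ _ (by simp [pred, hxy]) (fun q hq => ?_) _ (by simp only; omega)
      simp only [pred]
      split_ifs with h2
      · rfl
      · exact hj _ (by simp only; omega)
  -- each entry of `F x` depends only on the corresponding entry of `x`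
  have hloc : ∀ (i : ZMod t) (b : Fin s → ZMod 2) (k : Fin s),
      (F (i, b)).2 k = b k + (F (i, 0)).2 k := by
    intro i b k
    have h1 : (F (i, b)).2 k = (F (i, Pi.single k (b k))).2 k := by
      let b' : Fin s → ZMod 2 := fun j => if j.val ≤ k.val then b j else 0
      have h2 : (F (i, b)).2 k = (F (i, b')).2 k := by
        refine hpre (s - 1 - k.val) (i, b) (i, b') rfl (fun j hj => ?_) k (by omega)
        simp only [b']
        rw [if_pos (by omega)]
      rw [h2]
      refine hsuf k.val (i, b') (i, Pi.single k (b k)) rfl (fun j hj => ?_) k le_rfl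
      simp only [b']
      by_cases hjk : j = k
      · subst hjk; simp
      · have : ¬ j.val ≤ k.val := fun h0 => hjk (Fin.ext (by omega))
        simp [hjk, this]
    rw [h1]
    rcases (show ∀ a : ZMod 2, a = 0 ∨ a = 1 by decide) (b k) with hb | hb
    · rw [hb, Pi.single_zero, zero_add]
    · rw [hb]
      have h2 : (F (i, Pi.single k 1)).2 k ≠ (F (i, 0)).2 k := by
        intro h0
        have h3 : F (i, Pi.single k 1) = F (i, 0) := by
          refine Prod.ext ((hlev _).trans (hlev (i, 0)).symm) (funext fun j => ?_)
          rcases lt_trichotomy j.val k.val with hjk | hjk | hjk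
          · refine hpre (s - k.val) (i, Pi.single k 1) (i, 0) rfl (fun q hq => ?_) j (by omega)
            have : q ≠ k := fun h5 => by rw [h5] at hq; omega
            simp [this]
          · rw [Fin.ext hjk, h0]
          · refine hsuf (k.val + 1) (i, Pi.single k 1) (i, 0) rfl (fun q hq => ?_) j hjk
            have : q ≠ k := fun h5 => by rw [h5] at hq; omega
            simp [this]
        have h4 := congrFun (congrArg Prod.snd (F.injective h3)) k
        simp at h4
      generalize (F (i, Pi.single k 1)).2 k = u at h2
      generalize (F (i, 0)).2 k = w at h2
      revert h2 u w
      decide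
  let c : ZMod t → Fin s → ZMod 2 := fun i k => (F (i, 0)).2 k
  let h : ZMod t → ZMod 2 := fun i => c i ⟨0, hs⟩
  have hc : ∀ (k : ℕ) (hk : k < s) (i : ZMod t), c i ⟨k, hk⟩ = h (i + (k : ZMod t)) := by
    intro k
    induction k with
    | zero => intro hk i; simp [h]
    | succ k ih =>
      intro hk i
      have h1 : PArc (i, (0 : Fin s → ZMod 2)) (i + 1, 0) := ⟨rfl, fun _ _ => rfl⟩
      have h2 := (hF _ _ h1).2 k hk
      change c (i + 1) ⟨k, _⟩ = c i ⟨k + 1, hk⟩ at h2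
      rw [← h2, ih]
      push_cast
      rw [add_assoc, add_comm 1 (k : ZMod t)]
  refine ⟨h, fun k hk => ?_, Equiv.ext fun x => ?_⟩
  · have h1 := hc k hk 0
    rw [zero_add] at h1
    rw [← h1]
    simp only [c, hF0]
    rfl
  · refine Prod.ext (hlev x) (funext fun k => ?_)
    have h1 := hloc x.1 x.2 k
    rw [show (F (x.1, 0)).2 k = c x.1 k from rfl, show c x.1 k = _ from hc k.1 k.2 x.1] at h1
    exact h1

lemma card_flips [NeZero t] (hst : s ≤ t) :
    Nat.card {h : ZMod t → ZMod 2 // ∀ k < s, h (k : ZMod t) = 0} = 2 ^ (t - s) := by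
  let e1 : {h : ZMod t → ZMod 2 // ∀ k < s, h (k : ZMod t) = 0} ≃ (Fin (t - s) → ZMod 2) :=
    { toFun := fun h q => h.1 ((q.val + s : ℕ) : ZMod t)
      invFun := fun g => ⟨fun i => if hi : s ≤ i.val then
        g ⟨i.val - s, by have := ZMod.val_lt i; omega⟩ else 0, fun k hk => by
          refine dif_neg ?_
          rw [ZMod.val_natCast_of_lt (by omega)]
          omega⟩
      left_inv := by
        rintro ⟨h, hh⟩
        refine Subtype.ext (funext fun i => ?_)
        simp only
        split_ifs with hi
        · rw [Nat.sub_add_cancel hi, ZMod.natCast_zmod_val]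
        · have := hh i.val (by omega)
          rw [ZMod.natCast_zmod_val] at this
          exact this.symm
      right_inv := by
        intro g
        funext q
        have h1 : ((q.val + s : ℕ) : ZMod t).val = q.val + s := ZMod.val_natCast_of_lt (by omega)
        simp [-Nat.cast_add, h1] }
  rw [Nat.card_congr e1]
  simp

/-- The automorphisms of a Praeger–Xu graph that preserve the orientation and fix `(0, 0)`. -/
lemma card_preserving (ht : 3 ≤ t) (hs : 1 ≤ s) (hst : s ≤ t) :
    Nat.card {φ : praegerXu t s ≃g praegerXu t s //
      φ (0, 0) = (0, 0) ∧ ∀ x y, PArc x y → PArc (φ x) (φ y)} = 2 ^ (t - s) := by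
  have : NeZero t := ⟨by omega⟩
  rw [← card_flips hst]
  let f : {h : ZMod t → ZMod 2 // ∀ k < s, h (k : ZMod t) = 0} →
      {φ : praegerXu t s ≃g praegerXu t s //
        φ (0, 0) = (0, 0) ∧ ∀ x y, PArc x y → PArc (φ x) (φ y)} := fun h =>
    ⟨⟨flip h.1, CPM.perm_rel_iff _ (praegerXu t s).Adj fun x y hxy => by
      rw [praegerXu_adj ht] at hxy ⊢
      exact hxy.imp (flip_pArc _) (flip_pArc _)⟩, by
        refine Prod.ext rfl (funext fun k => ?_)
        change (0 : ZMod 2) + h.1 (0 + (k.val : ZMod t)) = 0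
        rw [zero_add, zero_add, h.2 k.1 k.2], fun x y => flip_pArc _⟩
  refine (Nat.card_congr (Equiv.ofBijective f ⟨?_, ?_⟩)).symm
  · intro h h' hh
    refine Subtype.ext (funext fun i => ?_)
    have h1 : flip h.1 (i, (0 : Fin s → ZMod 2)) = flip h'.1 (i, 0) := by
      have := congrArg (fun φ => φ.1 (i, (0 : Fin s → ZMod 2))) hh
      exact this
    have h2 : (0 : ZMod 2) + h.1 (i + ((0 : ℕ) : ZMod t)) = 0 + h'.1 (i + ((0 : ℕ) : ZMod t)) :=
      congrFun (congrArg Prod.snd h1) ⟨0, hs⟩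
    simpa using h2
  · rintro ⟨φ, hφ0, hφ⟩
    obtain ⟨h, hh, hF⟩ := exists_eq_flip hs φ.toEquiv hφ hφ0
    refine ⟨⟨h, hh⟩, Subtype.ext (RelIso.ext fun x => ?_)⟩
    exact (congrArg (fun e => e x) hF).symm

end PraegerXu

namespace CPM
variable {m M s : ℕ} {r : (ZMod 4)ˣ}

/-! ### The case `n = 4` -/

lemma unit_zmod_four : ∀ u : (ZMod 4)ˣ, (u : ZMod 4) = 1 ∨ (u : ZMod 4) = -1 := by decide

lemma arc_of_four {x y : Vertex m s 4} (h1 : y.1 = x.1 + 1)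
    (h2 : ∀ l, l ≠ label x.1 → y.2 l = x.2 l)
    (h3 : y.2 (label x.1) = x.2 (label x.1) + 1 ∨ y.2 (label x.1) = x.2 (label x.1) - 1) :
    Arc r x y := by
  rw [arc_iff]
  refine ⟨h1, ?_⟩
  have h4 : ∀ c : ZMod 4, y.2 (label x.1) = x.2 (label x.1) + c * (wt r x.1 : ZMod 4) →
      y.2 = x.2 + c • shift r x.1 := by
    intro c hc
    funext l
    by_cases hl : l = label x.1
    · subst hl
      rw [hc, Pi.add_apply, Pi.smul_apply, shift_apply_self, smul_eq_mul]
    · rw [h2 l hl, Pi.add_apply, Pi.smul_apply, shift_apply_of_ne hl, smul_zero, add_zero]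
  have h5 : y.2 = x.2 + (1 : ZMod 4) • shift r x.1 ∨ y.2 = x.2 + (-1 : ZMod 4) • shift r x.1 := by
    rcases unit_zmod_four (wt r x.1) with hw | hw <;> rcases h3 with h3 | h3
    · exact Or.inl (h4 1 (by rw [h3, hw]; ring))
    · exact Or.inr (h4 (-1) (by rw [h3, hw]; ring))
    · exact Or.inr (h4 (-1) (by rw [h3, hw]; ring))
    · exact Or.inl (h4 1 (by rw [h3, hw]; ring))
  simpa [sub_eq_add_neg] using h5

/-- The parity of the number of edges at levels `0, …, a - 1` that change the component `l`. -/
def par (a : ℕ) (l : ZMod s) : ℕ := (a + (s - 1 - l.val)) / s % 2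

lemma par_succ_of_ne [NeZero s] {a : ℕ} {l : ZMod s} (h : a % s ≠ l.val) :
    par (a + 1) l = par a l := by
  have hl := ZMod.val_lt l
  rw [par, par, show a + 1 + (s - 1 - l.val) = a + (s - 1 - l.val) + 1 by omega, Nat.succ_div,
    if_neg, add_zero]
  intro hd
  apply h
  have h1 : (a + (s - 1 - l.val) + 1) % s = 0 := Nat.mod_eq_zero_of_dvd hd
  have h2 : a ≡ l.val [MOD s] := by
    have h3 : a + (s - 1 - l.val) + 1 ≡ 0 [MOD s] := (Nat.modEq_zero_iff_dvd).2 hd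
    have h4 := h3.add_right l.val
    rw [show a + (s - 1 - l.val) + 1 + l.val = a + s by omega, zero_add] at h4
    simpa [Nat.ModEq] using h4
  rw [Nat.ModEq, Nat.mod_eq_of_lt hl] at h2
  exact h2

lemma par_succ_of_eq [NeZero s] {a : ℕ} {l : ZMod s} (h : a % s = l.val) :
    par a l = 0 ∧ par (a + 1) l = 1 ∨ par a l = 1 ∧ par (a + 1) l = 0 := by
  have hl := ZMod.val_lt l
  have h1 : par (a + 1) l = ((a + (s - 1 - l.val)) / s + 1) % 2 := by
    rw [par, show a + 1 + (s - 1 - l.val) = a + (s - 1 - l.val) + 1 by omega, Nat.succ_div, if_pos]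
    refine ⟨a / s + 1, ?_⟩
    have := Nat.div_add_mod a s
    rw [mul_add, mul_one]
    omega
  rw [h1, par]
  omega

lemma par_zero [NeZero s] (l : ZMod s) : par 0 l = 0 := by
  have hl := ZMod.val_lt l
  rw [par, Nat.div_eq_of_lt (by omega)]

lemma par_add_mul [NeZero s] (a : ℕ) (l : ZMod s) (k : ℕ) :
    par (a + k * s) l = (par a l + k) % 2 := by
  have hs : 0 < s := Nat.pos_of_ne_zero (NeZero.ne s)
  rw [par, par, show a + k * s + (s - 1 - l.val) = a + (s - 1 - l.val) + k * s by omega,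
    Nat.add_mul_div_right _ _ hs]
  omega

/-- The embedding of `ℤ_2` into `ℤ_4` as `{0, 2}`. -/
def twice (b : ZMod 2) : ZMod 4 := if b = 0 then 0 else 2

/-- The map from `PX(Ms, s)` to `CPM̄(m,s,4;r)`: the `k`-th bit says which of the two possible
values, given the parity, the component that is going to change at level `i + k` has. -/
def psi (hmM : m ∣ M) (hs : 0 < s) (x : ZMod (M * s) × (Fin s → ZMod 2)) : Vertex m s 4 :=
  (ZMod.castHom (Nat.mul_dvd_mul_right hmM s) (ZMod (m * s)) x.1,
    fun l => (par x.1.val l : ZMod 4) +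
      twice (x.2 ⟨(l - label x.1).val, haveI : NeZero s := ⟨hs.ne'⟩; ZMod.val_lt _⟩))

variable {hmM : m ∣ M} {hs : 0 < s}

lemma label_psi_fst (x : ZMod (M * s) × (Fin s → ZMod 2)) :
    label (psi hmM hs x).1 = label x.1 := by
  simp only [label, psi]
  rw [← RingHom.comp_apply]
  congr 1
  exact Subsingleton.elim _ _

lemma par_val_add_one [NeZero s] (hM : Even M) (hMs : 2 ≤ M * s) (i : ZMod (M * s)) (l : ZMod s) :
    par (i + 1).val l = par (i.val + 1) l := by
  have : NeZero (M * s) := ⟨by omega⟩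
  have : Fact (1 < M * s) := ⟨by omega⟩
  have hlt := ZMod.val_lt i
  rw [ZMod.val_add, ZMod.val_one]
  by_cases h1 : i.val + 1 < M * s
  · rw [Nat.mod_eq_of_lt h1]
  · have h2 : i.val + 1 = 0 + M * s := by omega
    rw [h2, par_add_mul, zero_add, Nat.mod_self, par_zero]
    obtain ⟨k, rfl⟩ := hM
    omega

lemma psi_arc (hM : Even M) (hMs : 2 ≤ M * s) {x y : ZMod (M * s) × (Fin s → ZMod 2)}
    (hxy : PraegerXu.PArc x y) : Arc r (psi hmM hs x) (psi hmM hs y) := by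
  have : NeZero s := ⟨hs.ne'⟩
  have : NeZero (M * s) := ⟨by omega⟩
  refine arc_of_four (by simp only [psi, hxy.1, map_add, map_one]) (fun l hl => ?_) ?_
  · rw [label_psi_fst] at hl
    simp only [psi]
    have h0 : l - label x.1 ≠ 0 := sub_ne_zero.2 hl
    have h1 : x.1.val % s ≠ l.val := by
      rw [← val_label]
      exact fun h0 => hl (ZMod.val_injective s h0.symm)
    have h2 : (l - label x.1).val = (l - label y.1).val + 1 := by
      have h3 : l - label x.1 = (l - label y.1) + 1 := by
        rw [hxy.1, label_add_one]; ring
      have h5 := ZMod.val_lt (l - label y.1)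
      have h4 : (((l - label y.1).val + 1 : ℕ) : ZMod s) = l - label x.1 := by
        push_cast
        rw [ZMod.natCast_zmod_val, h3]
      rw [← h4, ZMod.val_natCast, Nat.mod_eq_of_lt]
      by_contra h6
      have h7 : (l - label y.1).val + 1 = s := by omega
      rw [h7, ZMod.natCast_self] at h4
      exact h0 h4.symm
    have h8 := hxy.2 (l - label y.1).val (by rw [← h2]; exact ZMod.val_lt _)
    have h9 : par y.1.val l = par x.1.val l := by
      rw [hxy.1, par_val_add_one hM hMs, par_succ_of_ne h1]
    rw [h8, h9]
    congr 2
    exact congrArg x.2 (Fin.ext h2.symm)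
  · rw [label_psi_fst]
    simp only [psi]
    have h1 : x.1.val % s = (label x.1).val := (val_label _).symm
    generalize y.2 _ = b
    generalize x.2 _ = a
    rw [hxy.1, par_val_add_one hM hMs]
    rcases par_succ_of_eq h1 with ⟨h2, h3⟩ | ⟨h2, h3⟩ <;> rw [h2, h3] <;> revert a b <;> decide

/-- The level of `psi x` determines the level of `x` modulo `m s`. If `m` is odd and `M = 2m`, the
parities of the components tell apart the two levels that remain. -/
lemma psi_injective (hM : M = if Even m then m else 2 * m) (hm : 1 ≤ m) :
    Function.Injective (psi hmM hs) := by
  have : NeZero s := ⟨hs.ne'⟩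
  have hms : 0 < m * s := Nat.mul_pos hm hs
  have hM1 : 0 < M := by rw [hM]; split_ifs <;> omega
  have : NeZero (M * s) := ⟨(Nat.mul_pos hM1 hs).ne'⟩
  have : NeZero (m * s) := ⟨hms.ne'⟩
  have hpar : ∀ (a a' : ℕ) (l : ZMod s) (b b' : ZMod 2),
      (par a l : ZMod 4) + twice b = (par a' l : ZMod 4) + twice b' →
      par a l = par a' l ∧ b = b' := by
    intro a a' l b b'
    have h1 : par a l < 2 := Nat.mod_lt _ (by norm_num)
    have h2 : par a' l < 2 := Nat.mod_lt _ (by norm_num)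
    generalize par a l = u at h1 ⊢
    generalize par a' l = v at h2 ⊢
    interval_cases u <;> interval_cases v <;> revert b b' <;> decide
  intro x y hxy
  have h1 : ((x.1.val : ℕ) : ZMod (m * s)) = (y.1.val : ℕ) := by
    have := congrArg Prod.fst hxy
    simp only [psi] at this
    rwa [← ZMod.natCast_zmod_val x.1, ← ZMod.natCast_zmod_val y.1, map_natCast, map_natCast] at this
  have h2 : ∀ l, par x.1.val l = par y.1.val l := fun l =>
    (hpar _ _ _ _ _ (congrFun (congrArg Prod.snd hxy) l)).1
  have h3 : x.1 = y.1 := by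
    apply ZMod.val_injective
    have hx := ZMod.val_lt x.1
    have hy := ZMod.val_lt y.1
    rw [ZMod.natCast_eq_natCast_iff] at h1
    by_cases hev : Even m
    · rw [if_pos hev] at hM
      subst hM
      rwa [Nat.ModEq, Nat.mod_eq_of_lt hx, Nat.mod_eq_of_lt hy] at h1
    · rw [if_neg hev] at hM
      subst hM
      -- passing once through all levels changes the parity of every component
      have key : ∀ a b : ℕ, a ≡ b [MOD m * s] → b ≤ a → a < 2 * m * s →
          (∀ l : ZMod s, par a l = par b l) → a = b := by
        intro a b hab hle hlt hp
        obtain ⟨c, hc⟩ := (Nat.modEq_iff_dvd' hle).1 hab.symm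
        have hc' : a = b + c * m * s := by
          have : a = b + (a - b) := by omega
          rw [this, hc]; ring
        have hc2 : c < 2 := by
          by_contra h0
          have : 2 * (m * s) ≤ c * (m * s) := Nat.mul_le_mul_right _ (by omega)
          have h5 : c * m * s = c * (m * s) := by ring
          have h6 : 2 * m * s = 2 * (m * s) := by ring
          omega
        interval_cases c
        · simpa using hc'
        · exfalso
          have h5 := hp 0
          rw [hc', one_mul, par_add_mul] at h5
          have h6 : par b (0 : ZMod s) < 2 := Nat.mod_lt _ (by norm_num)
          rw [Nat.not_even_iff_odd, Nat.odd_iff] at hev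
          omega
      rcases le_total y.1.val x.1.val with hle | hle
      · exact key _ _ h1 hle hx h2
      · exact (key _ _ h1.symm hle hy fun l => (h2 l).symm).symm
  refine Prod.ext h3 (funext fun k => ?_)
  have h4 := (hpar _ _ _ _ _ (congrFun (congrArg Prod.snd hxy) (label x.1 + (k.val : ZMod s)))).2
  have h5 : (label x.1 + (k.val : ZMod s) - label x.1).val = k.val := by
    rw [add_sub_cancel_left, ZMod.val_natCast_of_lt k.2]
  have h6 : (label x.1 + (k.val : ZMod s) - label y.1).val = k.val := by
    rw [← h3, add_sub_cancel_left, ZMod.val_natCast_of_lt k.2]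
  convert h4 using 2
  · exact Fin.ext h5.symm
  · exact Fin.ext h6.symm

lemma psi_zero : psi hmM hs (0, 0) = (0, 0) := by
  have : NeZero s := ⟨hs.ne'⟩
  refine Prod.ext (by simp [psi]) (funext fun l => ?_)
  simp [psi, par_zero, twice]

/-- For `n = 4` the graph `CPM(m,s,4;r)` is a Praeger–Xu graph, and the isomorphism respects the
orientations. -/
lemma exists_iso_praegerXu (h : Admissible m s 4 r) (hM : M = if Even m then m else 2 * m) :
    ∃ Θ : praegerXu (M * s) s ≃g graph m s 4 r, Θ (0, 0) = origin m s 4 r ∧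
      ∀ x y, VArc (Θ x) (Θ y) ↔ PraegerXu.PArc x y := by
  have hm := h.one_le_m
  have hs2 := h.two_le_s
  have hs : 0 < s := by omega
  have hMev : Even M := by
    rw [hM]; split_ifs with h0
    · exact h0
    · exact even_two_mul m
  have hmM : m ∣ M := by
    rw [hM]; split_ifs
    · exact dvd_rfl
    · exact dvd_mul_left _ _
  have hM2 : 2 ≤ M := by
    rw [hM]; split_ifs with h0
    · obtain ⟨k, rfl⟩ := h0; omega
    · omega
  have hMs : 4 ≤ M * s := Nat.mul_le_mul hM2 hs2
  have : NeZero (M * s) := ⟨by omega⟩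
  let f := psi hmM hs
  have hinj : Function.Injective f := psi_injective hM hm
  have harc : ∀ x y, PraegerXu.PArc x y → Arc r (f x) (f y) := fun x y =>
    psi_arc hMev (by omega)
  -- the two out-neighbours correspond
  have hout : ∀ x (e : ℤˣ), ∃ y, PraegerXu.PArc x y ∧ f y = step r e (f x) := by
    intro x e
    obtain ⟨a, ha⟩ := harc _ _ (PraegerXu.pArc_succ 0 x)
    obtain ⟨b, hb⟩ := harc _ _ (PraegerXu.pArc_succ 1 x)
    have hab : a ≠ b := by
      rintro rfl
      have h1 := hinj (ha.trans hb.symm)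
      have h2 := congrFun (congrArg Prod.snd h1) ⟨s - 1, by omega⟩
      simp only [PraegerXu.succ] at h2
      rw [dif_neg (by omega), dif_neg (by omega)] at h2
      exact absurd h2 (by decide)
    rcases units_three a b e with h0 | rfl | rfl
    · exact absurd h0 hab
    · exact ⟨_, PraegerXu.pArc_succ 0 x, ha⟩
    · exact ⟨_, PraegerXu.pArc_succ 1 x, hb⟩
  have hiff : ∀ x y, Arc r (f x) (f y) ↔ PraegerXu.PArc x y := by
    refine fun x y => ⟨?_, harc x y⟩
    rintro ⟨e, he⟩
    obtain ⟨z, hz, hze⟩ := hout x e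
    rw [← hze] at he
    rwa [hinj he]
  have hmem : ∀ x, f x ∈ verts m s 4 r := by
    refine PraegerXu.induction ?_ fun x y hxy => h.mem_verts_iff_of_arc (harc x y hxy)
    simp only [f, psi_zero]
    exact zero_mem_verts
  have hsurj : ∀ y ∈ verts m s 4 r, ∃ x, f x = y := by
    intro y hy
    refine h.verts_induction_forward (p := fun y => ∃ x, f x = y) zero_mem_verts
      ⟨_, psi_zero⟩ ?_ hy
    rintro _ _ ⟨x, rfl⟩ ⟨e, rfl⟩
    obtain ⟨z, -, hz⟩ := hout x e
    exact ⟨z, hz⟩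
  let F : ZMod (M * s) × (Fin s → ZMod 2) → verts m s 4 r := fun x => ⟨f x, hmem x⟩
  have hF : Function.Bijective F :=
    ⟨fun x y hxy => hinj (congrArg Subtype.val hxy), fun y => by
      obtain ⟨x, hx⟩ := hsurj y y.2
      exact ⟨x, Subtype.ext hx⟩⟩
  refine ⟨⟨Equiv.ofBijective F hF, ?_⟩, Subtype.ext (psi_zero (hmM := hmM) (hs := hs)), hiff⟩
  intro x y
  rw [PraegerXu.praegerXu_adj (by omega), h.graph_adj]
  exact or_congr (hiff x y) (hiff y x)

lemma card_preserving_four (h : Admissible m s 4 r) (hM : M = if Even m then m else 2 * m) :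
    Nat.card {φ : graph m s 4 r ≃g graph m s 4 r //
      φ (origin m s 4 r) = origin m s 4 r ∧ Preserves φ} = 2 ^ (s * (M - 1)) := by
  obtain ⟨Θ, hΘ0, hΘ⟩ := exists_iso_praegerXu h hM
  have hm := h.one_le_m
  have hs2 := h.two_le_s
  have hM2 : 2 ≤ M := by
    rw [hM]; split_ifs with h0
    · obtain ⟨k, rfl⟩ := h0; omega
    · omega
  have hMs : 2 * s ≤ M * s := Nat.mul_le_mul_right s hM2
  have hexp : s * (M - 1) = M * s - s := by
    rw [Nat.mul_sub, mul_one, mul_comm]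
  rw [hexp, ← PraegerXu.card_preserving (t := M * s) (s := s) (by omega) (by omega) (by omega)]
  have hs1 : ∀ x, Θ.symm (Θ x) = x := Θ.symm_apply_apply
  have hs2 : ∀ x, Θ (Θ.symm x) = x := Θ.apply_symm_apply
  refine Nat.card_congr
    { toFun := fun φ => ⟨(Θ.trans φ.1).trans Θ.symm, ?_, ?_⟩
      invFun := fun φ => ⟨(Θ.symm.trans φ.1).trans Θ, ?_, ?_⟩
      left_inv := ?_
      right_inv := ?_ }
  · change Θ.symm (φ.1 (Θ (0, 0))) = (0, 0)
    rw [hΘ0, φ.2.1, ← hΘ0, hs1]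
  · intro x y hxy
    rw [← hΘ]
    change VArc (Θ (Θ.symm (φ.1 (Θ x)))) (Θ (Θ.symm (φ.1 (Θ y))))
    rw [hs2, hs2]
    exact φ.2.2 _ _ ((hΘ x y).2 hxy)
  · change Θ (φ.1 (Θ.symm (origin m s 4 r))) = _
    rw [← hΘ0, hs1, φ.2.1]
  · intro x y hxy
    refine (hΘ _ _).2 (φ.2.2 _ _ ?_)
    rw [← hΘ]
    change VArc (Θ (Θ.symm x)) (Θ (Θ.symm y))
    rwa [hs2, hs2]
  · intro φ
    refine Subtype.ext (RelIso.ext fun x => ?_)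
    change Θ (Θ.symm (φ.1 (Θ (Θ.symm x)))) = φ.1 x
    rw [hs2, hs2]
  · intro φ
    refine Subtype.ext (RelIso.ext fun x => ?_)
    change Θ.symm (Θ (φ.1 (Θ.symm (Θ x)))) = φ.1 x
    rw [hs1, hs1]

end CPM

namespace CPM
variable {m s n : ℕ} {r : (ZMod n)ˣ}

/-! ### Closed walks of length eight -/

/-- The `3`-arc `(x₀, x₁, x₂, x₃)` is contained in a closed non-backtracking walk of length `8`. -/
def Good {V : Type*} (Γ : SimpleGraph V) (x₀ x₁ x₂ x₃ : V) : Prop :=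
  ∃ x₄ x₅ x₆ x₇ : V, (Γ.Adj x₃ x₄ ∧ Γ.Adj x₄ x₅ ∧ Γ.Adj x₅ x₆ ∧ Γ.Adj x₆ x₇ ∧ Γ.Adj x₇ x₀) ∧
    x₄ ≠ x₂ ∧ x₅ ≠ x₃ ∧ x₆ ≠ x₄ ∧ x₇ ≠ x₅ ∧ x₀ ≠ x₆ ∧ x₁ ≠ x₇

lemma Good.map {V : Type*} {Γ : SimpleGraph V} {x₀ x₁ x₂ x₃ : V} (hg : Good Γ x₀ x₁ x₂ x₃)
    (φ : Γ ≃g Γ) : Good Γ (φ x₀) (φ x₁) (φ x₂) (φ x₃) := by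
  obtain ⟨x₄, x₅, x₆, x₇, ⟨a3, a4, a5, a6, a7⟩, b4, b5, b6, b7, b0, b1⟩ := hg
  exact ⟨φ x₄, φ x₅, φ x₆, φ x₇, ⟨φ.map_rel_iff.2 a3, φ.map_rel_iff.2 a4, φ.map_rel_iff.2 a5,
    φ.map_rel_iff.2 a6, φ.map_rel_iff.2 a7⟩, φ.injective.ne b4, φ.injective.ne b5,
    φ.injective.ne b6, φ.injective.ne b7, φ.injective.ne b0, φ.injective.ne b1⟩

/-- The change of the vector component along an edge that starts at level `i + k`, goes up if
`d = 1` and down if `d = -1`, and has the sign `e`. -/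
def edgeVec (r : (ZMod n)ˣ) (i : ZMod (m * s)) (k : ℤ) (d e : ℤˣ) : ZMod s → ZMod n :=
  if d = 1 then sg n e • shift r (i + ((k : ℤ) : ZMod (m * s)))
  else -(sg n e • shift r (i + ((k - 1 : ℤ) : ZMod (m * s))))

/-- `y` is the neighbour of `x` in the direction `d` with the sign `e`. -/
def Admissible.IsEdge (h : Admissible m s n r) (d e : ℤˣ) (x y : verts m s n r) : Prop :=
  (d = 1 ∧ y = h.up e x) ∨ (d = -1 ∧ y = h.down e x)

lemma Admissible.exists_isEdge (h : Admissible m s n r) {x y : verts m s n r}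
    (hxy : (graph m s n r).Adj x y) : ∃ d e : ℤˣ, h.IsEdge d e x y := by
  rcases h.adj_iff.1 hxy with ⟨e, he⟩ | ⟨e, he⟩
  · exact ⟨1, e, Or.inl ⟨rfl, he⟩⟩
  · exact ⟨-1, e, Or.inr ⟨rfl, he⟩⟩

lemma Admissible.IsEdge.fst {h : Admissible m s n r} {d e : ℤˣ} {x y : verts m s n r}
    (hxy : h.IsEdge d e x y) {i : ZMod (m * s)} {k : ℤ} (hx : x.1.1 = i + (k : ZMod (m * s))) :
    y.1.1 = i + ((k + (d : ℤ) : ℤ) : ZMod (m * s)) := by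
  rcases hxy with ⟨rfl, rfl⟩ | ⟨rfl, rfl⟩
  · simp [Admissible.up, hx, add_assoc]
  · simp [Admissible.down, hx, add_assoc, sub_eq_add_neg]

lemma Admissible.IsEdge.snd {h : Admissible m s n r} {d e : ℤˣ} {x y : verts m s n r}
    (hxy : h.IsEdge d e x y) {i : ZMod (m * s)} {k : ℤ} (hx : x.1.1 = i + (k : ZMod (m * s))) :
    y.1.2 = x.1.2 + edgeVec r i k d e := by
  rcases hxy with ⟨rfl, rfl⟩ | ⟨rfl, rfl⟩
  · simp [Admissible.up, hx, edgeVec]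
  · have h1 : ((-1 : ℤˣ) = 1) ↔ False := by decide
    have h2 : x.1.1 - 1 = i + ((k - 1 : ℤ) : ZMod (m * s)) := by rw [hx]; push_cast; ring
    simp only [Admissible.down, back_snd, h2, edgeVec, h1, if_false, sub_eq_add_neg]

lemma Admissible.IsEdge.sign_eq_neg {h : Admissible m s n r} {d d' e e' : ℤˣ}
    {x y z : verts m s n r} (hxy : h.IsEdge d e x y) (hyz : h.IsEdge d' e' y z) (hzx : z ≠ x)
    (hd : d' = -d) : e' = -e := by
  rw [← units_ne_iff]
  rintro rfl
  apply hzx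
  rcases hxy with ⟨rfl, rfl⟩ | ⟨rfl, rfl⟩ <;> rcases hyz with ⟨h1, rfl⟩ | ⟨h1, rfl⟩
  · exact absurd (h1.symm.trans hd) (by decide)
  · exact Subtype.ext (by simp [Admissible.up, Admissible.down])
  · exact Subtype.ext (by simp [Admissible.up, Admissible.down])
  · exact absurd (h1.symm.trans hd) (by decide)

/-- The possible values of the number `z` of ascending minus descending edges of a closed walk of
length `8` that has at least three ascending edges, where `N` is the number of levels. -/
lemma multiple_cases {N : ℕ} (hN : 6 ≤ N) {z : ℤ} (hz : (N : ℤ) ∣ z) (hz1 : -2 ≤ z) (hz2 : z ≤ 8)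
    (hz3 : z % 2 = 0) : z = 0 ∨ (z = 6 ∧ N = 6) ∨ (z = 8 ∧ N = 8) := by
  obtain ⟨q, rfl⟩ := hz
  have hq1 : q < 2 := by
    by_contra h0
    have : (N : ℤ) * 2 ≤ N * q := by gcongr; omega
    omega
  have hq2 : -1 < q := by
    by_contra h0
    have : (N : ℤ) * q ≤ N * (-1) := by gcongr; omega
    omega
  interval_cases q <;> omega

/-- The relations between the vectors `B k`, which belong to the edges above the `k`-th level from
the level of `x`, that result from the closed non-backtracking walks of length `8` beginning with
three ascending edges of signs `e₀`, `e₁`, `e₂`. In the first five alternatives the walk has as many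
descending as ascending edges: one ascending edge is left, and the alternatives correspond to its
position among the four descending ones. In the last two the walk winds once around the levels,
with one descending edge or without any. Where the direction changes, the two edges in question have
opposite signs, because the walk does not backtrack. -/
lemma Admissible.good_cases (h : Admissible m s n r) (hN : 6 ≤ m * s) {x : verts m s n r}
    {e₀ e₁ e₂ : ℤˣ}
    (hg : Good (graph m s n r) x (h.up e₀ x) (h.up e₁ (h.up e₀ x)) (h.up e₂ (h.up e₁ (h.up e₀ x))))
    {B : ℤ → ZMod s → ZMod n} (hB : ∀ k, B k = shift r (x.1.1 + (k : ZMod (m * s)))) :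
    (∃ e₃ f₁ f₂ : ℤˣ, (2 * sg n e₀) • B 0 + (sg n e₁ - sg n f₁) • B 1 + (sg n e₂ - sg n f₂) • B 2 +
      (2 * sg n e₃) • B 3 = 0) ∨
    (∃ g f₀ f₁ : ℤˣ, (sg n e₀ - sg n f₀) • B 0 + (sg n e₁ - sg n f₁) • B 1 + (2 * sg n e₂) • B 2 -
      (2 * sg n g) • B (-1) = 0) ∨
    (∃ f₁ : ℤˣ, (2 * sg n e₀) • B 0 + (sg n e₁ - sg n f₁) • B 1 + (4 * sg n e₂) • B 2 = 0) ∨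
    (∃ f₁ : ℤˣ, (2 * sg n e₀) • B 0 + (sg n e₁ - 3 * sg n f₁) • B 1 + (2 * sg n e₂) • B 2 = 0) ∨
    (∃ f₁ : ℤˣ, (4 * sg n e₀) • B 0 + (sg n e₁ - sg n f₁) • B 1 + (2 * sg n e₂) • B 2 = 0) ∨
    (m * s = 6 ∧ ∃ (c : Fin 6 → ℤˣ) (p : Fin 6),
      ∑ k : Fin 6, ((if k = p then 3 else 1) * sg n (c k)) • B (k : ℕ) = 0) ∨
    (m * s = 8 ∧ ∃ e₃ e₄ e₅ e₆ e₇ : ℤˣ, sg n e₀ • B 0 + sg n e₁ • B 1 + sg n e₂ • B 2 +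
      sg n e₃ • B 3 + sg n e₄ • B 4 + sg n e₅ • B 5 + sg n e₆ • B 6 + sg n e₇ • B 7 = 0) := by
  obtain ⟨x₄, x₅, x₆, x₇, ⟨a3, a4, a5, a6, a7⟩, b4, b5, b6, b7, b0, b1⟩ := hg
  set x₁ := h.up e₀ x with hx₁
  set x₂ := h.up e₁ x₁ with hx₂
  set x₃ := h.up e₂ x₂ with hx₃
  have E0 : h.IsEdge 1 e₀ x x₁ := Or.inl ⟨rfl, rfl⟩
  have E1 : h.IsEdge 1 e₁ x₁ x₂ := Or.inl ⟨rfl, rfl⟩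
  have E2 : h.IsEdge 1 e₂ x₂ x₃ := Or.inl ⟨rfl, rfl⟩
  obtain ⟨d₃, e₃, E3⟩ := h.exists_isEdge a3
  obtain ⟨d₄, e₄, E4⟩ := h.exists_isEdge a4
  obtain ⟨d₅, e₅, E5⟩ := h.exists_isEdge a5
  obtain ⟨d₆, e₆, E6⟩ := h.exists_isEdge a6
  obtain ⟨d₇, e₇, E7⟩ := h.exists_isEdge a7
  have n3 := E2.sign_eq_neg E3 b4
  have n4 := E3.sign_eq_neg E4 b5
  have n5 := E4.sign_eq_neg E5 b6
  have n6 := E5.sign_eq_neg E6 b7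
  have n7 := E6.sign_eq_neg E7 b0
  have n0 := E7.sign_eq_neg E0 b1
  have l0 : x.1.1 = x.1.1 + ((0 : ℤ) : ZMod (m * s)) := by simp
  have l1 := E0.fst l0
  have l2 := E1.fst l1
  have l3 := E2.fst l2
  have l4 := E3.fst l3
  have l5 := E4.fst l4
  have l6 := E5.fst l5
  have l7 := E6.fst l6
  have l8 := E7.fst l7
  have hv := E7.snd l7
  rw [E6.snd l6, E5.snd l5, E4.snd l4, E3.snd l3, E2.snd l2, E1.snd l1, E0.snd l0] at hv
  simp only [add_assoc] at hv
  replace hv := left_eq_add.1 hv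
  -- the edges lead back to the level and to the vector of `x`
  have hz : ((m * s : ℕ) : ℤ) ∣ 3 + (d₃ : ℤ) + (d₄ : ℤ) + (d₅ : ℤ) + (d₆ : ℤ) + (d₇ : ℤ) := by
    rw [← ZMod.intCast_zmod_eq_zero_iff_dvd]
    have := left_eq_add.1 l8
    rw [← this]
    push_cast
    ring
  clear l1 l2 l3 l4 l5 l6 l7 l8 E0 E1 E2 E3 E4 E5 E6 E7 a3 a4 a5 a6 a7 b0 b1 b4 b5 b6 b7
  have hBN : ∀ k, B (k + (m * s : ℕ)) = B k := by
    intro k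
    rw [hB, hB]
    congr 2
    push_cast
    rw [← Nat.cast_mul, ZMod.natCast_self, add_zero]
  have h1 : ((-1 : ℤˣ) = 1) ↔ False := by decide
  have h2 : ((1 : ℤˣ) = -1) ↔ False := by decide
  have hz' := multiple_cases hN hz
  simp only [edgeVec, ← hB] at hv
  rcases Int.units_eq_one_or d₃ with rfl | rfl <;> rcases Int.units_eq_one_or d₄ with rfl | rfl <;>
    rcases Int.units_eq_one_or d₅ with rfl | rfl <;>
    rcases Int.units_eq_one_or d₆ with rfl | rfl <;>
    rcases Int.units_eq_one_or d₇ with rfl | rfl <;>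
    simp only [h1, h2, if_true, if_false, Units.val_one, Units.val_neg, neg_neg, forall_const,
      false_imp_iff] at hv n3 n4 n5 n6 n7 n0 hz' <;>
    norm_num at hz' <;> norm_num at hv
  · exact Or.inr (Or.inr (Or.inr (Or.inr (Or.inr (Or.inr ⟨hz', e₃, e₄, e₅, e₆, e₇, by
      linear_combination hv⟩)))))
  · have h6 := hBN 0
    simp only [hz', Nat.cast_ofNat, zero_add] at h6
    refine Or.inr (Or.inr (Or.inr (Or.inr (Or.inr (Or.inl
      ⟨hz', ![e₀, e₁, e₂, e₃, e₄, e₅], 0, ?_⟩)))))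
    have n7' : e₇ = -e₀ := by rw [n0, neg_neg]
    have n6' : e₆ = e₀ := by rw [n0, n7, neg_neg]
    rw [n7', n6', h6] at hv
    simp only [Fin.sum_univ_six, Fin.reduceEq, if_true, if_false, Fin.isValue,
      Fin.coe_ofNat_eq_mod, Nat.reduceMod, Nat.cast_ofNat, Nat.cast_zero, Nat.cast_one,
      Nat.zero_mod, Nat.one_mod, one_mul, Matrix.cons_val]
    simp only [sg_neg] at hv
    linear_combination (norm := module) hv
  · refine Or.inr (Or.inr (Or.inr (Or.inr (Or.inr (Or.inl
      ⟨hz', ![e₀, e₁, e₂, e₃, e₄, e₅], 5, ?_⟩)))))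
    rw [n7, n6] at hv
    simp only [Fin.sum_univ_six, Fin.reduceEq, if_true, if_false, Fin.isValue,
      Fin.coe_ofNat_eq_mod, Nat.reduceMod, Nat.cast_ofNat, Nat.cast_zero, Nat.cast_one,
      Nat.zero_mod, Nat.one_mod, one_mul, Matrix.cons_val]
    simp only [sg_neg] at hv
    linear_combination (norm := module) hv
  · refine Or.inr (Or.inr (Or.inr (Or.inr (Or.inr (Or.inl
      ⟨hz', ![e₀, e₁, e₂, e₃, e₄, e₇], 4, ?_⟩)))))
    rw [n6, n5] at hv
    simp only [Fin.sum_univ_six, Fin.reduceEq, if_true, if_false, Fin.isValue,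
      Fin.coe_ofNat_eq_mod, Nat.reduceMod, Nat.cast_ofNat, Nat.cast_zero, Nat.cast_one,
      Nat.zero_mod, Nat.one_mod, one_mul, Matrix.cons_val]
    simp only [sg_neg] at hv
    linear_combination (norm := module) hv
  · refine Or.inr (Or.inr (Or.inr (Or.inr (Or.inr (Or.inl
      ⟨hz', ![e₀, e₁, e₂, e₃, e₆, e₇], 3, ?_⟩)))))
    rw [n5, n4] at hv
    simp only [Fin.sum_univ_six, Fin.reduceEq, if_true, if_false, Fin.isValue,
      Fin.coe_ofNat_eq_mod, Nat.reduceMod, Nat.cast_ofNat, Nat.cast_zero, Nat.cast_one,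
      Nat.zero_mod, Nat.one_mod, one_mul, Matrix.cons_val]
    simp only [sg_neg] at hv
    linear_combination (norm := module) hv
  · have n7' : e₇ = -e₀ := by rw [n0, neg_neg]
    refine Or.inl ⟨e₃, e₆, e₅, ?_⟩
    rw [n4, n7'] at hv
    simp only [sg_neg] at hv
    linear_combination (norm := module) hv
  · refine Or.inr (Or.inr (Or.inr (Or.inr (Or.inr (Or.inl
      ⟨hz', ![e₀, e₁, e₂, e₅, e₆, e₇], 2, ?_⟩)))))
    rw [n4, n3] at hv
    simp only [Fin.sum_univ_six, Fin.reduceEq, if_true, if_false, Fin.isValue,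
      Fin.coe_ofNat_eq_mod, Nat.reduceMod, Nat.cast_ofNat, Nat.cast_zero, Nat.cast_one,
      Nat.zero_mod, Nat.one_mod, one_mul, Matrix.cons_val]
    simp only [sg_neg] at hv
    linear_combination (norm := module) hv
  · have n7' : e₇ = -e₀ := by rw [n0, neg_neg]
    refine Or.inr (Or.inr (Or.inl ⟨e₆, ?_⟩))
    rw [n7', n5, n4, n3] at hv
    simp only [sg_neg] at hv
    linear_combination (norm := module) hv
  · have n7' : e₇ = -e₀ := by rw [n0, neg_neg]
    refine Or.inr (Or.inr (Or.inr (Or.inl ⟨e₄, ?_⟩)))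
    rw [n7', n6, n5, n3] at hv
    simp only [sg_neg] at hv
    linear_combination (norm := module) hv
  · have n7' : e₇ = -e₀ := by rw [n0, neg_neg]
    have n6' : e₆ = e₀ := by rw [← neg_inj, ← n7, n7']
    have n5' : e₅ = -e₀ := by rw [← n6', n6, neg_neg]
    refine Or.inr (Or.inr (Or.inr (Or.inr (Or.inl ⟨e₄, ?_⟩))))
    rw [n7', n6', n5', n3] at hv
    simp only [sg_neg] at hv
    linear_combination (norm := module) hv
  · refine Or.inr (Or.inl ⟨e₆, e₅, e₄, ?_⟩)
    rw [n7, n3] at hv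
    simp only [sg_neg] at hv
    linear_combination (norm := module) hv

end CPM

namespace CPM
variable {m s n : ℕ} {r : (ZMod n)ˣ}

/-! ### Straight arcs in closed walks of length eight -/

lemma shift_apply_label_add (i : ZMod (m * s)) (k j : ℤ) :
    shift r (i + (k : ZMod (m * s))) (label i + (j : ZMod s)) =
      if (s : ℤ) ∣ k - j then (wt r (i + (k : ZMod (m * s))) : ZMod n) else 0 := by
  have hl : label (i + (k : ZMod (m * s))) = label i + (k : ZMod s) := by simp [label]
  split_ifs with hd
  · have : ((j : ℤ) : ZMod s) = (k : ℤ) := (ZMod.intCast_eq_intCast_iff_dvd_sub _ _ _).2 hd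
    rw [this, ← hl, shift_apply_self]
  · apply shift_apply_of_ne
    rw [hl]
    intro h0
    exact hd ((ZMod.intCast_eq_intCast_iff_dvd_sub _ _ _).1 (add_left_cancel h0))

/-- Comparison of the weights of two levels that differ by `k`. -/
lemma Admissible.wt_add_int (h : Admissible m s n r) (i : ZMod (m * s)) (j : ℤ) (k : ℕ) :
    ∃ e : ℤˣ, (wt r (i + ((j + k : ℤ) : ZMod (m * s))) : ZMod n) =
      sg n e * r ^ k * wt r (i + (j : ZMod (m * s))) := by
  obtain ⟨e, he⟩ := h.wt_add (i + (j : ZMod (m * s))) k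
  refine ⟨e, ?_⟩
  rw [← he]
  push_cast
  rw [add_assoc]

/-- Two signed multiples `2w` and `2 ρ w` with a unit `w` can only cancel if `2 ρ ^ 2 = 2`. -/
lemma two_mul_sq_of_add_eq_zero {ρ : ZMod n} {e f : ℤˣ} (w : (ZMod n)ˣ)
    (h0 : 2 * sg n e * w + 2 * sg n f * (ρ * w) = 0) : 2 * (ρ ^ 2 - 1) = 0 := by
  have h1 : 2 * sg n e + 2 * sg n f * ρ = 0 := by
    rw [← Units.mul_left_eq_zero w]
    linear_combination h0
  have he := sg_sq (n := n) e
  have hf := sg_sq (n := n) f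
  linear_combination (sg n f * ρ - sg n e) * h1 - 2 * ρ ^ 2 * hf + 2 * he

lemma Admissible.two_mul_wt_ne (h : Admissible m s n r) {N : ℕ} (i : ZMod N) (e : ℤˣ) :
    2 * sg n e * (wt r i : ZMod n) ≠ 0 := by
  intro h0
  apply h.wt_two_ne i
  linear_combination sg n e * h0 - 2 * (wt r i : ZMod n) * sg_sq (n := n) e

/-- If `r ^ (2s) ≠ ±1` up to a factor `2`, then `m ≥ 3`. -/
lemma Admissible.three_le_m (h : Admissible m s n r)
    (H : 2 * ((r : ZMod n) ^ (2 * s) - 1) ≠ 0) (H' : 2 * ((r : ZMod n) ^ (2 * s) + 1) ≠ 0) :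
    3 ≤ m := by
  have h1 := h.one_le_m
  by_contra hm
  have : m = 1 ∨ m = 2 := by omega
  rcases this with rfl | rfl
  · apply H
    have := h.pow_eq
    rw [one_mul] at this
    rw [mul_comm 2 s, pow_mul]
    rcases this with h2 | h2
    · linear_combination 2 * ((r : ZMod n) ^ s - 1) * h2
    · linear_combination 2 * ((r : ZMod n) ^ s + 1) * h2
  · rcases h.pow_eq with h2 | h2
    · exact H' (by rw [h2, mul_zero])
    · exact H (by rw [h2, mul_zero])

/-- For `s ≥ 3` no straight `3`-arc is contained in a closed non-backtracking walk of length `8`: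
three consecutive levels change different components, so one of the terms of each relation of
`good_cases` stands alone, or faces only the term of the level at distance `s = 3`. -/
lemma Admissible.not_good_straight (h : Admissible m s n r) (hs : 3 ≤ s)
    (H : 2 * ((r : ZMod n) ^ (2 * s) - 1) ≠ 0) (H' : 2 * ((r : ZMod n) ^ (2 * s) + 1) ≠ 0)
    (x : verts m s n r) (e₀ e₁ e₂ : ℤˣ) :
    ¬ Good (graph m s n r) x (h.up e₀ x) (h.up e₁ (h.up e₀ x))
      (h.up e₂ (h.up e₁ (h.up e₀ x))) := by
  intro hg
  have hm := h.three_le_m H H'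
  have hN : 9 ≤ m * s := Nat.mul_le_mul hm hs
  set i := x.1.1 with hi
  have hnd : ∀ z : ℤ, z ≠ 0 → |z| < 3 → ¬ (s : ℤ) ∣ z := by
    intro z hz hz3 hd
    exact hz (Int.eq_zero_of_abs_lt_dvd hd (by omega))
  have d1 := hnd 1 (by norm_num) (by norm_num)
  have d2 := hnd 2 (by norm_num) (by norm_num)
  have d1' := hnd (-1) (by norm_num) (by norm_num)
  have d2' := hnd (-2) (by norm_num) (by norm_num)
  have hw0 : ∀ e : ℤˣ, 2 * sg n e * (wt r (i + ((0 : ℤ) : ZMod (m * s))) : ZMod n) ≠ 0 :=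
    fun e => h.two_mul_wt_ne _ e
  have hw2 : ∀ e : ℤˣ, 2 * sg n e * (wt r (i + ((2 : ℤ) : ZMod (m * s))) : ZMod n) ≠ 0 :=
    fun e => h.two_mul_wt_ne _ e
  have hthree : ∀ (j : ℤ) (e f : ℤˣ), (s : ℤ) ∣ 3 →
      2 * sg n e * (wt r (i + ((j : ℤ) : ZMod (m * s))) : ZMod n) +
        2 * sg n f * (wt r (i + ((j + 3 : ℤ) : ZMod (m * s))) : ZMod n) ≠ 0 := by
    intro j e f hd h0
    have hs3 : s = 3 := by
      have : s ∣ 3 := by exact_mod_cast hd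
      have := Nat.le_of_dvd (by norm_num) this
      omega
    obtain ⟨g, hg⟩ := h.wt_add_int i j 3
    rw [Nat.cast_ofNat] at hg
    rw [hg] at h0
    apply H
    have := two_mul_sq_of_add_eq_zero (ρ := (r : ZMod n) ^ 3) (e := e) (f := f * g)
      (wt r (i + ((j : ℤ) : ZMod (m * s)))) (by rw [sg_mul]; linear_combination h0)
    rw [hs3]
    linear_combination this
  rcases h.good_cases (by omega) hg (B := fun k => shift r (i + (k : ZMod (m * s)))) (fun k => rfl)
    with ⟨e₃, f₁, f₂, h0⟩ | ⟨g, f₀, f₁, h0⟩ | ⟨f₁, h0⟩ | ⟨f₁, h0⟩ | ⟨f₁, h0⟩ | ⟨h6, -⟩ | ⟨h8, -⟩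
  · have h1 := congrFun h0 (label i + ((0 : ℤ) : ZMod s))
    simp only [Pi.add_apply, Pi.smul_apply, shift_apply_label_add, smul_eq_mul, sub_zero,
      dvd_zero, if_true, d1, d2, if_false, mul_zero, add_zero, Pi.zero_apply] at h1
    split_ifs at h1 with hd
    · exact hthree 0 e₀ e₃ hd h1
    · exact hw0 e₀ (by simpa using h1)
  · have h1 := congrFun h0 (label i + ((2 : ℤ) : ZMod s))
    simp only [Pi.add_apply, Pi.smul_apply, Pi.sub_apply, shift_apply_label_add, smul_eq_mul,
      sub_self, zero_sub, Int.reduceSub, d1', d2', dvd_zero, if_true, if_false, mul_zero, zero_add,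
      Pi.zero_apply] at h1
    split_ifs at h1 with hd
    · refine hthree (-1) (-g) e₂ (by simpa using (dvd_neg (α := ℤ)).2 hd) ?_
      rw [sg_neg]
      norm_num at h1 ⊢
      linear_combination h1
    · exact hw2 e₂ (by simpa using h1)
  · have h1 := congrFun h0 (label i + ((0 : ℤ) : ZMod s))
    simp only [Pi.add_apply, Pi.smul_apply, shift_apply_label_add, smul_eq_mul, sub_zero,
      dvd_zero, if_true, d1, d2, if_false, mul_zero, add_zero, Pi.zero_apply] at h1
    exact hw0 e₀ h1
  · have h1 := congrFun h0 (label i + ((0 : ℤ) : ZMod s))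
    simp only [Pi.add_apply, Pi.smul_apply, shift_apply_label_add, smul_eq_mul, sub_zero,
      dvd_zero, if_true, d1, d2, if_false, mul_zero, add_zero, Pi.zero_apply] at h1
    exact hw0 e₀ h1
  · have h1 := congrFun h0 (label i + ((2 : ℤ) : ZMod s))
    simp only [Pi.add_apply, Pi.smul_apply, shift_apply_label_add, smul_eq_mul,
      sub_self, zero_sub, Int.reduceSub, d1', d2', dvd_zero, if_true, if_false, mul_zero, zero_add,
      Pi.zero_apply] at h1
    exact hw2 e₂ h1
  · omega
  · omega

/-! ### The case `s = 2` -/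

/-- The condition on `x = r ^ 2` under which, for `s = 2`, a straight `3`-arc may be contained in a
closed non-backtracking walk of length `8`; the sign `c` compares the sign of the third edge with
that of the first. -/
def StraightGood (m n : ℕ) (x : ZMod n) (c : ℤˣ) : Prop :=
  2 + 4 * sg n c * x = 0 ∨ 4 + 2 * sg n c * x = 0 ∨
    (m = 4 ∧ x ^ 4 = 1 ∧ 1 + sg n c * x + x ^ 2 + sg n c * x ^ 3 = 0)

/-- Both relations have coefficients `±1`, except for the first coefficient of the first one. After
scaling the first coefficients to `3` and `1`, the sum or the difference of the relations has at
most one further term. -/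
lemma tripled_cases {u v w : ZMod n} {a b c a' b' c' : ℤˣ}
    (h1 : 3 * sg n a * u + sg n b * v + sg n c * w = 0)
    (h2 : sg n a' * u + sg n b' * v + sg n c' * w = 0) :
    4 * u = 0 ∨ (∃ e, 2 * u + 2 * sg n e * v = 0) ∨ ∃ e, 2 * u + 2 * sg n e * w = 0 := by
  have key : ∀ p q : ℤˣ, p = q ∨ p = -q := fun p q => by
    rcases Int.units_eq_one_or p with rfl | rfl <;> rcases Int.units_eq_one_or q with rfl | rfl <;>
      simp
  have h3 : 3 * u + sg n (a * b) * v + sg n (a * c) * w = 0 := by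
    simp only [sg_mul]
    linear_combination sg n a * h1 - 3 * u * sg_sq (n := n) a
  have h4 : u + sg n (a' * b') * v + sg n (a' * c') * w = 0 := by
    simp only [sg_mul]
    linear_combination sg n a' * h2 - u * sg_sq (n := n) a'
  rcases key (a * b) (a' * b') with hb | hb <;> rcases key (a * c) (a' * c') with hc | hc <;>
    rw [hb, hc] at h3 <;> try simp only [sg_neg] at h3
  · left
    linear_combination 2 * h3 - 2 * h4
  · exact Or.inr (Or.inr ⟨-(a' * c'), by rw [sg_neg]; linear_combination h3 - h4⟩)
  · exact Or.inr (Or.inl ⟨-(a' * b'), by rw [sg_neg]; linear_combination h3 - h4⟩)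
  · left
    linear_combination h3 + h4

/-- The relation of a closed walk of length `8` that ascends throughout. Multiplying it by `x` and
using `x ^ 4 = ±1` gives a second relation with coefficients `±1`; comparing the two leaves only one
possibility for the signs. -/
lemma ascending_cases {x : ZMod n} {c a b g : ℤˣ} (h2 : (2 : ZMod n) ≠ 0) (hx : IsUnit x)
    (H : 2 * (x ^ 2 - 1) ≠ 0) (hg : x ^ 4 = sg n g)
    (h0 : 1 + sg n c * x + sg n a * x ^ 2 + sg n b * x ^ 3 = 0) : a = 1 ∧ b = c ∧ g = 1 := by
  have h1 : x + sg n c * x ^ 2 + sg n a * x ^ 3 + sg n b * sg n g = 0 := by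
    linear_combination x * h0 - sg n b * hg
  -- the difference of `h0` and of a signed multiple of `h1` with the same constant term
  have h3 : (sg n c - sg n b * sg n g) * x + (sg n a - sg n c * sg n b * sg n g) * x ^ 2 +
      (sg n b - sg n a * sg n b * sg n g) * x ^ 3 = 0 := by
    linear_combination h0 - sg n b * sg n g * h1 + sg n g ^ 2 * sg_sq (n := n) b +
      sg_sq (n := n) g
  have ne : ∀ y : ZMod n, IsUnit y → 2 * y ≠ 0 := fun y hy h => h2 (hy.mul_left_eq_zero.1 h)
  have N1 := ne x hx
  have N2 := ne _ (hx.pow 2)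
  have N3 := ne _ (hx.pow 3)
  have N4 : 2 * (x - x ^ 3) ≠ 0 := fun h =>
    H (hx.mul_left_eq_zero.1 (by linear_combination -h))
  have N5 : 2 * (1 + x) ≠ 0 := fun h => H (by linear_combination (x - 1) * h)
  have N6 : 2 * (1 - x) ≠ 0 := fun h => H (by linear_combination (-x - 1) * h)
  have N7 : 2 * (x + x ^ 2) ≠ 0 := fun h =>
    N5 (hx.mul_left_eq_zero.1 (by linear_combination h))
  have N8 : 2 * (x - x ^ 2) ≠ 0 := fun h =>
    N6 (hx.mul_left_eq_zero.1 (by linear_combination h))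
  have N9 : 2 * (x ^ 2 + x ^ 3) ≠ 0 := fun h =>
    N7 (hx.mul_left_eq_zero.1 (by linear_combination h))
  have N10 : 2 * (x ^ 2 - x ^ 3) ≠ 0 := fun h =>
    N8 (hx.mul_left_eq_zero.1 (by linear_combination h))
  rcases Int.units_eq_one_or a with rfl | rfl <;> rcases Int.units_eq_one_or b with rfl | rfl <;>
    rcases Int.units_eq_one_or c with rfl | rfl <;> rcases Int.units_eq_one_or g with rfl | rfl <;>
    simp only [sg_neg, sg_one] at h3 h0
  all_goals first
    | exact ⟨rfl, rfl, rfl⟩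
    | exact absurd (by linear_combination h3) N1
    | exact absurd (by linear_combination -h3) N1
    | exact absurd (by linear_combination h3) N2
    | exact absurd (by linear_combination -h3) N2
    | exact absurd (by linear_combination h3) N3
    | exact absurd (by linear_combination -h3) N3
    | exact absurd (by linear_combination h3) N4
    | exact absurd (by linear_combination -h3) N4
    | exact absurd (by linear_combination h3) N7
    | exact absurd (by linear_combination -h3) N7
    | exact absurd (by linear_combination h3) N8
    | exact absurd (by linear_combination -h3) N8
    | exact absurd (by linear_combination h3) N9
    | exact absurd (by linear_combination -h3) N9
    | exact absurd (by linear_combination h3) N10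
    | exact absurd (by linear_combination -h3) N10
    | exact absurd (by linear_combination 2 * h0 - h3) h2

/-- Two relations between `1`, `ρ`, `ρ ^ 2` whose coefficients are signs, except for a single one
that is tripled, do not hold simultaneously. -/
lemma tripled_false {ρ : ZMod n} (hρ : IsUnit ρ) (h4 : (4 : ZMod n) ≠ 0)
    (H : 2 * (ρ ^ 2 - 1) ≠ 0) (H' : 2 * (ρ ^ 2 + 1) ≠ 0) {q : Fin 3} {a b c a' b' c' : ℤˣ}
    (h1 : (if q = 0 then 3 else 1) * sg n a + (if q = 1 then 3 else 1) * sg n b * ρ +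
      (if q = 2 then 3 else 1) * sg n c * ρ ^ 2 = 0)
    (h2 : sg n a' + sg n b' * ρ + sg n c' * ρ ^ 2 = 0) : False := by
  have N1 : ∀ e : ℤˣ, 2 + 2 * sg n e * ρ ≠ 0 := fun e h0 => H (by
    linear_combination (sg n e * ρ - 1) * h0 - 2 * ρ ^ 2 * sg_sq (n := n) e)
  have N2 : ∀ e : ℤˣ, 2 + 2 * sg n e * ρ ^ 2 ≠ 0 := fun e h0 => by
    rcases Int.units_eq_one_or e with rfl | rfl
    · exact H' (by rw [sg_one] at h0; linear_combination h0)
    · exact H (by rw [sg_neg, sg_one] at h0; linear_combination -h0)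
  fin_cases q <;> norm_num [Fin.ext_iff] at h1
  · rcases tripled_cases (u := 1) (v := ρ) (w := ρ ^ 2) (by rwa [mul_one]) (by rwa [mul_one]) with
      h | ⟨e, h⟩ | ⟨e, h⟩
    · exact h4 (by rwa [mul_one] at h)
    · exact N1 e (by rwa [mul_one] at h)
    · exact N2 e (by rwa [mul_one] at h)
  · rcases tripled_cases (u := ρ) (v := 1) (w := ρ ^ 2) (a := b) (b := a) (c := c) (a' := b')
      (b' := a') (c' := c') (by linear_combination h1) (by linear_combination h2) with
      h | ⟨e, h⟩ | ⟨e, h⟩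
    · exact h4 (hρ.mul_left_eq_zero.1 h)
    · exact N1 e (by linear_combination sg n e * h - 2 * sg_sq (n := n) e)
    · exact N1 e (hρ.mul_left_eq_zero.1 (by linear_combination h))
  · rcases tripled_cases (u := ρ ^ 2) (v := 1) (w := ρ) (a := c) (b := a) (c := b) (a' := c')
      (b' := a') (c' := b') (by linear_combination h1) (by linear_combination h2) with
      h | ⟨e, h⟩ | ⟨e, h⟩
    · exact h4 ((hρ.pow 2).mul_left_eq_zero.1 h)
    · exact N2 e (by linear_combination sg n e * h - 2 * sg_sq (n := n) e)
    · exact N1 e (hρ.mul_left_eq_zero.1 (by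
        linear_combination sg n e * h - 2 * ρ * sg_sq (n := n) e))

/-- For `s = 2` the relations of `good_cases` split into one for the even and one for the odd
levels, and by the weights each of them becomes a relation between powers of `r ^ 2`. -/
lemma Admissible.straightGood_of_good (h : Admissible m 2 n r)
    (H : 2 * ((r : ZMod n) ^ 4 - 1) ≠ 0) (H' : 2 * ((r : ZMod n) ^ 4 + 1) ≠ 0) (hn4 : n ≠ 4)
    (x : verts m 2 n r) (e₀ e₁ e₂ : ℤˣ)
    (hg : Good (graph m 2 n r) x (h.up e₀ x) (h.up e₁ (h.up e₀ x))
      (h.up e₂ (h.up e₁ (h.up e₀ x)))) {σ : ℤˣ}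
    (hσ : (wt r (x.1.1 + 2) : ZMod n) = sg n σ * r ^ 2 * wt r x.1.1) :
    StraightGood m n (r ^ 2) (e₀ * e₂ * σ) := by
  have h2 := two_ne_zero_of_three_le h.three_le_n
  have h4 := four_ne_zero_of h.three_le_n hn4
  have hm := h.three_le_m H H'
  set i := x.1.1 with hi
  set ρ : ZMod n := (r : ZMod n) ^ 2 with hρ
  have hρu : IsUnit ρ := r.isUnit.pow 2
  have Hρ : 2 * (ρ ^ 2 - 1) ≠ 0 := fun h0 => H (by rw [← h0, hρ]; ring)
  have Hρ' : 2 * (ρ ^ 2 + 1) ≠ 0 := fun h0 => H' (by rw [← h0, hρ]; ring)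
  set W : ℤ → (ZMod n)ˣ := fun k => wt r (i + (k : ZMod (m * 2))) with hW
  have hW2 : (W 2 : ZMod n) = sg n σ * ρ * W 0 := by simpa [hW] using hσ
  have hWW : ∀ k : ℤ, ∃ e f g : ℤˣ, (W (k + 2) : ZMod n) = sg n e * ρ * W k ∧
      (W (k + 4) : ZMod n) = sg n f * ρ ^ 2 * W k ∧
      (W (k + 6) : ZMod n) = sg n g * ρ ^ 3 * W k := by
    intro k
    obtain ⟨e, he⟩ := h.wt_add_int i k 2
    obtain ⟨f, hf⟩ := h.wt_add_int i k 4
    obtain ⟨g, hg⟩ := h.wt_add_int i k 6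
    exact ⟨e, f, g, by simpa [hW, hρ, ← pow_mul] using he, by simpa [hW, hρ, ← pow_mul] using hf,
      by simpa [hW, hρ, ← pow_mul] using hg⟩
  have N0 : ∀ e : ℤˣ, 2 * sg n e * (W 0 : ZMod n) ≠ 0 := fun e => h.two_mul_wt_ne _ e
  have N2 : ∀ e : ℤˣ, 2 * sg n e * (W 2 : ZMod n) ≠ 0 := fun e => h.two_mul_wt_ne _ e
  have N02 : ∀ e f : ℤˣ, 2 * sg n e * (W 0 : ZMod n) + 2 * sg n f * W 2 ≠ 0 := by
    intro e f h0
    refine Hρ (two_mul_sq_of_add_eq_zero (e := e) (f := f * σ) (W 0) ?_)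
    rw [sg_mul, ← h0, hW2]
    ring
  have key : ∀ p q : ℤˣ, q = p ∨ q = -p := fun p q => by
    rcases Int.units_eq_one_or p with rfl | rfl <;> rcases Int.units_eq_one_or q with rfl | rfl <;>
      simp
  have he₀ := sg_sq (n := n) e₀
  have hev : ∀ k j : ℤ, shift r (i + (k : ZMod (m * 2))) (label i + (j : ZMod 2)) =
      if (2 : ℤ) ∣ k - j then (W k : ZMod n) else 0 := fun k j => shift_apply_label_add i k j
  rcases h.good_cases (by omega) hg (B := fun k => shift r (i + (k : ZMod (m * 2)))) (fun k => rfl)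
    with ⟨e₃, f₁, f₂, h0⟩ | ⟨g, f₀, f₁, h0⟩ | ⟨f₁, h0⟩ | ⟨f₁, h0⟩ | ⟨f₁, h0⟩ | ⟨h6, c, p, h0⟩ |
      ⟨h8, e₃, e₄, e₅, e₆, e₇, h0⟩
  · have h1 := congrFun h0 (label i + ((0 : ℤ) : ZMod 2))
    simp only [Pi.add_apply, Pi.smul_apply, hev, smul_eq_mul, Pi.zero_apply] at h1
    norm_num at h1
    exfalso
    rcases key e₂ f₂ with rfl | rfl
    · exact N0 e₀ (by linear_combination h1)
    · rw [sg_neg] at h1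
      exact N02 e₀ e₂ (by linear_combination h1)
  · have h1 := congrFun h0 (label i + ((0 : ℤ) : ZMod 2))
    simp only [Pi.add_apply, Pi.sub_apply, Pi.smul_apply, hev, smul_eq_mul, Pi.zero_apply] at h1
    norm_num at h1
    exfalso
    rcases key e₀ f₀ with rfl | rfl
    · exact N2 e₂ (by linear_combination h1)
    · rw [sg_neg] at h1
      exact N02 e₀ e₂ (by linear_combination h1)
  · have h1 := congrFun h0 (label i + ((0 : ℤ) : ZMod 2))
    simp only [Pi.add_apply, Pi.smul_apply, hev, smul_eq_mul, Pi.zero_apply] at h1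
    norm_num at h1
    rw [hW2] at h1
    left
    rw [← Units.mul_left_eq_zero (W 0)]
    simp only [sg_mul]
    linear_combination sg n e₀ * h1 - 2 * (W 0 : ZMod n) * he₀
  · have h1 := congrFun h0 (label i + ((0 : ℤ) : ZMod 2))
    simp only [Pi.add_apply, Pi.smul_apply, hev, smul_eq_mul, Pi.zero_apply] at h1
    norm_num at h1
    exact absurd h1 (N02 e₀ e₂)
  · have h1 := congrFun h0 (label i + ((0 : ℤ) : ZMod 2))
    simp only [Pi.add_apply, Pi.smul_apply, hev, smul_eq_mul, Pi.zero_apply] at h1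
    norm_num at h1
    rw [hW2] at h1
    right; left
    rw [← Units.mul_left_eq_zero (W 0)]
    simp only [sg_mul]
    linear_combination sg n e₀ * h1 - 4 * (W 0 : ZMod n) * he₀
  · exfalso
    have h1 := congrFun h0 (label i + ((0 : ℤ) : ZMod 2))
    have h1' := congrFun h0 (label i + ((1 : ℤ) : ZMod 2))
    simp only [Fin.sum_univ_six, Pi.add_apply, Pi.smul_apply, hev, smul_eq_mul,
      Pi.zero_apply] at h1 h1'
    norm_num at h1 h1'
    obtain ⟨a, b, -, ha, hb, -⟩ := hWW 0
    obtain ⟨a', b', -, ha', hb', -⟩ := hWW 1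
    norm_num at ha hb ha' hb'
    rw [ha, hb] at h1
    rw [ha', hb'] at h1'
    have hp : ∀ p : Fin 6, p = 0 ∨ p = 1 ∨ p = 2 ∨ p = 3 ∨ p = 4 ∨ p = 5 := by decide
    rcases hp p with rfl | rfl | rfl | rfl | rfl | rfl
    · simp only [Fin.reduceEq, if_true, if_false] at h1 h1'
      refine tripled_false hρu h4 Hρ Hρ' (q := 0) (a := (c 0)) (b := (c 2 * a)) (c := (c 4 * b))
        (a' := (c 1)) (b' := (c 3 * a')) (c' := (c 5 * b')) ?_ ?_
      · rw [← Units.mul_left_eq_zero (W 0)]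
        simp only [Fin.reduceEq, if_true, if_false, sg_mul]
        linear_combination h1
      · rw [← Units.mul_left_eq_zero (W 1)]
        simp only [sg_mul]
        linear_combination h1'
    · simp only [Fin.reduceEq, if_true, if_false] at h1 h1'
      refine tripled_false hρu h4 Hρ Hρ' (q := 0) (a := (c 1)) (b := (c 3 * a')) (c := (c 5 * b'))
        (a' := (c 0)) (b' := (c 2 * a)) (c' := (c 4 * b)) ?_ ?_
      · rw [← Units.mul_left_eq_zero (W 1)]
        simp only [Fin.reduceEq, if_true, if_false, sg_mul]
        linear_combination h1'
      · rw [← Units.mul_left_eq_zero (W 0)]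
        simp only [sg_mul]
        linear_combination h1
    · simp only [Fin.reduceEq, if_true, if_false] at h1 h1'
      refine tripled_false hρu h4 Hρ Hρ' (q := 1) (a := (c 0)) (b := (c 2 * a)) (c := (c 4 * b))
        (a' := (c 1)) (b' := (c 3 * a')) (c' := (c 5 * b')) ?_ ?_
      · rw [← Units.mul_left_eq_zero (W 0)]
        simp only [Fin.reduceEq, if_true, if_false, sg_mul]
        linear_combination h1
      · rw [← Units.mul_left_eq_zero (W 1)]
        simp only [sg_mul]
        linear_combination h1'
    · simp only [Fin.reduceEq, if_true, if_false] at h1 h1'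
      refine tripled_false hρu h4 Hρ Hρ' (q := 1) (a := (c 1)) (b := (c 3 * a')) (c := (c 5 * b'))
        (a' := (c 0)) (b' := (c 2 * a)) (c' := (c 4 * b)) ?_ ?_
      · rw [← Units.mul_left_eq_zero (W 1)]
        simp only [Fin.reduceEq, if_true, if_false, sg_mul]
        linear_combination h1'
      · rw [← Units.mul_left_eq_zero (W 0)]
        simp only [sg_mul]
        linear_combination h1
    · simp only [Fin.reduceEq, if_true, if_false] at h1 h1'
      refine tripled_false hρu h4 Hρ Hρ' (q := 2) (a := (c 0)) (b := (c 2 * a)) (c := (c 4 * b))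
        (a' := (c 1)) (b' := (c 3 * a')) (c' := (c 5 * b')) ?_ ?_
      · rw [← Units.mul_left_eq_zero (W 0)]
        simp only [Fin.reduceEq, if_true, if_false, sg_mul]
        linear_combination h1
      · rw [← Units.mul_left_eq_zero (W 1)]
        simp only [sg_mul]
        linear_combination h1'
    · simp only [Fin.reduceEq, if_true, if_false] at h1 h1'
      refine tripled_false hρu h4 Hρ Hρ' (q := 2) (a := (c 1)) (b := (c 3 * a')) (c := (c 5 * b'))
        (a' := (c 0)) (b' := (c 2 * a)) (c' := (c 4 * b)) ?_ ?_
      · rw [← Units.mul_left_eq_zero (W 1)]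
        simp only [Fin.reduceEq, if_true, if_false, sg_mul]
        linear_combination h1'
      · rw [← Units.mul_left_eq_zero (W 0)]
        simp only [sg_mul]
        linear_combination h1
  · obtain ⟨-, b, g, -, hb, hg'⟩ := hWW 0
    have h1 := congrFun h0 (label i + ((0 : ℤ) : ZMod 2))
    simp only [Pi.add_apply, Pi.smul_apply, hev, smul_eq_mul, Pi.zero_apply] at h1
    norm_num at h1 hb hg'
    rw [hW2, hb, hg'] at h1
    have hm4 : m = 4 := by omega
    obtain ⟨γ, hγ⟩ := h.exists_pow_eq
    have hγ' : ρ ^ 4 = sg n γ := by rw [← hγ, hρ, ← pow_mul, h8]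
    obtain ⟨h5, h6, h7⟩ := ascending_cases (c := e₀ * e₂ * σ) (a := e₀ * e₄ * b) (b := e₀ * e₆ * g)
      h2 hρu Hρ hγ' (by
        rw [← Units.mul_left_eq_zero (W 0)]
        simp only [sg_mul]
        linear_combination sg n e₀ * h1 - (W 0 : ZMod n) * he₀)
    refine Or.inr (Or.inr ⟨by omega, by rw [hγ', h7, sg_one], ?_⟩)
    rw [← Units.mul_left_eq_zero (W 0)]
    have h8' : sg n (e₀ * e₄ * b) = 1 := by rw [h5, sg_one]
    have h9 : sg n (e₀ * e₆ * g) = sg n (e₀ * e₂ * σ) := by rw [h6]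
    simp only [sg_mul] at h8' h9 ⊢
    linear_combination sg n e₀ * h1 - (W 0 : ZMod n) * he₀ - ρ ^ 2 * W 0 * h8' - ρ ^ 3 * W 0 * h9

end CPM

namespace CPM
variable {m s n : ℕ} {r : (ZMod n)ˣ}

/-! ### Explicit closed walks of length eight -/

section Walks
variable (h : Admissible m s n r)

lemma Admissible.up_down (e : ℤˣ) (x : verts m s n r) : h.up e (h.down e x) = x :=
  Subtype.ext (by simp [Admissible.up, Admissible.down])

lemma Admissible.down_up (e : ℤˣ) (x : verts m s n r) : h.down e (h.up e x) = x :=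
  Subtype.ext (by simp [Admissible.up, Admissible.down])

lemma Admissible.up_down_ne {e f : ℤˣ} (hef : e ≠ f) (x : verts m s n r) :
    h.up e (h.down f x) ≠ x := fun h0 =>
  hef (h.up_injective (h0.trans (h.up_down f x).symm))

lemma Admissible.down_up_ne {e f : ℤˣ} (hef : e ≠ f) (x : verts m s n r) :
    h.down e (h.up f x) ≠ x := fun h0 =>
  hef (h.down_injective (h0.trans (h.down_up f x).symm))

lemma Admissible.up_up_ne (e f : ℤˣ) (x : verts m s n r) : h.up e (h.up f x) ≠ x := fun h0 =>
  h.up_ne_down e f (h.up f x) (h0.trans (h.down_up f x).symm)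

lemma Admissible.down_down_ne (e f : ℤˣ) (x : verts m s n r) : h.down e (h.down f x) ≠ x :=
  fun h0 => h.up_ne_down f e (h.down f x) ((h.up_down f x).trans h0.symm)

lemma units_ne_neg (e : ℤˣ) : e ≠ -e := units_ne_iff.2 rfl

lemma units_neg_ne (e : ℤˣ) : -e ≠ e := (units_ne_neg e).symm

/-- A `3`-arc that turns exactly at its second vertex, going up first, lies in a closed walk of
length `8`: it goes twice to the level above and twice to the level below that of `x`, and the
second excursion in either direction undoes the change made by the first. -/
lemma Admissible.good_up_down_down (x : verts m s n r) (e f : ℤˣ) :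
    Good (graph m s n r) x (h.up e x) (h.down (-e) (h.up e x))
      (h.down f (h.down (-e) (h.up e x))) := by
  set x₃ := h.down f (h.down (-e) (h.up e x)) with hx₃
  set x₇ := h.down (-f) (h.down e (h.up (-e) (h.up (-f) x₃))) with hx₇
  have hx : x = h.up f x₇ := by
    apply Subtype.ext
    refine Prod.ext ?_ ?_
    · simp [hx₇, hx₃, Admissible.up, Admissible.down]
    · simp only [hx₇, hx₃, Admissible.up, Admissible.down, step_fst, step_snd, back_fst, back_snd,
        add_sub_cancel_right, sub_add_cancel, sg_neg]
      module
  refine ⟨h.up (-f) x₃, h.up (-e) (h.up (-f) x₃), h.down e (h.up (-e) (h.up (-f) x₃)), x₇,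
    ⟨h.adj_up _ _, h.adj_up _ _, h.adj_down _ _, h.adj_down _ _, ?_⟩,
    h.up_down_ne (units_neg_ne f) _, h.up_up_ne _ _ _, h.down_up_ne (units_ne_neg e) _,
    h.down_down_ne _ _ _, ?_, ?_⟩
  · conv_rhs => rw [hx]
    exact h.adj_up _ _
  · conv_lhs => rw [hx]
    exact h.up_down_ne (units_ne_neg f) _
  · conv_lhs => rw [hx]
    exact h.up_up_ne _ _ _

/-- The counterpart of `good_up_down_down` for a `3`-arc that goes down first. -/
lemma Admissible.good_down_up_up (x : verts m s n r) (e f : ℤˣ) :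
    Good (graph m s n r) x (h.down e x) (h.up (-e) (h.down e x))
      (h.up f (h.up (-e) (h.down e x))) := by
  set x₃ := h.up f (h.up (-e) (h.down e x)) with hx₃
  set x₇ := h.up (-f) (h.up e (h.down (-e) (h.down (-f) x₃))) with hx₇
  have hx : x = h.down f x₇ := by
    apply Subtype.ext
    refine Prod.ext ?_ ?_
    · simp [hx₇, hx₃, Admissible.up, Admissible.down]
    · simp only [hx₇, hx₃, Admissible.up, Admissible.down, step_fst, step_snd, back_fst, back_snd,
        add_sub_cancel_right, sub_add_cancel, sg_neg]
      module
  refine ⟨h.down (-f) x₃, h.down (-e) (h.down (-f) x₃), h.up e (h.down (-e) (h.down (-f) x₃)), x₇,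
    ⟨h.adj_down _ _, h.adj_down _ _, h.adj_up _ _, h.adj_up _ _, ?_⟩,
    h.down_up_ne (units_neg_ne f) _, h.down_down_ne _ _ _, h.up_down_ne (units_ne_neg e) _,
    h.up_up_ne _ _ _, ?_, ?_⟩
  · conv_rhs => rw [hx]
    exact h.adj_down _ _
  · conv_lhs => rw [hx]
    exact h.down_up_ne (units_ne_neg f) _
  · conv_lhs => rw [hx]
    exact h.down_down_ne _ _ _

end Walks

/-- The first alternative of `StraightGood` provides a closed walk of length `8` through two
consecutive turns. -/
lemma Admissible.good_turns_of_first (h : Admissible m 2 n r) (x : verts m 2 n r) {c : ℤˣ}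
    (hc : 2 + 4 * sg n c * (r : ZMod n) ^ 2 = 0) :
    Good (graph m 2 n r) x (h.up 1 x) (h.down (-1) (h.up 1 x))
      (h.up 1 (h.down (-1) (h.up 1 x))) := by
  set x₃ := h.up 1 (h.down (-1) (h.up 1 x)) with hx₃
  obtain ⟨σ, hσ⟩ := h.wt_add (x.1.1 - 2) 2
  have hσ' : (wt r x.1.1 : ZMod n) = sg n σ * r ^ 2 * wt r (x.1.1 - 2) := by
    rw [← hσ]; congr 2; push_cast; ring
  -- this sign makes the two edges two levels below `x` cancel the four edges above `x`
  set g := -(c * σ) with hg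
  set x₇ := h.up (-g) (h.down g (h.down 1 (h.down (-1) x₃))) with hx₇
  have hx : x = h.up 1 x₇ := by
    apply Subtype.ext
    refine Prod.ext ?_ ?_
    · simp [hx₇, hx₃, Admissible.up, Admissible.down]
    · have h2 : (1 + 1 : ZMod 2) = 0 := rfl
      have hsh : (4 : ZMod n) • shift r x.1.1 = (2 * sg n g) • shift r (x.1.1 - 1 - 1) := by
        have e1 : x.1.1 - 1 - 1 = x.1.1 - 2 := by ring
        have e2 : label (x.1.1 - 2) = label x.1.1 := by
          rw [← e1, label_sub_one, label_sub_one, sub_sub, h2, sub_zero]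
        rw [e1, shift_eq, shift_eq, e2, ← Pi.single_smul, ← Pi.single_smul]
        congr 1
        rw [hσ', hg]
        simp only [smul_eq_mul, sg_neg, sg_mul]
        linear_combination (sg n c * sg n σ * wt r (x.1.1 - 2) : ZMod n) * hc -
          4 * r ^ 2 * wt r (x.1.1 - 2) * sg n σ * sg_sq (n := n) c
      simp only [hx₇, hx₃, Admissible.up, Admissible.down, step_fst, step_snd, back_fst, back_snd,
        add_sub_cancel_right, sub_add_cancel, sg_neg, sg_one]
      linear_combination (norm := module) -hsh
  refine ⟨h.down (-1) x₃, h.down 1 (h.down (-1) x₃), h.down g (h.down 1 (h.down (-1) x₃)), x₇,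
    ⟨h.adj_down _ _, h.adj_down _ _, h.adj_down _ _, h.adj_up _ _, ?_⟩,
    h.down_up_ne (by decide) _, h.down_down_ne _ _ _, h.down_down_ne _ _ _,
    h.up_down_ne (units_neg_ne g) _, ?_, ?_⟩
  · conv_rhs => rw [hx]
    exact h.adj_up _ _
  · conv_lhs => rw [hx]
    exact h.up_up_ne _ _ _
  · conv_lhs => rw [hx]
    exact h.up_up_ne _ _ _

/-- The second alternative of `StraightGood` provides a closed walk of length `8` through two
consecutive turns. -/
lemma Admissible.good_turns_of_second (h : Admissible m 2 n r) (x : verts m 2 n r) {c : ℤˣ}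
    (hc : 4 + 2 * sg n c * (r : ZMod n) ^ 2 = 0) :
    Good (graph m 2 n r) x (h.up 1 x) (h.down (-1) (h.up 1 x))
      (h.up 1 (h.down (-1) (h.up 1 x))) := by
  set x₃ := h.up 1 (h.down (-1) (h.up 1 x)) with hx₃
  obtain ⟨σ, hσ⟩ := h.wt_add x.1.1 2
  have hσ' : (wt r (x.1.1 + 1 + 1) : ZMod n) = sg n σ * r ^ 2 * wt r x.1.1 := by
    rw [← hσ]; congr 2; push_cast; ring
  -- this sign makes the two edges two levels above `x` cancel the other four at its own level
  set g := c * σ with hg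
  set x₇ := h.down 1 (h.down (-g) (h.up g (h.up 1 x₃))) with hx₇
  have hx : x = h.down (-1) x₇ := by
    apply Subtype.ext
    refine Prod.ext ?_ ?_
    · simp [hx₇, hx₃, Admissible.up, Admissible.down]
    · have h2 : (1 + 1 : ZMod 2) = 0 := rfl
      have hsh : (4 : ZMod n) • shift r x.1.1 + (2 * sg n g) • shift r (x.1.1 + 1 + 1) = 0 := by
        have e2 : label (x.1.1 + 1 + 1) = label x.1.1 := by
          simp [label, h2, add_assoc]
        rw [shift_eq, shift_eq, e2, ← Pi.single_smul, ← Pi.single_smul, ← Pi.single_add,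
          Pi.single_eq_zero_iff]
        rw [hσ', hg]
        simp only [smul_eq_mul, sg_mul]
        linear_combination (wt r x.1.1 : ZMod n) * hc +
          2 * sg n c * r ^ 2 * wt r x.1.1 * sg_sq (n := n) σ
      simp only [hx₇, hx₃, Admissible.up, Admissible.down, step_fst, step_snd, back_fst, back_snd,
        add_sub_cancel_right, sg_neg, sg_one]
      linear_combination (norm := module) -hsh
  refine ⟨h.up 1 x₃, h.up g (h.up 1 x₃), h.down (-g) (h.up g (h.up 1 x₃)), x₇,
    ⟨h.adj_up _ _, h.adj_up _ _, h.adj_down _ _, h.adj_down _ _, ?_⟩,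
    h.up_up_ne _ _ _, h.up_up_ne _ _ _, h.down_up_ne (units_neg_ne g) _,
    h.down_down_ne _ _ _, ?_, ?_⟩
  · conv_rhs => rw [hx]
    exact h.adj_down _ _
  · conv_lhs => rw [hx]
    exact h.down_down_ne _ _ _
  · rw [← h.up_down (-1) x₇, ← hx]
    exact fun h0 => absurd (h.up_injective h0) (by decide)

/-! ### Incompatibility of the two signs -/

lemma pow_four_eq_one_of_dvd (hn : n ∣ 120) (r : (ZMod n)ˣ) : (r : ZMod n) ^ 4 = 1 := by
  obtain ⟨u, rfl⟩ := ZMod.unitsMap_surjective hn r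
  have key : ∀ a < 120, Nat.Coprime a 120 → a ^ 4 % 120 = 1 := by decide
  have h1 := key (u : ZMod 120).val (ZMod.val_lt _) (ZMod.val_coe_unit_coprime u)
  have h2 : u ^ 4 = 1 := by
    apply Units.ext
    rw [Units.val_pow_eq_pow_val, Units.val_one]
    have : (((u : ZMod 120).val ^ 4 : ℕ) : ZMod 120) = ((1 : ℕ) : ZMod 120) := by
      rw [ZMod.natCast_eq_natCast_iff']
      exact h1
    simpa using this
  rw [← Units.val_pow_eq_pow_val, ← map_pow, h2, map_one, Units.val_one]

/-- For some sign `c`, the condition `StraightGood` fails. Otherwise the relations for both signs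
combine to `4 = 0`, to `2 (r ^ 4 + 1) = 0`, or to `120 = 0`, and in the latter case `r ^ 4 = 1`. -/
lemma exists_not_straightGood (h4 : (4 : ZMod n) ≠ 0)
    (H : 2 * ((r : ZMod n) ^ 4 - 1) ≠ 0) (H' : 2 * ((r : ZMod n) ^ 4 + 1) ≠ 0) :
    ∃ c : ℤˣ, ¬ StraightGood m n (r ^ 2) c := by
  by_contra! hc
  have h120 : (120 : ZMod n) ≠ 0 := by
    intro h0
    have : ((120 : ℕ) : ZMod n) = 0 := by exact_mod_cast h0
    apply H
    rw [pow_four_eq_one_of_dvd ((ZMod.natCast_eq_zero_iff _ _).1 this), sub_self, mul_zero]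
  have h1 := hc 1
  have h2 := hc (-1)
  simp only [StraightGood, sg_one, sg_neg] at h1 h2
  generalize (r : ZMod n) = q at *
  rcases h1 with a | a | ⟨-, a', a⟩ <;> rcases h2 with b | b | ⟨-, b', b⟩
  · exact h4 (by linear_combination a + b)
  · exact h120 (by linear_combination 12 * a + 24 * b)
  · exact h120 (by linear_combination 64 * b + (16 * q ^ 4 - 24 * q ^ 2 + 28) * a)
  · exact h120 (by linear_combination 24 * a + 12 * b)
  · exact h120 (by linear_combination 15 * a + 15 * b)
  · exact h120 (by linear_combination 8 * b + (4 * q ^ 4 - 12 * q ^ 2 + 28) * a)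
  · exact h120 (by linear_combination 64 * a + (16 * q ^ 4 + 24 * q ^ 2 + 28) * b)
  · exact h120 (by linear_combination 8 * a + (4 * q ^ 4 + 12 * q ^ 2 + 28) * b)
  · exact H' (by linear_combination a + b)

end CPM

namespace CPM
variable {m s n : ℕ} {r : (ZMod n)ˣ}

/-! ### Failure of `2`-arc-transitivity -/

/-- If some automorphism maps the turn `(x, up x, down (up x))` to a straight `2`-arc, then one of
the two straight extensions of the latter is contained in a closed non-backtracking walk of length
`8`: the two extensions of the turn that descend further are, and they have distinct images. -/
lemma Admissible.exists_good_of_map (h : Admissible m s n r) (φ : graph m s n r ≃g graph m s n r)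
    {x y : verts m s n r} {e f : ℤˣ} (h0 : φ x = y) (h1 : φ (h.up 1 x) = h.up e y)
    (h2 : φ (h.down (-1) (h.up 1 x)) = h.up f (h.up e y)) :
    ∃ g : ℤˣ, Good (graph m s n r) y (h.up e y) (h.up f (h.up e y))
      (h.up g (h.up f (h.up e y))) := by
  have key : ∀ d : ℤˣ, (∃ g, φ (h.down d (h.down (-1) (h.up 1 x))) =
      h.up g (h.up f (h.up e y))) ∨ φ (h.down d (h.down (-1) (h.up 1 x))) =
      h.down (-f) (h.up f (h.up e y)) := by
    intro d
    have ha := φ.map_rel_iff.2 (h.adj_down d (h.down (-1) (h.up 1 x)))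
    rw [h2, h.adj_iff] at ha
    rcases ha with ha | ⟨g, hg⟩
    · exact Or.inl ha
    · right
      rw [hg]
      congr 1
      apply units_ne_iff.1
      rintro rfl
      rw [h.down_up, ← h1] at hg
      exact h.down_down_ne _ _ _ (φ.injective hg)
  have hgood : ∀ d g : ℤˣ, φ (h.down d (h.down (-1) (h.up 1 x))) = h.up g (h.up f (h.up e y)) →
      Good (graph m s n r) y (h.up e y) (h.up f (h.up e y)) (h.up g (h.up f (h.up e y))) := by
    intro d g hg
    rw [← hg, ← h2, ← h1, ← h0]
    exact (h.good_up_down_down x 1 d).map φ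
  rcases key 1 with ⟨g, hg⟩ | k1
  · exact ⟨g, hgood 1 g hg⟩
  rcases key (-1) with ⟨g, hg⟩ | k2
  · exact ⟨g, hgood (-1) g hg⟩
  exact absurd (h.down_injective (φ.injective (k1.trans k2.symm))) (by decide)

/-- If a turn that goes up first is mapped to `(y₀, y₁, y₂)` and `y₃` is a bad extension of the
image, then `y₃` is the image of the extension that turns again. -/
lemma Admissible.map_turn_up (h : Admissible m s n r) (φ : graph m s n r ≃g graph m s n r)
    {x y₃ : verts m s n r} (h23 : (graph m s n r).Adj (φ (h.down (-1) (h.up 1 x))) y₃)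
    (h13 : y₃ ≠ φ (h.up 1 x))
    (hb : ¬ Good (graph m s n r) (φ x) (φ (h.up 1 x)) (φ (h.down (-1) (h.up 1 x))) y₃) :
    φ (h.up 1 (h.down (-1) (h.up 1 x))) = y₃ := by
  obtain ⟨y, rfl⟩ := φ.surjective y₃
  rw [φ.map_adj_iff, h.adj_iff] at h23
  rcases h23 with ⟨e, rfl⟩ | ⟨e, rfl⟩
  · have : e = 1 := by
      by_contra he
      have he' := units_ne_iff.1 (Ne.symm he)
      exact h13 (by rw [he', h.up_down])
    rw [this]
  · exact absurd ((h.good_up_down_down x 1 e).map φ) hb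

/-- The counterpart of `map_turn_up` for a turn that goes down first. -/
lemma Admissible.map_turn_down (h : Admissible m s n r) (φ : graph m s n r ≃g graph m s n r)
    {x y₃ : verts m s n r} (h23 : (graph m s n r).Adj (φ (h.up 1 (h.down (-1) x))) y₃)
    (h13 : y₃ ≠ φ (h.down (-1) x))
    (hb : ¬ Good (graph m s n r) (φ x) (φ (h.down (-1) x)) (φ (h.up 1 (h.down (-1) x))) y₃) :
    φ (h.down (-1) (h.up 1 (h.down (-1) x))) = y₃ := by
  obtain ⟨y, rfl⟩ := φ.surjective y₃
  rw [φ.map_adj_iff, h.adj_iff] at h23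
  rcases h23 with ⟨e, rfl⟩ | ⟨e, rfl⟩
  · refine absurd ((h.good_down_up_up x (-1) e).map φ) ?_
    rwa [neg_neg]
  · have : e = -1 := by
      by_contra he
      have he' := units_ne_iff.1 (Ne.symm he)
      exact h13 (by rw [he', neg_neg, h.down_up])
    rw [this]

lemma wt_natCast (hr : r ^ (m * s) = 1) (k : ℕ) : wt r (k : ZMod (m * s)) = r ^ k := by
  rw [wt, ZMod.val_natCast]
  exact (pow_eq_pow_mod k hr).symm

/-- The path that alternates between ascending and descending edges, with the signs `1`, `-1`. -/
def Admissible.alternating (h : Admissible m s n r) : ℕ → verts m s n r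
  | 0 => origin m s n r
  | k + 1 => if Even k then h.up 1 (h.alternating k) else h.down (-1) (h.alternating k)

/-- The ascending path with the signs `1, 1, c, c, 1, 1, c, c, …`. -/
def Admissible.ascending (h : Admissible m s n r) (c : ℤˣ) : ℕ → verts m s n r
  | 0 => origin m s n r
  | k + 1 => h.up (c ^ (k / 2)) (h.ascending c k)

lemma Admissible.alternating_two_mul (h : Admissible m s n r) (k : ℕ) :
    (h.alternating (2 * k) : Vertex m s n) =
      ((0, (2 * k : ZMod n) • shift r (0 : ZMod (m * s))) : Vertex m s n) := by
  induction k with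
  | zero => simp [Admissible.alternating, origin]
  | succ k ih =>
    have h1 : ¬ Even (2 * k + 1) := by simp
    rw [show 2 * (k + 1) = 2 * k + 1 + 1 from rfl, Admissible.alternating, if_neg h1,
      Admissible.alternating, if_pos (even_two_mul k)]
    simp only [Admissible.up, Admissible.down]
    refine Prod.ext ?_ ?_
    · simp [ih]
    · simp only [back_snd, step_snd, step_fst, ih, zero_add, sub_self, sg_neg, sg_one]
      push_cast
      module

lemma Admissible.ascending_fst (h : Admissible m s n r) (c : ℤˣ) (k : ℕ) :
    (h.ascending c k).1.1 = k := by
  induction k with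
  | zero => simp [Admissible.ascending, origin]
  | succ k ih => simp [Admissible.ascending, Admissible.up, ih]

lemma Admissible.ascending_snd (h : Admissible m 2 n r) (hr : r ^ (m * 2) = 1) (c : ℤˣ) (k : ℕ) :
    (h.ascending c (2 * k)).1.2 0 = ∑ j ∈ Finset.range k, (sg n c * (r : ZMod n) ^ 2) ^ j := by
  induction k with
  | zero => simp [Admissible.ascending, origin]
  | succ k ih =>
    have l0 : label ((2 * k : ℕ) : ZMod (m * 2)) = 0 := by
      have h1 := label_add_natCast (0 : ZMod (m * 2)) (2 * k)
      have h2 : ((2 * k : ℕ) : ZMod 2) = 0 := by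
        rw [Nat.cast_mul, show ((2 : ℕ) : ZMod 2) = 0 from rfl, zero_mul]
      rwa [zero_add, label_zero, zero_add, h2] at h1
    have l1 : (0 : ZMod 2) ≠ label ((2 * k + 1 : ℕ) : ZMod (m * 2)) := by
      rw [Nat.cast_add, label_add_natCast, l0]
      decide
    have hs : ∀ e : ℤˣ, sg n (e ^ k) = sg n e ^ k := fun e => by simp [sg]
    rw [show 2 * (k + 1) = 2 * k + 1 + 1 from rfl, Admissible.ascending, Finset.sum_range_succ,
      ← ih]
    simp only [Admissible.up, step_snd, h.ascending_fst, Pi.add_apply, Pi.smul_apply,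
      shift_apply_of_ne l1, smul_zero, add_zero]
    rw [Admissible.ascending]
    simp only [Admissible.up, step_snd, h.ascending_fst, Pi.add_apply, Pi.smul_apply]
    rw [← l0, shift_apply_self, wt_natCast hr]
    simp [hs, mul_pow, pow_mul]

/-- Under the third relation of `StraightGood`, no automorphism maps the beginning of the
alternating path to that of the ascending path. Otherwise it would map the first path to the second:
each step of the ascending path is a bad extension of the `2`-arc before it, and the only extension
of a turn that can be bad is the next step of the alternating path. The alternating path is back at
the origin after `2n` steps, so `2n` is a multiple of the number `8` of levels. As `n` is then even,
it is back after `n` steps already, so `8 ∣ n` and the ascending path is back at the origin after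
`n` steps as well. But eight of its steps add `2 (1 + r ^ 4)` to the first component, so `4` would
divide `1 + y ^ 2` for some integer `y`. -/
lemma Admissible.exceptional_false (h : Admissible 4 2 n r)
    (H : 2 * ((r : ZMod n) ^ 4 - 1) ≠ 0) (H' : 2 * ((r : ZMod n) ^ 4 + 1) ≠ 0) (hn4 : n ≠ 4)
    (φ : graph 4 2 n r ≃g graph 4 2 n r) {c : ℤˣ} (hc : ¬ StraightGood 4 n ((r : ZMod n) ^ 2) c)
    (hr : ((r : ZMod n) ^ 2) ^ 4 = 1)
    (hrel : 1 - sg n c * (r : ZMod n) ^ 2 + ((r : ZMod n) ^ 2) ^ 2 -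
      sg n c * ((r : ZMod n) ^ 2) ^ 3 = 0)
    (hφ : ∀ k ≤ 2, φ (h.alternating k) = h.ascending c k) : False := by
  have hr' : r ^ (4 * 2) = 1 := by
    apply Units.ext
    rw [Units.val_pow_eq_pow_val, Units.val_one, ← hr, ← pow_mul]
  have hbad : ∀ k, ¬ Good (graph 4 2 n r) (h.ascending c k) (h.ascending c (k + 1))
      (h.ascending c (k + 2)) (h.ascending c (k + 3)) := by
    intro k hg
    apply hc
    have h1 := h.straightGood_of_good H H' hn4 _ _ _ _ hg (σ := 1) (by
      have : ((k : ZMod (4 * 2)) + 2) = ((k + 2 : ℕ) : ZMod (4 * 2)) := by push_cast; rfl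
      rw [h.ascending_fst, this, wt_natCast hr', wt_natCast hr']
      simp [pow_add, mul_comm])
    have h2 : c ^ (k / 2) * c ^ ((k + 2) / 2) * 1 = c := by
      rw [Nat.add_div_right _ (by norm_num), pow_succ, mul_one, ← mul_assoc, ← mul_pow,
        Int.units_mul_self, one_pow, one_mul]
    rwa [h2] at h1
  have hstep : ∀ k, (φ (h.alternating k) = h.ascending c k ∧
      φ (h.alternating (k + 1)) = h.ascending c (k + 1)) ∧
      φ (h.alternating (k + 2)) = h.ascending c (k + 2) := by
    intro k
    induction k with
    | zero => exact ⟨⟨hφ 0 (by norm_num), hφ 1 (by norm_num)⟩, hφ 2 le_rfl⟩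
    | succ k ih =>
      obtain ⟨⟨i0, i1⟩, i2⟩ := ih
      refine ⟨⟨i1, i2⟩, ?_⟩
      have hb := hbad k
      have hadj : (graph 4 2 n r).Adj (h.ascending c (k + 2)) (h.ascending c (k + 3)) :=
        h.adj_up _ _
      have hne : h.ascending c (k + 3) ≠ h.ascending c (k + 1) := h.up_up_ne _ _ _
      rw [← i0, ← i1, ← i2] at hb
      rw [← i2] at hadj
      rw [← i1] at hne
      by_cases hk : Even k
      · have hk1 : ¬ Even (k + 1) := by simpa [Nat.even_add_one] using hk
        have hk2 : Even (k + 1 + 1) := by simpa [Nat.even_add_one] using hk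
        have e1 : h.alternating (k + 1) = h.up 1 (h.alternating k) := by
          rw [Admissible.alternating, if_pos hk]
        have e2 : h.alternating (k + 2) = h.down (-1) (h.up 1 (h.alternating k)) := by
          rw [← e1, Admissible.alternating, if_neg hk1]
        have e3 : h.alternating (k + 1 + 2) =
            h.up 1 (h.down (-1) (h.up 1 (h.alternating k))) := by
          rw [← e2, Admissible.alternating, if_pos hk2]
        rw [e1, e2] at hb
        rw [e2] at hadj
        rw [e1] at hne
        rw [e3]
        exact h.map_turn_up φ hadj hne hb
      · have hk1 : Even (k + 1) := by simpa [Nat.even_add_one] using hk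
        have hk2 : ¬ Even (k + 1 + 1) := by simpa [Nat.even_add_one] using hk
        have e1 : h.alternating (k + 1) = h.down (-1) (h.alternating k) := by
          rw [Admissible.alternating, if_neg hk]
        have e2 : h.alternating (k + 2) = h.up 1 (h.down (-1) (h.alternating k)) := by
          rw [← e1, Admissible.alternating, if_pos hk1]
        have e3 : h.alternating (k + 1 + 2) =
            h.down (-1) (h.up 1 (h.down (-1) (h.alternating k))) := by
          rw [← e2, Admissible.alternating, if_neg hk2]
        rw [e1, e2] at hb
        rw [e2] at hadj
        rw [e1] at hne
        rw [e3]
        exact h.map_turn_down φ hadj hne hb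
  -- the ascending path is closed whenever the alternating path is
  have hclosed : ∀ k : ℕ, ((2 * k : ℕ) : ZMod n) = 0 → h.ascending c (2 * k) = origin 4 2 n r := by
    intro k hk
    have h1 : h.alternating (2 * k) = h.alternating 0 := by
      apply Subtype.ext
      have h2 := h.alternating_two_mul 0
      rw [mul_zero] at h2
      push_cast at hk
      rw [h.alternating_two_mul, h2, hk]
      simp
    rw [← (hstep (2 * k)).1.1, h1, (hstep 0).1.1]
    rfl
  have hdvd : ∀ k : ℕ, ((2 * k : ℕ) : ZMod n) = 0 → 8 ∣ 2 * k := by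
    intro k hk
    have h1 := h.ascending_fst c (2 * k)
    rw [hclosed k hk] at h1
    exact (ZMod.natCast_eq_zero_iff _ _).1 h1.symm
  have h4 : 8 ∣ 2 * n := hdvd n (by simp)
  obtain ⟨p, hp⟩ : 4 ∣ n := by omega
  have hn0 : ((2 * (2 * p) : ℕ) : ZMod n) = 0 := by
    rw [← mul_assoc, show 2 * 2 * p = n by omega, ZMod.natCast_self]
  have h8 := hdvd _ hn0
  obtain ⟨q, rfl⟩ : 2 ∣ p := by omega
  have hsum := h.ascending_snd hr' c (4 * q)
  rw [show 4 * q = 2 * (2 * q) by ring, hclosed _ hn0] at hsum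
  have hpow : (sg n c * (r : ZMod n) ^ 2) ^ 4 = 1 := by
    rw [mul_pow, hr, show sg n c ^ 4 = (sg n c ^ 2) ^ 2 by ring, sg_sq, one_pow, one_mul]
  have hgeom : ∀ k : ℕ, ∑ j ∈ Finset.range (4 * k), (sg n c * (r : ZMod n) ^ 2) ^ j =
      k * (2 + 2 * (r : ZMod n) ^ 4) := by
    have hfour : 1 + sg n c * (r : ZMod n) ^ 2 + (sg n c * (r : ZMod n) ^ 2) ^ 2 +
        (sg n c * (r : ZMod n) ^ 2) ^ 3 = 2 + 2 * (r : ZMod n) ^ 4 := by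
      linear_combination (sg_sq (n := n) c) * ((r : ZMod n) ^ 4 + sg n c * r ^ 6) - hrel
    generalize sg n c * (r : ZMod n) ^ 2 = y at hpow hfour
    intro k
    induction k with
    | zero => simp
    | succ k ih =>
      have e0 : y ^ (4 * k) = 1 := by rw [pow_mul, hpow, one_pow]
      rw [show 4 * (k + 1) = 4 * k + 1 + 1 + 1 + 1 from rfl]
      simp only [Finset.sum_range_succ, ih, pow_succ, e0]
      push_cast
      linear_combination hfour
  rw [show 2 * (2 * q) = 4 * q by ring, hgeom] at hsum
  have h0 : (((q * (2 + 2 * (r : ZMod n).val ^ 4) : ℕ)) : ZMod n) = 0 := by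
    have := h.neZero_n
    push_cast
    rw [ZMod.natCast_zmod_val, ← hsum]
    rfl
  rw [ZMod.natCast_eq_zero_iff] at h0
  have hn3 := h.three_le_n
  have hq : 0 < q := by omega
  have h5 : q * 8 ∣ q * (2 + 2 * (r : ZMod n).val ^ 4) := by
    rwa [show q * 8 = n by omega]
  have h6 : 8 ∣ 2 + 2 * ((r : ZMod n).val ^ 2) ^ 2 := by
    rw [← pow_mul]
    exact Nat.dvd_of_mul_dvd_mul_left hq h5
  -- a square is not congruent to `-1` modulo `4`
  generalize (r : ZMod n).val ^ 2 = y at h6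
  obtain ⟨z, rfl | rfl⟩ := Nat.even_or_odd' y <;> ring_nf at h6 <;> omega

/-- The graph is not `2`-arc-transitive unless `r ^ (2s) = ±1` up to a factor `2`. -/
lemma Admissible.not_isTwoArcTransitive (h : Admissible m s n r)
    (H : 2 * ((r : ZMod n) ^ (2 * s) - 1) ≠ 0) (H' : 2 * ((r : ZMod n) ^ (2 * s) + 1) ≠ 0)
    (hn4 : n ≠ 4) : ¬ IsTwoArcTransitive (graph m s n r) := by
  intro htrans
  -- an automorphism that maps a turn to a straight `2`-arc
  obtain ⟨φ, h0, h1, h2⟩ := htrans (origin m s n r) (h.up 1 (origin m s n r))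
    (h.down (-1) (h.up 1 (origin m s n r))) (origin m s n r) (h.up 1 (origin m s n r))
    (h.up 1 (h.up 1 (origin m s n r))) (h.adj_up _ _) (h.adj_down _ _)
    (h.down_up_ne (by decide) _).symm (h.adj_up _ _) (h.adj_up _ _) (h.up_up_ne _ _ _).symm
  obtain ⟨g, hg⟩ := h.exists_good_of_map φ h0 h1 h2
  rcases h.two_le_s.lt_or_eq with hs | rfl
  · exact h.not_good_straight hs H H' _ _ _ _ hg
  have h4 := four_ne_zero_of h.three_le_n hn4
  obtain ⟨c, hc⟩ := exists_not_straightGood (m := m) h4 H H'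
  have hσ : (wt r ((origin m 2 n r).1.1 + 2) : ZMod n) =
      sg n 1 * r ^ 2 * wt r (origin m 2 n r).1.1 := by
    have hm := h.three_le_m H H'
    have h2' : (2 : ZMod (m * 2)).val = 2 := ZMod.val_natCast_of_lt (by omega : 2 < m * 2)
    simp [wt, origin, h2']
  have hstraight := h.straightGood_of_good H H' hn4 _ _ _ _ hg hσ
  -- a straight `2`-arc has a bad straight extension, so a turn has a bad extension
  have hbad : ¬ Good (graph m 2 n r) (origin m 2 n r) (h.up 1 (origin m 2 n r))
      (h.up 1 (h.up 1 (origin m 2 n r))) (h.up c (h.up 1 (h.up 1 (origin m 2 n r)))) := by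
    intro hg'
    apply hc
    simpa using h.straightGood_of_good H H' hn4 _ _ _ _ hg' hσ
  have hturn : ¬ Good (graph m 2 n r) (origin m 2 n r) (h.up 1 (origin m 2 n r))
      (h.down (-1) (h.up 1 (origin m 2 n r)))
      (h.up 1 (h.down (-1) (h.up 1 (origin m 2 n r)))) := by
    intro hg'
    have hmap := h.map_turn_up φ (x := origin m 2 n r)
      (y₃ := h.up c (h.up 1 (h.up 1 (origin m 2 n r)))) (by rw [h2]; exact h.adj_up _ _)
      (by rw [h1]; exact h.up_up_ne _ _ _) (by rwa [h0, h1, h2])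
    have := hg'.map φ
    rw [hmap, h0, h1, h2] at this
    exact hbad this
  rcases hstraight with ha | hb | ⟨rfl, hr, hrel⟩
  · exact hturn (h.good_turns_of_first _ ha)
  · exact hturn (h.good_turns_of_second _ hb)
  · have hgc : c = -(1 * g * 1) := by
      apply units_ne_iff.1
      intro hgc
      exact hc (hgc ▸ Or.inr (Or.inr ⟨rfl, hr, hrel⟩))
    refine h.exceptional_false H H' hn4 φ hc hr ?_ ?_
    · rw [hgc, sg_neg]
      linear_combination hrel
    · intro k hk
      interval_cases k
      · exact h0
      · simpa [Admissible.alternating, Admissible.ascending] using h1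
      · simpa [Admissible.alternating, Admissible.ascending] using h2

end CPM

namespace CPM
variable {m s n : ℕ} {r : (ZMod n)ˣ}

/-! ### Arc-transitivity and automorphism groups -/

/-- If the graph is not `2`-arc-transitive but arc-transitive, then every automorphism preserves or
reverses the orientation. -/
lemma Admissible.preserves_or_reverses_of_not (h : Admissible m s n r)
    (harc : IsArcTransitive (graph m s n r)) (h2 : ¬ IsTwoArcTransitive (graph m s n r))
    (φ : graph m s n r ≃g graph m s n r) : Preserves φ ∨ Reverses φ := by
  refine h.preserves_or_reverses φ fun x y z hxz ht => ?_
  by_contra hnt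
  exact h2 (h.isTwoArcTransitive_of_turn harc φ hxz ht hnt)

lemma two_mul_pow_four_sub_one (r : (ZMod 4)ˣ) (k : ℕ) :
    2 * ((r : ZMod 4) ^ (2 * k) - 1) = 0 := by
  have h1 : (r : ZMod 4) ^ 2 = 1 := by
    rcases unit_zmod_four r with h0 | h0 <;> rw [h0] <;> rfl
  rw [pow_mul, h1, one_pow, sub_self, mul_zero]

lemma Admissible.isArcTransitive_iff (h : Admissible m s n r) :
    IsArcTransitive (graph m s n r) ↔
      2 * ((r : ZMod n) ^ (2 * s) + 1) = 0 ∨ 2 * ((r : ZMod n) ^ (2 * s) - 1) = 0 := by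
  constructor
  · intro harc
    by_cases hn4 : n = 4
    · subst hn4
      exact Or.inr (two_mul_pow_four_sub_one r s)
    by_contra! hr
    have h2 := h.not_isTwoArcTransitive hr.2 hr.1 hn4
    set o := origin m s n r
    have h1 := h.varc_up 1 o
    obtain ⟨φ, hφ, hφ'⟩ := harc o (h.up 1 o) (h.up 1 o) o (h.adj_up 1 o) (h.adj_up 1 o).symm
    rcases h.preserves_or_reverses_of_not harc h2 φ with hp | hp
    · have := hp _ _ h1
      rw [hφ, hφ'] at this
      exact h.varc_asymm h1 this
    · rcases two_mul_pow_of_reverses h hn4 hp with h0 | h0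
      · exact hr.1 h0
      · exact hr.2 h0
  · intro hr2
    by_cases hr : (r : ZMod n) ^ (2 * s) + 1 = 0 ∨ (r : ZMod n) ^ (2 * s) - 1 = 0
    · obtain ⟨η, hη, -⟩ := exists_eta h hr
      exact h.isArcTransitive_of_reverses hη
    · obtain ⟨η, hη, -⟩ := exists_etaPrime h hr hr2
      exact h.isArcTransitive_of_reverses hη

end CPM

theorem mainTheorem3 (m s n : ℕ) (hm : 1 ≤ m) (hs : 2 ≤ s) (hn : 3 ≤ n) (r : (ZMod n)ˣ)
    (hr : (r : ZMod n) ^ (m * s) + 1 = 0 ∨ (r : ZMod n) ^ (m * s) - 1 = 0) :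
    (IsArcTransitive (CPM.graph m s n r) ↔
      2 * ((r : ZMod n) ^ (2 * s) + 1) = 0 ∨ 2 * ((r : ZMod n) ^ (2 * s) - 1) = 0) ∧
    (IsArcTransitive (CPM.graph m s n r) → ¬ IsTwoArcTransitive (CPM.graph m s n r) →
      -- the Praeger–Xu case, where `M` is the even one of `m` and `2m` (and is `m` if both are even)
      (n = 4 ∧ ∃ M : ℕ, M = (if Even m then m else 2 * m) ∧
        Nonempty (CPM.graph m s n r ≃g CPM.graph M s 4 1) ∧
        Nonempty (CPM.graph m s n r ≃g praegerXu (M * s) s) ∧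
        HasVertexStabilizersOfOrder (CPM.graph m s n r) (2 ^ (s * (M - 1) + 1))) ∨
      -- the remaining case, where `Aut` is generated by `G` and the restriction of a reflection
      ((∃ η : CPM.graph m s n r ≃g CPM.graph m s n r,
          (((r : ZMod n) ^ (2 * s) + 1 = 0 ∨ (r : ZMod n) ^ (2 * s) - 1 = 0) ∧
              CPM.IsRestriction η (CPM.eta m s n r) ∨
            ¬ ((r : ZMod n) ^ (2 * s) + 1 = 0 ∨ (r : ZMod n) ^ (2 * s) - 1 = 0) ∧
              CPM.IsRestriction η (CPM.etaPrime m s n r)) ∧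
          Subgroup.closure ((CPM.group m s n r : Set _) ∪ {η}) = ⊤) ∧
        HasVertexStabilizersOfOrder (CPM.graph m s n r) (2 ^ (s + 1)))) := by
  have h : CPM.Admissible m s n r := ⟨hm, hs, hn, hr⟩
  refine ⟨h.isArcTransitive_iff, fun harc h2 => ?_⟩
  have hdich := h.preserves_or_reverses_of_not harc h2
  obtain ⟨η, hη, hηr⟩ : ∃ η : CPM.graph m s n r ≃g CPM.graph m s n r, CPM.Reverses η ∧
      (((r : ZMod n) ^ (2 * s) + 1 = 0 ∨ (r : ZMod n) ^ (2 * s) - 1 = 0) ∧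
          CPM.IsRestriction η (CPM.eta m s n r) ∨
        ¬ ((r : ZMod n) ^ (2 * s) + 1 = 0 ∨ (r : ZMod n) ^ (2 * s) - 1 = 0) ∧
          CPM.IsRestriction η (CPM.etaPrime m s n r)) := by
    by_cases hr' : (r : ZMod n) ^ (2 * s) + 1 = 0 ∨ (r : ZMod n) ^ (2 * s) - 1 = 0
    · obtain ⟨η, hη, hηr⟩ := CPM.exists_eta h hr'
      exact ⟨η, hη, Or.inl ⟨hr', hηr⟩⟩
    · obtain ⟨η, hη, hηr⟩ := CPM.exists_etaPrime h hr' (h.isArcTransitive_iff.1 harc)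
      exact ⟨η, hη, Or.inr ⟨hr', hηr⟩⟩
  by_cases hn4 : n = 4
  · subst hn4
    left
    obtain ⟨M, hM⟩ : ∃ M : ℕ, M = if Even m then m else 2 * m := ⟨_, rfl⟩
    have hMe : Even M := by rw [hM]; split_ifs with h0; exacts [h0, even_two_mul m]
    have hM1 : 1 ≤ M := by rw [hM]; split_ifs <;> omega
    have h' : CPM.Admissible M s 4 1 := ⟨hM1, hs, hn, Or.inr (by simp)⟩
    obtain ⟨Θ, -, -⟩ := CPM.exists_iso_praegerXu h hM
    obtain ⟨Θ', -, -⟩ := CPM.exists_iso_praegerXu h' (M := M) (by rw [if_pos hMe])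
    exact ⟨rfl, M, hM, ⟨Θ.symm.trans Θ'⟩, ⟨Θ.symm⟩,
      h.hasVertexStabilizersOfOrder hdich hη (CPM.card_preserving_four h hM)⟩
  · right
    exact ⟨⟨η, hηr, h.closure_eq_top hn4 hdich hη⟩,
      h.hasVertexStabilizersOfOrder hdich hη (h.card_preserving hn4)⟩
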